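/- Let $M$ be a smooth manifold of dimension $n$ and let $E,F\to M$ be smooth real vector bundles. Let $\mathcal M=\Pi E\oplus\Pi F$ be the supermanifold with coordinates $\phi^A=(x^i,\eta^a,c^\alpha)$ ($x$ even, $\eta,c$ odd, of ghost numbers $0,-1,1$), and $\mathcal N=\Pi T^*\mathcal M$ its odd cotangent bundle, with momenta $\phi^*_A=(x^*_i,\eta^*_a,c^*_\alpha)$ of ghost numbers $1,2,0$ and of parity opposite to that of $\phi^A$. On $\Pi T\mathcal N$, with velocities $d\phi^A,d\phi^*_A$, consider the canonical even Poisson bracket $$\{F,G\}=\sum_A(-1)^{A(F+1)}\Big(\tfrac{\partial F}{\partial d\phi^*_A}\tfrac{\partial G}{\partial\phi^A}+(-1)^F\tfrac{\partial F}{\partial d\phi^A}\tfrac{\partial G}{\partial\phi^*_A}\Big)-(-1)^{AF}\Big(\tfrac{\partial F}{\partial\phi^A}\tfrac{\partial G}{\partial d\phi^*_A}-(-1)^F\tfrac{\partial F}{\partial\phi^*_A}\tfrac{\partial G}{\partial d\phi^A}\Big),$$ where an index or a function in an exponent stands for its parity, the function $\Delta=\sum_A(-1)^A d\phi^A\,d\phi^*_A$,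 and the Lagrangian submanifold $\mathcal L=\Pi T\mathcal M=\{\phi^*=0=d\phi^*\}$. Functions $F,G$ on $\mathcal N$ have the odd bracket $(F,G)=\{\{\Delta,F\},G\}$. A differential form on $\mathcal M$ is a smooth function on $\mathcal L$ that is polynomial in $d\phi$. Let $S\in C^\infty(\mathcal N)$ be a master function: $S$ is even, of ghost number $2$, vanishes for $\phi^*=0$, and $(S,S)=0$. (Its terms of lowest degree are the constraints $T^a$, the gauge generators $R_\alpha$ and the weak Poisson bivector $P$.) Let $V\in C^\infty(\mathcal N)$ be a projectible weak Poisson vector field, extended to $\mathcal N$: $V$ is odd, of ghost number $1$, vanishes for $\phi^*=0$, and $(S,V)=0$. Put $\Psi=\{\Delta,S\}$ and $\Gamma=\{\Delta,V\}$, and for differential forms $\omega,\tau$ on $\mathcal M$ $$\hat Q\omega=\{\Psi,\omega\}|_{\mathcal L},\qquad [\omega,\tau]=\{\{\Psi,\omega\},\tau\}|_{\mathcal L},\qquad \mathcal L_V\omega=-\{\Gamma,\omega\}|_{\mathcal L}$$ (the differential, the weak Koszul bracket, the Lie derivative). A projectible form is a differential form $\omega$ on $\mathcal M$ (the extension of a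 form on $M$) with $\hat Q\omega=0$. Let $\omega,\tau$ be projectible forms such that $\mathcal L_V\omega$ and $\mathcal L_V\tau$ are zero in $\hat Q$-cohomology, i.e. are of the form $\hat Q\alpha$ with differential forms $\alpha$ on $\mathcal M$. Then $[\omega,\tau]$ is a projectible form and $\mathcal L_V[\omega,\tau]$ is zero in $\hat Q$-cohomology. -/

import Mathlib

open scoped Manifold ContDiff
open Bundle Set

noncomputable section

namespace WeakKoszul

/-! ## Superfunctions in local coordinates

The extended manifold `𝓜 = ΠE ⊕ ΠF` has coordinates `φ = (xⁱ, ηᵃ, cᵅ)` with `x` even and `η, c` odd;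
`𝓝 = ΠT*𝓜` has in addition the momenta `φ* = (x*ᵢ, η*ₐ, c*ₐ)` of opposite parity, and `ΠT𝓝` the
velocities `dφ, dφ*`, again with the parity reversed. We write `z = (η, c)` for the two kinds of odd
coordinates of `𝓜`. -/

/-- The index of `z = (η, c)`: `inl a` stands for `ηᵃ` and `inr α` for `cᵅ`. -/
abbrev Ghost (m k : ℕ) := Fin m ⊕ Fin k

/-- The even coordinates of `ΠT𝓝`. -/
inductive EvenCoord (n m k : ℕ) where
  | x (i : Fin n)
  | zStar (a : Ghost m k)
  | dz (a : Ghost m k)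
  | dxStar (i : Fin n)
  deriving DecidableEq, Fintype

/-- The odd coordinates of `ΠT𝓝`. -/
inductive OddCoord (n m k : ℕ) where
  | z (a : Ghost m k)
  | xStar (i : Fin n)
  | dx (i : Fin n)
  | dzStar (a : Ghost m k)
  deriving DecidableEq, Fintype

/-- The Grassmann algebra on the odd coordinates. -/
abbrev Grassmann (n m k : ℕ) := ExteriorAlgebra ℝ (OddCoord n m k → ℝ)

/-- Superfunctions: functions of the even coordinates with values in the Grassmann algebra, with the
pointwise product. -/
abbrev SFun (n m k : ℕ) := (EvenCoord n m k → ℝ) → Grassmann n m k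

variable {n m k : ℕ}

/-- The odd coordinate `o`, as an element of the Grassmann algebra. -/
def gen (o : OddCoord n m k) : Grassmann n m k :=
  ExteriorAlgebra.ι ℝ (Pi.single o 1)

/-- An even coordinate as a superfunction. -/
def evenVar (e : EvenCoord n m k) : SFun n m k := fun u => algebraMap ℝ _ (u e)

/-- An odd coordinate as a superfunction. -/
def oddVar (o : OddCoord n m k) : SFun n m k := fun _ => gen o

/-- The parity involution `F ↦ (-1)^F F`. -/
def parityInv (f : SFun n m k) : SFun n m k := fun u => CliffordAlgebra.involute (f u)

/-- Smoothness on a set: all real components are smooth. -/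
def SmoothOn (f : SFun n m k) (D : Set (EvenCoord n m k → ℝ)) : Prop :=
  ∀ l : Grassmann n m k →ₗ[ℝ] ℝ, ContDiffOn ℝ ∞ (fun u => l (f u)) D

/-- `w` is the partial derivative of `f` at `u` along the even coordinate `e`
(the Grassmann algebra has finite dimension, so this may be tested on linear functionals). -/
def HasEvenDeriv (e : EvenCoord n m k) (f : SFun n m k) (u : EvenCoord n m k → ℝ)
    (w : Grassmann n m k) : Prop :=
  ∀ l : Grassmann n m k →ₗ[ℝ] ℝ,
    HasDerivAt (fun t : ℝ => l (f (u + t • (Pi.single e 1 : EvenCoord n m k → ℝ)))) (l w) 0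

open Classical in
/-- The partial derivative along an even coordinate (`0` where it does not exist). -/
def evenDeriv (e : EvenCoord n m k) (f : SFun n m k) : SFun n m k := fun u =>
  if h : ∃ w, HasEvenDeriv e f u w then h.choose else 0

/-- The left partial derivative along an odd coordinate. -/
def oddDeriv (o : OddCoord n m k) (f : SFun n m k) : SFun n m k := fun u =>
  CliffordAlgebra.contractLeft (LinearMap.proj o : (OddCoord n m k → ℝ) →ₗ[ℝ] ℝ) (f u)

/-- Index of the coordinates `φᴬ`: `inl i` is `xⁱ`, of parity `0`; `inr a` is `zᵃ`, of parity `1`. -/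
abbrev Idx (n m k : ℕ) := Fin n ⊕ Ghost m k

/-- `(-1)^A`. -/
def sgn : Idx n m k → ℝ
  | .inl _ => 1
  | .inr _ => -1

/-- `(-1)^{AF} F`. -/
def twist : Idx n m k → SFun n m k → SFun n m k
  | .inl _, F => F
  | .inr _, F => parityInv F

/-- `∂/∂φᴬ`. -/
def dPhi : Idx n m k → SFun n m k → SFun n m k
  | .inl i => evenDeriv (.x i)
  | .inr a => oddDeriv (.z a)

/-- `∂/∂φ*_A`. -/
def dPhiStar : Idx n m k → SFun n m k → SFun n m k
  | .inl i => oddDeriv (.xStar i)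
  | .inr a => evenDeriv (.zStar a)

/-- `∂/∂(dφᴬ)`. -/
def dVel : Idx n m k → SFun n m k → SFun n m k
  | .inl i => oddDeriv (.dx i)
  | .inr a => evenDeriv (.dz a)

/-- `∂/∂(dφ*_A)`. -/
def dVelStar : Idx n m k → SFun n m k → SFun n m k
  | .inl i => evenDeriv (.dxStar i)
  | .inr a => oddDeriv (.dzStar a)

/-- The canonical even Poisson bracket of `ΠT𝓝`,
`{F,G} = (-1)^{A(F+1)} (∂F/∂(dφ*_A) ∂G/∂φᴬ + (-1)^F ∂F/∂(dφᴬ) ∂G/∂φ*_A)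
  - (-1)^{AF} (∂F/∂φᴬ ∂G/∂(dφ*_A) - (-1)^F ∂F/∂φ*_A ∂G/∂(dφᴬ))`,
extended bilinearly from homogeneous `F` (the signs that depend on `F` are put on `F`). -/
def bracket (F G : SFun n m k) : SFun n m k :=
  ∑ A : Idx n m k,
    (sgn A • (dVelStar A (twist A F) * dPhi A G
        + dVel A (twist A (parityInv F)) * dPhiStar A G)
      - (dPhi A (twist A F) * dVelStar A G
        - dPhiStar A (twist A (parityInv F)) * dVel A G))

/-- `Δ = (-1)^A dφᴬ dφ*_A`. -/
def Delta (n m k : ℕ) : SFun n m k :=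
  ∑ i : Fin n, oddVar (.dx i) * evenVar (.dxStar i)
    - ∑ a : Ghost m k, evenVar (.dz a) * oddVar (.dzStar a)

/-- The odd Poisson bracket `(F,G) = {{Δ,F},G}` of functions `F, G` on `𝓝`
(for such functions the right-hand side contains no velocities). -/
def oddBracket (F G : SFun n m k) : SFun n m k := bracket (bracket (Delta n m k) F) G

/-- Setting to zero the coordinates outside of the given sets. -/
def setToZero (pe : EvenCoord n m k → Bool) (po : OddCoord n m k → Bool) (f : SFun n m k) :
    SFun n m k := fun u =>
  ExteriorAlgebra.map
    (LinearMap.pi fun o => if po o then LinearMap.proj o else 0 :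
      (OddCoord n m k → ℝ) →ₗ[ℝ] (OddCoord n m k → ℝ))
    (f fun e => if pe e then u e else 0)

/-- Restriction to `𝓝 ⊂ ΠT𝓝`: all velocities are set to zero. A superfunction is (the pullback of)
a function on `𝓝` if this does not change it. -/
def restrictN : SFun n m k → SFun n m k :=
  setToZero (fun | .x _ => true | .zStar _ => true | .dz _ => false | .dxStar _ => false)
    (fun | .z _ => true | .xStar _ => true | .dx _ => false | .dzStar _ => false)

/-- Restriction to the Lagrangian submanifold `𝓛 = ΠT𝓜 = {φ* = 0 = dφ*}`. -/
def restrictL : SFun n m k → SFun n m k :=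
  setToZero (fun | .x _ => true | .zStar _ => false | .dz _ => true | .dxStar _ => false)
    (fun | .z _ => true | .xStar _ => false | .dx _ => true | .dzStar _ => false)

/-- Restriction to `𝓜`: only the coordinates `φ` are kept. -/
def restrictM : SFun n m k → SFun n m k :=
  setToZero (fun | .x _ => true | .zStar _ => false | .dz _ => false | .dxStar _ => false)
    (fun | .z _ => true | .xStar _ => false | .dx _ => false | .dzStar _ => false)

/-- Ghost numbers of the even coordinates of `ΠT𝓝`. -/
def ghEven : EvenCoord n m k → ℝ
  | .x _ => 0
  | .zStar (.inl _) => 2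
  | .zStar (.inr _) => 0
  | .dz (.inl _) => -2
  | .dz (.inr _) => 0
  | .dxStar _ => 0

/-- Ghost numbers of the odd coordinates of `ΠT𝓝`. -/
def ghOdd : OddCoord n m k → ℝ
  | .z (.inl _) => -1
  | .z (.inr _) => 1
  | .xStar _ => 1
  | .dx _ => -1
  | .dzStar (.inl _) => 1
  | .dzStar (.inr _) => -1

/-- The Euler vector field of the ghost grading; `f` has ghost number `l` iff it multiplies `f` by
`l`. -/
def ghostEuler (f : SFun n m k) : SFun n m k :=
  ∑ e, ghEven e • (evenVar e * evenDeriv e f) + ∑ o, ghOdd o • (oddVar o * oddDeriv o f)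

/-- The lift `{Δ,F}` to `ΠT𝓝` of a function `F` on `𝓝`: `Ψ = {Δ,S}` and `Γ = {Δ,V}`. -/
def lift (F : SFun n m k) : SFun n m k := bracket (Delta n m k) F

/-- The exterior differential `d = {Δ,-}|_𝓛`. -/
def extDeriv (θ : SFun n m k) : SFun n m k := restrictL (bracket (Delta n m k) θ)

/-- `Q̂ = {Ψ,-}|_𝓛`. -/
def Qhat (S θ : SFun n m k) : SFun n m k := restrictL (bracket (lift S) θ)

/-- The weak Koszul bracket `[θ,τ] = {{Ψ,θ},τ}|_𝓛`. -/
def koszul (S θ τ : SFun n m k) : SFun n m k := restrictL (bracket (bracket (lift S) θ) τ)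

/-- The Lie derivative `L_V θ = (-1)^V {Γ,θ}|_𝓛` along the odd function `V`. -/
def lieDer (V θ : SFun n m k) : SFun n m k := -restrictL (bracket (lift V) θ)

/-! ## Global functions

A global object is a family of local expressions, one in each system of coordinates that comes from a
chart of `M` and local trivializations of `E` and `F`, related by the changes of coordinates. -/

section Global

variable {M : Type*} [TopologicalSpace M] [ChartedSpace (Fin n → ℝ) M]
  {E : M → Type*} [TopologicalSpace (TotalSpace (Fin m → ℝ) E)]
  [∀ p, AddCommGroup (E p)] [∀ p, Module ℝ (E p)] [∀ p, TopologicalSpace (E p)]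
  [FiberBundle (Fin m → ℝ) E] [VectorBundle ℝ (Fin m → ℝ) E]
  {F : M → Type*} [TopologicalSpace (TotalSpace (Fin k → ℝ) F)]
  [∀ p, AddCommGroup (F p)] [∀ p, Module ℝ (F p)] [∀ p, TopologicalSpace (F p)]
  [FiberBundle (Fin k → ℝ) F] [VectorBundle ℝ (Fin k → ℝ) F]

variable (n m k E F) in
/-- A chart of `M` together with local trivializations of `E` and `F`. -/
structure SuperChart where
  chart : OpenPartialHomeomorph M (Fin n → ℝ)
  chart_mem : chart ∈ atlas (Fin n → ℝ) M
  trivE : Trivialization (Fin m → ℝ) (π (Fin m → ℝ) E)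
  memE : MemTrivializationAtlas trivE
  trivF : Trivialization (Fin k → ℝ) (π (Fin k → ℝ) F)
  memF : MemTrivializationAtlas trivF

attribute [instance] SuperChart.memE SuperChart.memF

/-- The open subset of `M` on which the coordinates are defined. -/
def SuperChart.base (c : SuperChart n m k E F) : Set M :=
  c.chart.source ∩ (c.trivE.baseSet ∩ c.trivF.baseSet)

/-- The part `x` of the even coordinates. -/
def xPart (u : EvenCoord n m k → ℝ) : Fin n → ℝ := fun i => u (.x i)

/-- The point of `M` with the coordinates `x`. -/
def SuperChart.point (c : SuperChart n m k E F) (u : EvenCoord n m k → ℝ) : M :=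
  c.chart.symm (xPart u)

/-- The values of the even coordinates over the subset `D` of `M`. -/
def SuperChart.region (c : SuperChart n m k E F) (D : Set M) : Set (EvenCoord n m k → ℝ) :=
  {u | xPart u ∈ c.chart.target ∧ c.point u ∈ D}

/-- The domain of the coordinate system. -/
def SuperChart.dom (c : SuperChart n m k E F) : Set (EvenCoord n m k → ℝ) := c.region c.base

/-- The transition matrix `T_b^a(p)` of the fibre coordinates, `z'ᵃ = zᵇ T_b^a`. -/
def ghostTrans (c c' : SuperChart n m k E F) (p : M) : Ghost m k → Ghost m k → ℝ
  | .inl b, .inl a => c.trivE.coordChangeL ℝ c'.trivE p (Pi.single b 1) a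
  | .inr b, .inr a => c.trivF.coordChangeL ℝ c'.trivF p (Pi.single b 1) a
  | _, _ => 0

/-- The even coordinates `(x', z*')` of the second system in terms of those of the first:
`z*'_a = T'_a^b z*_b` with `T'` the inverse of `T`. (Only used for functions on `𝓝`; the velocities
are set to zero.) -/
def transEven (c c' : SuperChart n m k E F) (u : EvenCoord n m k → ℝ) : EvenCoord n m k → ℝ
  | .x i => c'.chart (c.point u) i
  | .zStar a => ∑ b, ghostTrans c' c (c.point u) a b * u (.zStar b)
  | .dz _ => 0
  | .dxStar _ => 0

/-- The odd coordinates of the second system in terms of those of the first: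
`z'ᵃ = zᵇ T_b^a` and
`x*'_i = (∂xʲ/∂x'ⁱ) x*_j + z'ᵃ (∂T'_a^b/∂x'ⁱ) z*_b`,
the law by which the canonical momenta transform. -/
def transOddGen (c c' : SuperChart n m k E F) (u : EvenCoord n m k → ℝ) :
    OddCoord n m k → (OddCoord n m k → ℝ)
  | .z a => ∑ b, ghostTrans c c' (c.point u) b a • Pi.single (.z b) 1
  | .xStar i =>
      ∑ j, fderiv ℝ (fun y => c.chart (c'.chart.symm y)) (c'.chart (c.point u)) (Pi.single i 1) j •
          Pi.single (.xStar j) 1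
        + ∑ a, ∑ b,
          (fderiv ℝ (fun y => ghostTrans c' c (c'.chart.symm y) a b) (c'.chart (c.point u))
              (Pi.single i 1) * u (.zStar b)) •
            ∑ d, ghostTrans c c' (c.point u) d a • Pi.single (.z d) 1
  | .dx _ => 0
  | .dzStar _ => 0

/-- The pullback to the first coordinate system of a function on `𝓝` expressed in the second. -/
def pullback (c c' : SuperChart n m k E F) (f' : SFun n m k) : SFun n m k := fun u =>
  ExteriorAlgebra.map (Fintype.linearCombination ℝ (transOddGen c c' u)) (f' (transEven c c' u))

/-- The family `f` is a smooth function on `𝓝`. -/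
structure IsFunctionN (f : SuperChart n m k E F → SFun n m k) : Prop where
  smooth : ∀ c, SmoothOn (f c) c.dom
  noVelocity : ∀ c, EqOn (restrictN (f c)) (f c) c.dom
  glue : ∀ c c', EqOn (f c) (pullback c c' (f c')) (c.region (c.base ∩ c'.base))

/-- `FormTrans c c' D θ θ'`: over the open subset `D` of `M`, the expressions `θ` and `θ'` are
fibrewise polynomial differential forms on `𝓜` in the coordinates `c` and `c'` respectively, and the
change of coordinates takes `θ'` to `θ`. The change of coordinates of forms is the homomorphism of
algebras that commutes with `d` and is the substitution of coordinates on functions on `𝓜`; as forms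
are sums of products of functions and differentials of functions, this is its graph. -/
inductive FormTrans (c c' : SuperChart n m k E F) (D : Set M) : SFun n m k → SFun n m k → Prop
  | fn (f f' : SFun n m k) (hf : SmoothOn f (c.region D)) (hf' : SmoothOn f' (c'.region D))
      (hM : EqOn (restrictM f) f (c.region D)) (hM' : EqOn (restrictM f') f' (c'.region D))
      (h : EqOn f (pullback c c' f') (c.region D)) : FormTrans c c' D f f'
  | add {θ₁ θ₁' θ₂ θ₂' : SFun n m k} (h₁ : FormTrans c c' D θ₁ θ₁')
      (h₂ : FormTrans c c' D θ₂ θ₂') : FormTrans c c' D (θ₁ + θ₂) (θ₁' + θ₂')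
  | mul {θ₁ θ₁' θ₂ θ₂' : SFun n m k} (h₁ : FormTrans c c' D θ₁ θ₁')
      (h₂ : FormTrans c c' D θ₂ θ₂') : FormTrans c c' D (θ₁ * θ₂) (θ₁' * θ₂')
  | d {θ θ' : SFun n m k} (h : FormTrans c c' D θ θ') :
      FormTrans c c' D (extDeriv θ) (extDeriv θ')
  | congr {θ θ' θ₁ θ₁' : SFun n m k} (h : FormTrans c c' D θ θ')
      (e : EqOn θ θ₁ (c.region D)) (e' : EqOn θ' θ₁' (c'.region D)) : FormTrans c c' D θ₁ θ₁'

/-- The family `θ` is a (fibrewise polynomial) differential form on `𝓜`, i.e. an element of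
`Ω(𝓜) ⊂ C^∞(𝓛)`. -/
def IsForm (θ : SuperChart n m k E F → SFun n m k) : Prop :=
  ∀ c c' : SuperChart n m k E F, ∀ p ∈ c.base ∩ c'.base,
    ∃ D : Set M, IsOpen D ∧ p ∈ D ∧ D ⊆ c.base ∩ c'.base ∧ FormTrans c c' D (θ c) (θ c')

/-- A master function: an even function on `𝓝` of ghost number `2` and positive momentum degree such
that `(S,S) = 0`. -/
structure IsMasterFunction (S : SuperChart n m k E F → SFun n m k) : Prop
    extends IsFunctionN S where
  even : ∀ c, EqOn (parityInv (S c)) (S c) c.dom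
  ghost : ∀ c, EqOn (ghostEuler (S c)) ((2 : ℝ) • S c) c.dom
  momentum : ∀ c, EqOn (restrictM (S c)) 0 c.dom
  master : ∀ c, EqOn (oddBracket (S c) (S c)) 0 c.dom

/-- A weak Poisson vector field (extended to `𝓝`): an odd function on `𝓝` of ghost number `1` and
positive momentum degree such that `(S,V) = 0`. -/
structure IsWeakPoissonField (S V : SuperChart n m k E F → SFun n m k) : Prop
    extends IsFunctionN V where
  odd : ∀ c, EqOn (parityInv (V c)) (-V c) c.dom
  ghost : ∀ c, EqOn (ghostEuler (V c)) (V c) c.dom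
  momentum : ∀ c, EqOn (restrictM (V c)) 0 c.dom
  master : ∀ c, EqOn (oddBracket (S c) (V c)) 0 c.dom

/-- A projectible form (extended to `𝓛`): a differential form that is a `Q̂`-cocycle. -/
structure IsProjectibleForm (S θ : SuperChart n m k E F → SFun n m k) : Prop where
  isForm : IsForm θ
  cocycle : ∀ c, EqOn (Qhat (S c) (θ c)) 0 c.dom

/-- `θ` is zero in `Q̂`-cohomology: it is the `Q̂`-coboundary of a differential form. -/
def ZeroInCohomology (S θ : SuperChart n m k E F → SFun n m k) : Prop :=
  ∃ α : SuperChart n m k E F → SFun n m k, IsForm α ∧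
    ∀ c, EqOn (θ c) (Qhat (S c) (α c)) c.dom

end Global

end WeakKoszul

end

open WeakKoszul

namespace WeakKoszul

noncomputable section

set_option linter.unusedSectionVars false

/-! ## Superalgebras with Darboux coordinates -/

/-! Both claims follow from the Jacobi identity and from the Lagrangian property of `𝓛`. The bracket
with `Δ` squares to zero (`lft_lft`) and is a derivation of the bracket, so `(S,S) = 0` and `(S,V) =
0` become `{Ψ,Ψ} = 0` and `{Γ,Ψ} = 0` (`br_lft_lft`). As `S`, `V` and `Δ` vanish on `𝓛`, so do `Ψ`
and `Γ`. Functions vanishing on `𝓛` are closed under the bracket (`r_br_eq_zero`); hence for such a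
function `F` the restriction of `{F,G}` to `𝓛` only depends on the restriction of `G` (`r_br_r`).

Write `ω'` for `ω` with the parity involution applied. Jacobi gives `{Ψ,{{Ψ,ω},τ}} =
-{{Ψ,ω'},{Ψ,τ}}` (`br_lft_kos`). For cocycles both factors on the right vanish on `𝓛`, hence so does
their bracket (`r_br_kos`). The even function `Γ` commutes with `Ψ`, so `{Γ,-}` distributes over `ω`
and `τ` in `{{Ψ,ω},τ}`. If `L_V ω = Q̂α` and `L_V τ = Q̂β`, then `L_V[ω,τ]` is `Q̂` of
`-{{Γ,ω},τ}|_𝓛 - [α,τ] - [ω',β]` (`r_br_field_kos`). The first term is needed because `{Γ,ω}` and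
`-{Ψ,α}` agree on `𝓛` only, whereas `{{Ψ,-},τ}` also sees derivatives normal to `𝓛`.

These brackets must moreover be differential forms globally, that is, correspond under the changes
of coordinates generated by functions, products and `d`. The weak Koszul bracket is a biderivation
(`kos_mul`), is compatible with `d` (`kos_lft_left`) and symmetric (`kos_symm`). This reduces the
question to functions `f`, `g` on `𝓜`, where `[f,g] = 0` and `[df,g] = -((S,f),g)|_𝓛`, with the
analogue up to sign for `V` (`FormRel.kos`). What is left is the invariance of the odd bracket of a
function on `𝓝` with a function on `𝓜`, a chain rule computation (`oddBracket_eqOn_pullback`,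
`canonical_sum_eq`).

The identities are proved in an abstract `SuperCalculus`. Its model `smoothCalc` consists of
superfunctions over an open set, considered only where they are smooth, so that partial derivatives
are total operations; `Rep` transports statements between the two levels. -/

/-- The coordinates of `ΠT𝓝`. -/
abbrev Coord (n m k : ℕ) := EvenCoord n m k ⊕ OddCoord n m k

variable {n m k : ℕ}

namespace Coord

/-- The coordinate that is conjugate for the Poisson bracket. -/
def conj : Coord n m k → Coord n m k
  | .inl (.x i) => .inl (.dxStar i)
  | .inl (.dxStar i) => .inl (.x i)
  | .inl (.zStar a) => .inl (.dz a)
  | .inl (.dz a) => .inl (.zStar a)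
  | .inr (.z a) => .inr (.dzStar a)
  | .inr (.dzStar a) => .inr (.z a)
  | .inr (.xStar i) => .inr (.dx i)
  | .inr (.dx i) => .inr (.xStar i)

/-- The sign of a coordinate in the Poisson bracket. -/
def eps : Coord n m k → ℝ
  | .inl (.x _) => -1
  | .inl (.dxStar _) => 1
  | .inl (.zStar _) => 1
  | .inl (.dz _) => -1
  | .inr (.z _) => -1
  | .inr (.dzStar _) => -1
  | .inr (.xStar _) => 1
  | .inr (.dx _) => 1

/-- The parity of a coordinate. -/
def odd : Coord n m k → Bool
  | .inl _ => false
  | .inr _ => true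

/-- The coordinates of the Lagrangian submanifold `𝓛`. -/
def tang : Coord n m k → Bool
  | .inl (.x _) => true
  | .inl (.dz _) => true
  | .inr (.z _) => true
  | .inr (.dx _) => true
  | _ => false

/-- The velocities. -/
def vel : Coord n m k → Bool
  | .inl (.dxStar _) => true
  | .inl (.dz _) => true
  | .inr (.dzStar _) => true
  | .inr (.dx _) => true
  | _ => false

@[simp] lemma conj_conj (w : Coord n m k) : conj (conj w) = w := by
  rcases w with (_ | _ | _ | _) | (_ | _ | _ | _) <;> rfl

@[simp] lemma odd_conj (w : Coord n m k) : odd (conj w) = odd w := by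
  rcases w with (_ | _ | _ | _) | (_ | _ | _ | _) <;> rfl

@[simp] lemma tang_conj (w : Coord n m k) : tang (conj w) = !tang w := by
  rcases w with (_ | _ | _ | _) | (_ | _ | _ | _) <;> rfl

@[simp] lemma vel_conj (w : Coord n m k) : vel (conj w) = !vel w := by
  rcases w with (_ | _ | _ | _) | (_ | _ | _ | _) <;> rfl

/-- The sign changes within an even conjugate pair and is constant within an odd one, as graded
skew-symmetry (`br_skew`) requires. -/
lemma eps_conj (w : Coord n m k) : eps (conj w) = if odd w then eps w else -eps w := by
  rcases w with (_ | _ | _ | _) | (_ | _ | _ | _) <;> simp [conj, eps, odd]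

/-- Conjugation as a permutation of the coordinates. -/
def conjEquiv : Coord n m k ≃ Coord n m k := ⟨conj, conj, conj_conj, conj_conj⟩

lemma sum_conj {A : Type*} [AddCommMonoid A] (f : Coord n m k → A) :
    ∑ w, f (conj w) = ∑ w, f w :=
  Equiv.sum_comp conjEquiv f

end Coord

open Coord

/-- A superalgebra with a superderivation for every coordinate of `ΠT𝓝` and a
restriction to `𝓛`. -/
structure SuperCalculus (n m k : ℕ) (R : Type*) [Ring R] [Algebra ℝ R] where
  /-- the parity involution -/
  inv : R →ₐ[ℝ] R
  inv_inv : ∀ a, inv (inv a) = a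
  comm_of_even : ∀ a, inv a = a → ∀ b, a * b = b * a
  comm_of_odd : ∀ a, inv a = -a → ∀ b, a * b = inv b * a
  /-- the partial derivatives -/
  pd : Coord n m k → R →ₗ[ℝ] R
  pd_mul : ∀ w a b, pd w (a * b) = pd w a * b + (if odd w then inv a else a) * pd w b
  inv_pd : ∀ w a, inv (pd w a) = if odd w then -pd w (inv a) else pd w (inv a)
  pd_comm : ∀ v w a, pd v (pd w a) = if odd v && odd w then -pd w (pd v a) else pd w (pd v a)
  /-- the coordinates -/
  X : Coord n m k → R
  inv_X : ∀ w, inv (X w) = if odd w then -X w else X w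
  pd_X : ∀ v w, pd v (X w) = if v = w then 1 else 0
  /-- the restriction to `𝓛` -/
  r : R →ₐ[ℝ] R
  r_r : ∀ a, r (r a) = r a
  r_inv : ∀ a, r (inv a) = inv (r a)
  r_pd : ∀ w a, tang w → r (pd w a) = pd w (r a)
  pd_r : ∀ w a, ¬ tang w → pd w (r a) = 0
  r_X : ∀ w, r (X w) = if tang w then X w else 0

namespace SuperCalculus

lemma eq_zero_of_eq_neg {A : Type*} [AddCommGroup A] [Module ℝ A] {a : A} (h : a = -a) : a = 0 := by
  have : (2 : ℝ) • a = 0 := by rw [two_smul]; nth_rewrite 2 [h]; simp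
  simpa using this

variable {R : Type*} [Ring R] [Algebra ℝ R] (C : SuperCalculus n m k R)

/-- The power of the parity involution. -/
def tau (p : Bool) : R →ₐ[ℝ] R := if p then C.inv else AlgHom.id ℝ R

@[simp] lemma tau_true (a : R) : C.tau true a = C.inv a := rfl
@[simp] lemma tau_false (a : R) : C.tau false a = a := rfl

/-- Homogeneity of parity `p`. -/
def Homog (p : Bool) (a : R) : Prop := C.inv a = if p then -a else a

/-- The Poisson bracket. -/
def br (F G : R) : R :=
  ∑ w, eps w • (C.pd w (C.tau (odd w) F) * C.pd (conj w) G)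

lemma br_add_right (F G H : R) : C.br F (G + H) = C.br F G + C.br F H := by
  simp [br, mul_add, Finset.sum_add_distrib]

lemma br_add_left (F G H : R) : C.br (F + G) H = C.br F H + C.br G H := by
  simp [br, add_mul, Finset.sum_add_distrib]

lemma br_neg_right (F G : R) : C.br F (-G) = -C.br F G := by
  simp [br]

lemma br_neg_left (F G : R) : C.br (-F) G = -C.br F G := by
  simp [br]

lemma br_sub_right (F G H : R) : C.br F (G - H) = C.br F G - C.br F H := by
  rw [sub_eq_add_neg, br_add_right, br_neg_right, ← sub_eq_add_neg]

lemma br_sub_left (F G H : R) : C.br (F - G) H = C.br F H - C.br G H := by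
  rw [sub_eq_add_neg, br_add_left, br_neg_left, ← sub_eq_add_neg]

@[simp] lemma br_zero_right (F : R) : C.br F 0 = 0 := by simp [br]

@[simp] lemma br_zero_left (F : R) : C.br 0 F = 0 := by simp [br]

lemma br_sum_right {ι : Type*} (s : Finset ι) (F : R) (G : ι → R) :
    C.br F (∑ i ∈ s, G i) = ∑ i ∈ s, C.br F (G i) := by
  classical
  induction s using Finset.induction_on with
  | empty => simp
  | insert a s ha ih => simp [Finset.sum_insert ha, br_add_right, ih]

lemma br_smul_right (c : ℝ) (F G : R) : C.br F (c • G) = c • C.br F G := by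
  simp [br, Finset.smul_sum, smul_comm c]

lemma inv_br (F G : R) : C.inv (C.br F G) = C.br (C.inv F) (C.inv G) := by
  simp only [br, map_sum, map_smul, map_mul, C.inv_pd, odd_conj]
  refine Finset.sum_congr rfl fun w _ => ?_
  cases odd w <;> simp

lemma tau_br (p : Bool) (F G : R) : C.tau p (C.br F G) = C.br (C.tau p F) (C.tau p G) := by
  cases p <;> simp [inv_br]

variable {C} in
lemma Homog.tau_eq {p : Bool} {a : R} (h : C.Homog p a) (q : Bool) :
    C.tau q a = if p && q then -a else a := by
  unfold Homog at h
  cases p <;> cases q <;> simp_all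

variable {C} in
lemma Homog.pd {p : Bool} {a : R} (h : C.Homog p a) (w : Coord n m k) :
    C.Homog (xor (odd w) p) (C.pd w a) := by
  unfold Homog at *
  rw [C.inv_pd, h]
  cases odd w <;> cases p <;> simp

variable {C} in
lemma Homog.mul_comm {p : Bool} {a : R} (h : C.Homog p a) (b : R) :
    a * b = C.tau p b * a := by
  unfold Homog at *
  cases p
  · exact C.comm_of_even a (by simpa using h) b
  · exact C.comm_of_odd a (by simpa using h) b

variable {C} in
lemma Homog.br {p q : Bool} {a b : R} (ha : C.Homog p a) (hb : C.Homog q b) :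
    C.Homog (xor p q) (C.br a b) := by
  unfold Homog at *
  rw [inv_br, ha, hb]
  cases p <;> cases q <;> simp [br_neg_left, br_neg_right]

/-- The bracket with a homogeneous function is a superderivation. -/
lemma br_mul {p : Bool} {D : R} (hD : C.Homog p D) (F G : R) :
    C.br D (F * G) = C.br D F * G + C.tau p F * C.br D G := by
  simp only [br, Finset.sum_mul, Finset.mul_sum, ← Finset.sum_add_distrib]
  refine Finset.sum_congr rfl fun w _ => ?_
  -- Moving the derivative of `D` to the right past a factor built from `F` produces the sign `tau
  -- p` of the Leibniz rule.
  have h₁ := (hD.pd w).mul_comm (C.pd (conj w) F)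
  have h₂ := (hD.pd w).mul_comm (if odd w then C.inv F else F)
  rw [hD.tau_eq, C.pd_mul, odd_conj]
  cases hw : odd w <;> cases p <;>
    simp [hw, mul_add, ← mul_assoc, C.inv_inv] at h₁ h₂ ⊢ <;>
    simp [*]

/-- A coordinate derivative is a superderivation of the bracket. -/
lemma pd_br (w : Coord n m k) (F G : R) :
    C.pd w (C.br F G) = C.br (C.pd w F) G + C.br (C.tau (odd w) F) (C.pd w G) := by
  simp only [br, map_sum, map_smul, ← Finset.sum_add_distrib]
  refine Finset.sum_congr rfl fun v _ => ?_
  rw [C.pd_mul, C.pd_comm w v, C.pd_comm w (conj v), odd_conj]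
  cases hw : odd w <;> cases hv : odd v <;>
    simp [C.inv_pd, C.inv_inv, hw, hv, smul_add]

/-- The bracket is skew-symmetric. -/
lemma br_skew {q : Bool} {G : R} (hG : C.Homog q G) (F : R) :
    C.br F G = -C.br G (C.tau q F) := by
  -- Reindexing by `conj` exchanges the two members of every conjugate pair.
  rw [br, br, ← sum_conj, ← Finset.sum_neg_distrib]
  refine Finset.sum_congr rfl fun w _ => ?_
  have h := (hG.pd w).mul_comm (C.pd (conj w) (C.tau q F))
  rw [hG.tau_eq, eps_conj, odd_conj, conj_conj]
  cases hw : odd w <;> cases q <;> simp [hw, C.inv_pd, C.inv_inv] at h ⊢ <;> simp [h]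

/-- The mirror image of `br_mul` under skew-symmetry. -/
lemma br_mul_left {q : Bool} {H : R} (hH : C.Homog q H) (F G : R) :
    C.br (F * G) H = F * C.br G H + C.br F H * C.tau q G := by
  rw [C.br_skew hH, C.br_skew hH, C.br_skew hH F, map_mul, C.br_mul hH]
  cases q <;> simp [C.inv_inv]

/-- The Jacobi identity. -/
lemma jacobi {p : Bool} {D : R} (hD : C.Homog p D) (F G : R) :
    C.br D (C.br F G) = C.br (C.br D F) G + C.br (C.tau p F) (C.br D G) := by
  -- `pd_br` solved for the bracket with `∂_w H`: the operators `{D,-}` and `∂_w` commute up to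
  -- `{∂_w D,-}`.
  have key : ∀ (w : Coord n m k) (H : R),
      C.br D (C.pd w H) = (if p && odd w then -1 else 1 : ℝ) •
        (C.pd w (C.br D H) - C.br (C.pd w D) H) := by
    intro w H
    rw [pd_br, hD.tau_eq]
    cases p <;> cases odd w <;> simp [br_neg_left]
  have h1 : C.br D (C.br F G) = ∑ w, eps w •
      (C.br D (C.pd w (C.tau (odd w) F)) * C.pd (conj w) G +
        C.tau p (C.pd w (C.tau (odd w) F)) * C.br D (C.pd (conj w) G)) := by
    conv_lhs => rw [br.eq_def C F G, br_sum_right]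
    simp only [br_smul_right, C.br_mul hD]
  -- By `key` the terms in which `∂_w` hits a whole bracket cancel. The Jacobi defect consists of
  -- brackets with first derivatives of `D`, hence of second derivatives of `D`.
  have h2 : C.br (C.br D F) G + C.br (C.tau p F) (C.br D G) - C.br D (C.br F G) =
      ∑ w, ((if p && odd w then -1 else 1 : ℝ) * eps w) •
        (C.br (C.pd w D) (C.tau (odd w) F) * C.pd (conj w) G) +
      ∑ w, ((if p && odd w then -1 else 1 : ℝ) * eps w) •
        (C.tau p (C.pd w (C.tau (odd w) F)) * C.br (C.pd (conj w) D) G) := by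
    rw [h1, br.eq_def C (C.br D F) G, br.eq_def C (C.tau p F), ← Finset.sum_add_distrib,
      ← Finset.sum_add_distrib, ← Finset.sum_sub_distrib]
    refine Finset.sum_congr rfl fun w _ => ?_
    rw [key, key, tau_br, hD.tau_eq, odd_conj]
    cases hw : odd w <;> cases p <;>
      simp [hw, br_neg_left, C.inv_pd, C.inv_inv, sub_mul, mul_sub, smul_add, smul_sub, add_mul, mul_add] <;>
      abel
  have h3 : ∑ w, ((if p && odd w then -1 else 1 : ℝ) * eps w) •
        (C.br (C.pd w D) (C.tau (odd w) F) * C.pd (conj w) G) =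
      ∑ w, ∑ v, ((if p && odd w then -1 else 1 : ℝ) * eps w * eps v) •
        (C.pd v (C.tau (odd v) (C.pd w D)) * C.pd (conj v) (C.tau (odd w) F) *
          C.pd (conj w) G) := by
    simp only [br, Finset.sum_mul, Finset.smul_sum, smul_mul_assoc, smul_smul]
  -- The two dummy indices are exchanged and one is replaced by its conjugate, so that the terms
  -- match those of `h3` one by one.
  have h4 : ∑ w, ((if p && odd w then -1 else 1 : ℝ) * eps w) •
        (C.tau p (C.pd w (C.tau (odd w) F)) * C.br (C.pd (conj w) D) G) =
      ∑ w, ∑ v, ((if p && odd v then -1 else 1 : ℝ) * eps (conj v) * eps w) •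
        (C.tau p (C.pd (conj v) (C.tau (odd v) F)) *
          (C.pd w (C.tau (odd w) (C.pd v D)) * C.pd (conj w) G)) := by
    rw [Finset.sum_comm, ← sum_conj]
    simp only [br, Finset.mul_sum, Finset.smul_sum, mul_smul_comm, smul_smul, odd_conj, conj_conj]
  have h5 : C.br (C.br D F) G + C.br (C.tau p F) (C.br D G) - C.br D (C.br F G) = 0 := by
    rw [h2, h3, h4, ← Finset.sum_add_distrib]
    refine Finset.sum_eq_zero fun w _ => ?_
    rw [← Finset.sum_add_distrib]
    refine Finset.sum_eq_zero fun v _ => ?_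
    -- Second derivatives of `D` commute up to sign; moved past the derivative of `F`, they make the
    -- terms of `h3` and `h4` opposite.
    have h := ((hD.pd v).pd w).mul_comm
    rw [(hD.pd w).tau_eq, (hD.pd v).tau_eq, eps_conj]
    cases hw : odd w <;> cases hv : odd v <;> cases p <;>
      simp [hw, hv, C.inv_pd, C.inv_inv, C.pd_comm v w, ← mul_assoc] at h ⊢ <;>
      simp [h, C.inv_pd, C.inv_inv, hv, mul_comm]
  exact (sub_eq_zero.mp h5).symm

/-- Functions that vanish on `𝓛` are closed under the bracket. -/
lemma r_br_eq_zero {F G : R} (hF : C.r F = 0) (hG : C.r G = 0) : C.r (C.br F G) = 0 := by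
  simp only [br, map_sum, map_smul, map_mul]
  refine Finset.sum_eq_zero fun w _ => ?_
  -- Exactly one member of a conjugate pair is tangent to `𝓛`, and a tangential derivative of a
  -- function vanishing on `𝓛` vanishes on `𝓛`.
  by_cases hw : tang w
  · rw [C.r_pd w _ hw]
    cases odd w <;> simp [hF, C.r_inv]
  · rw [C.r_pd (conj w) _ (by simpa using hw)]
    simp [hG]

/-- Restriction to `𝓛` after a bracket with a function that vanishes on `𝓛`. -/
lemma r_br_r {F : R} (hF : C.r F = 0) (G : R) : C.r (C.br F (C.r G)) = C.r (C.br F G) := by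
  rw [← sub_eq_zero, ← map_sub, ← br_sub_right]
  exact C.r_br_eq_zero hF (by simp [C.r_r])

lemma r_br_r_left {G : R} (hG : C.r G = 0) (F : R) : C.r (C.br (C.r F) G) = C.r (C.br F G) := by
  rw [← sub_eq_zero, ← map_sub, ← br_sub_left]
  exact C.r_br_eq_zero (by simp [C.r_r]) hG

/-- Functions on `𝓛` commute. -/
lemma br_of_r {F G : R} (hF : C.r F = F) (hG : C.r G = G) : C.br F G = 0 := by
  refine Finset.sum_eq_zero fun w _ => ?_
  -- One member of each pair is normal to `𝓛`, and functions pulled back from `𝓛` do not depend on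
  -- it.
  by_cases hw : tang w
  · rw [← hG, C.pd_r (conj w) _ (by simpa using hw)]; simp
  · have : C.tau (odd w) F = C.r (C.tau (odd w) F) := by cases odd w <;> simp [C.r_inv, hF]
    rw [this, C.pd_r w _ hw]; simp

/-- Functions without velocities. -/
def NoVel (F : R) : Prop := ∀ w, vel w → C.pd w F = 0

variable {C} in
lemma NoVel.inv {F : R} (hF : C.NoVel F) : C.NoVel (C.inv F) := by
  intro w hw
  have := C.inv_pd w F
  rw [hF w hw] at this
  cases h : odd w <;> simp_all

/-- Each conjugate pair contains exactly one velocity, so every term has a vanishing factor. -/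
lemma br_of_noVel {F G : R} (hF : C.NoVel F) (hG : C.NoVel G) : C.br F G = 0 := by
  refine Finset.sum_eq_zero fun w _ => ?_
  by_cases hw : vel w
  · have : C.pd w (C.tau (odd w) F) = 0 := by
      cases h : odd w
      · exact hF w hw
      · exact hF.inv w hw
    rw [this]; simp
  · rw [hG (conj w) (by simpa using hw)]; simp

/-! ### The de Rham function and the derived brackets -/

/-- The function `Δ`. -/
def delta : R :=
  ∑ i, C.X (.inr (.dx i)) * C.X (.inl (.dxStar i)) - ∑ a, C.X (.inl (.dz a)) * C.X (.inr (.dzStar a))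

lemma homog_delta : C.Homog true C.delta := by
  simp [Homog, delta, C.inv_X, odd, -Fintype.sum_sum_type]; abel

lemma r_delta : C.r C.delta = 0 := by
  simp [delta, C.r_X, tang]

/-- The partial derivatives of `Δ`. -/
def dDelta : Coord n m k → R
  | .inl (.dxStar i) => C.X (.inr (.dx i))
  | .inl (.dz a) => -C.X (.inr (.dzStar a))
  | .inr (.dzStar a) => -C.X (.inl (.dz a))
  | .inr (.dx i) => C.X (.inl (.dxStar i))
  | _ => 0

lemma pd_delta (w : Coord n m k) : C.pd w C.delta = C.dDelta w := by
  rcases w with (_ | _ | _ | _) | (_ | _ | _ | _) <;>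
    simp [delta, dDelta, C.pd_mul, C.pd_X, C.inv_X, odd, -Fintype.sum_sum_type]

/-- The lift of a function on `𝓝`. -/
def lft (F : R) : R := C.br C.delta F

/-- `Δ` depends on velocities only, and no two velocities are conjugate. -/
lemma br_delta_delta : C.br C.delta C.delta = 0 := by
  refine Finset.sum_eq_zero fun w _ => ?_
  rw [C.homog_delta.tau_eq, C.pd_delta]
  rcases w with (_ | _ | _ | _) | (_ | _ | _ | _) <;>
    simp [odd, conj, dDelta, C.pd_delta]

/-- As `Δ` is odd and commutes with itself, Jacobi makes the double bracket equal to its own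
negative. On `𝓛` this is `d² = 0`. -/
lemma lft_lft (F : R) : C.lft (C.lft F) = 0 := by
  have h := C.jacobi C.homog_delta C.delta F
  rw [br_delta_delta, C.homog_delta.tau_eq] at h
  simp only [br_zero_left, zero_add, Bool.and_self, if_true, br_neg_left] at h
  exact eq_zero_of_eq_neg h

variable {C} in
lemma Homog.lft {p : Bool} {F : R} (h : C.Homog p F) : C.Homog (!p) (C.lft F) := by
  simpa [SuperCalculus.lft] using C.homog_delta.br h

lemma inv_lft (F : R) : C.inv (C.lft F) = -C.lft (C.inv F) := by
  rw [lft, inv_br, show C.inv C.delta = -C.delta from C.homog_delta.tau_eq true, br_neg_left, lft]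

lemma r_lft {F : R} (h : C.r F = 0) : C.r (C.lft F) = 0 := C.r_br_eq_zero C.r_delta h

/-- On functions on `𝓛` the bracket with `Δ` is the exterior differential. -/
lemma r_lft_of_r {F : R} (h : C.r F = F) : C.r (C.lft F) = C.lft F := by
  simp only [lft, br, map_sum, map_smul, map_mul]
  refine Finset.sum_congr rfl fun w _ => ?_
  rw [C.homog_delta.tau_eq]
  by_cases hw : tang w
  · rw [← h, C.pd_r (conj w) _ (by simpa using hw)]; simp
  · rw [C.r_pd (conj w) _ (by simpa using hw), h]
    -- Along a coordinate normal to `𝓛`, the derivative of `Δ` is zero or plus or minus a velocity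
    -- tangent to `𝓛`, hence fixed by `r`.
    congr 2
    rcases w with (_ | _ | _ | _) | (_ | _ | _ | _) <;>
      simp_all [tang, odd, pd_delta, dDelta, C.r_X]

lemma lft_br (F G : R) : C.lft (C.br F G) = C.br (C.lft F) G + C.br (C.inv F) (C.lft G) :=
  C.jacobi C.homog_delta F G

/-- Apply `lft_br` to the odd bracket on the right; one term dies by `lft_lft`. Thus lifts commute
as soon as the odd bracket vanishes. -/
lemma br_lft_lft (F G : R) : C.br (C.lft F) (C.lft G) = -C.lft (C.br (C.lft (C.inv F)) G) := by
  rw [lft_br, lft_lft, inv_lft, C.inv_inv, br_zero_left, br_neg_left]; simp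

/-- The weak Koszul bracket. -/
def kos (W F G : R) : R := C.r (C.br (C.br (C.lft W) F) G)

/-! ### Cocycles and coboundaries under the weak Koszul bracket -/

section Cocycle

variable {C} {S V : R} (hS : C.Homog false S) (hSr : C.r S = 0) (hSS : C.br (C.lft S) S = 0)
  (hV : C.Homog true V) (hVr : C.r V = 0) (hSV : C.br (C.lft S) V = 0)

include hS hSS in
lemma br_lft_self : C.br (C.lft S) (C.lft S) = 0 := by
  rw [br_lft_lft, show C.inv S = S from hS.tau_eq true, hSS, lft, br_zero_right, neg_zero]

include hS hSS in
-- The lift of `S` is odd and commutes with itself, so the argument of `lft_lft` applies again.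
lemma br_lft_br_lft (F : R) : C.br (C.lft S) (C.br (C.lft S) F) = 0 := by
  have h := C.jacobi hS.lft (C.lft S) F
  rw [br_lft_self hS hSS, hS.lft.tau_eq] at h
  simp only [br_zero_left, zero_add, Bool.not_false, Bool.and_self, if_true, br_neg_left] at h
  exact eq_zero_of_eq_neg h

include hS hSS in
/-- `Q̂` is a derivation of the Koszul bracket, up to terms that vanish for cocycles. -/
lemma br_lft_kos (F G : R) : C.br (C.lft S) (C.br (C.br (C.lft S) F) G) =
    -C.br (C.br (C.lft S) (C.inv F)) (C.br (C.lft S) G) := by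
  rw [C.jacobi hS.lft, br_lft_br_lft hS hSS, br_zero_left, zero_add, tau_br, hS.lft.tau_eq]
  simp [br_neg_left]

include hS hSr hSS in
-- The cocycle conditions say that both factors on the right of `br_lft_kos` vanish on `𝓛`. The
-- restriction inside `kos` is harmless because `Ψ` vanishes on `𝓛`.
lemma r_br_kos {F G : R} (hF : C.r (C.br (C.lft S) F) = 0) (hG : C.r (C.br (C.lft S) G) = 0) :
    C.r (C.br (C.lft S) (C.kos S F G)) = 0 := by
  have hF' : C.r (C.br (C.lft S) (C.inv F)) = 0 := by
    have := congrArg C.inv hF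
    rw [← C.r_inv, inv_br, show C.inv (C.lft S) = _ from hS.lft.tau_eq true] at this
    simpa [br_neg_left] using this
  rw [kos, C.r_br_r (C.r_lft hSr), br_lft_kos hS hSS, map_neg, C.r_br_eq_zero hF' hG, neg_zero]

include hS hV hSV in
-- The form in which `(S,V) = 0` is used: `{Γ,Ψ} = 0`.
lemma br_lft_lft_field : C.br (C.lft V) (C.lft S) = 0 := by
  rw [C.br_skew hS.lft, show C.tau (!false) (C.lft V) = C.lft V from hV.lft.tau_eq true,
    br_lft_lft, show C.inv S = S from hS.tau_eq true, hSV, lft, br_zero_right, neg_zero, neg_zero]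

include hS hSr hSS hV hVr hSV in
-- The primitive comes from distributing `{Γ,-}` by Jacobi and rewriting each resulting term on `𝓛`
-- as a bracket with `Ψ`. The cocycle conditions permit replacing `{Γ,F}` and `{Γ,G}` by their
-- restrictions in brackets with `{Ψ,G}` and `{Ψ,F}`.
lemma r_br_field_kos {F G A B : R} (hF : C.r (C.br (C.lft S) F) = 0)
    (hG : C.r (C.br (C.lft S) G) = 0)
    (hA : -C.r (C.br (C.lft V) F) = C.r (C.br (C.lft S) A))
    (hB : -C.r (C.br (C.lft V) G) = C.r (C.br (C.lft S) B)) :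
    -C.r (C.br (C.lft V) (C.kos S F G)) =
      C.r (C.br (C.lft S) (-C.kos V F G - C.kos S A G - C.kos S (C.inv F) B)) := by
  have hSl := C.r_lft hSr
  have hVl := C.r_lft hVr
  -- Two applications of Jacobi; the term with `{Γ,Ψ}` is zero.
  have e1 : C.br (C.lft V) (C.br (C.br (C.lft S) F) G) =
      C.br (C.br (C.lft S) (C.br (C.lft V) F)) G +
        C.br (C.br (C.lft S) F) (C.br (C.lft V) G) := by
    have hp : C.Homog false (C.lft V) := hV.lft
    rw [C.jacobi hp, C.jacobi hp (C.lft S), br_lft_lft_field hS hV hSV]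
    simp
  -- Since `{Ψ,F}` vanishes on `𝓛`, only the restriction of `{Γ,G}` matters; it is exchanged for
  -- `-{Ψ,B}`, and `br_lft_kos` is read backwards.
  have e2 : C.r (C.br (C.br (C.lft S) F) (C.br (C.lft V) G)) =
      C.r (C.br (C.lft S) (C.br (C.br (C.lft S) (C.inv F)) B)) := by
    rw [← C.r_br_r hF, ← neg_neg (C.r (C.br (C.lft V) G)), hB, br_neg_right, map_neg, C.r_br_r hF,
      br_lft_kos hS hSS, C.inv_inv, map_neg]
  have hΨ : C.inv (C.lft S) = -C.lft S := hS.lft.tau_eq true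
  -- The same exchange in the first argument, allowed because `{Ψ,G}` vanishes on `𝓛`.
  have e3 : C.r (C.br (C.inv (C.br (C.lft V) F)) (C.br (C.lft S) G)) =
      -C.r (C.br (C.lft S) (C.br (C.br (C.lft S) A) G)) := by
    have h : C.r (C.inv (C.br (C.lft V) F)) = C.r (C.br (C.lft S) (C.inv A)) := by
      rw [C.r_inv, ← neg_neg (C.r (C.br (C.lft V) F)), hA, map_neg, ← C.r_inv, inv_br, hΨ,
        br_neg_left, map_neg, neg_neg]
    rw [← C.r_br_r_left hG, h, C.r_br_r_left hG, br_lft_kos hS hSS, map_neg, neg_neg]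
  -- Here `{Γ,F}` may not be replaced by its restriction. Jacobi first pulls `Ψ` to the outside,
  -- which yields the `kos V F G` term of the primitive.
  have e4 : C.br (C.br (C.lft S) (C.br (C.lft V) F)) G =
      C.br (C.lft S) (C.br (C.br (C.lft V) F) G) -
        C.br (C.inv (C.br (C.lft V) F)) (C.br (C.lft S) G) := by
    have h := C.jacobi hS.lft (C.br (C.lft V) F) G
    rw [h]; simp
  rw [kos, C.r_br_r hVl, e1, map_add, e2, e4, map_sub, e3]
  simp only [br_sub_right, br_neg_right, map_sub, map_neg, kos, C.r_br_r hSl]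
  abel

end Cocycle

/-! ### The Koszul bracket as a biderivation -/

lemma r_lft_r (F : R) : C.r (C.lft (C.r F)) = C.r (C.lft F) := C.r_br_r C.r_delta F

variable {C} in
-- The Leibniz rules also give terms with the bracket of two functions on `𝓛`; these vanish by
-- `br_of_r`.
lemma kos_mul {p s : Bool} {W F₁ F₂ G : R} (hW : C.Homog p W) (hG : C.Homog s G)
    (h₁ : C.r F₁ = F₁) (h₂ : C.r F₂ = F₂) (h : C.r G = G) :
    C.kos W (F₁ * F₂) G = C.kos W F₁ G * C.tau s F₂ + C.tau (!p) F₁ * C.kos W F₂ G := by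
  have h₁' : C.r (C.tau (!p) F₁) = C.tau (!p) F₁ := by cases p <;> simp [C.r_inv, h₁]
  have h₂' : C.r (C.tau s F₂) = C.tau s F₂ := by cases s <;> simp [C.r_inv, h₂]
  rw [kos, C.br_mul hW.lft, br_add_left, C.br_mul_left hG, C.br_mul_left hG, C.br_of_r h₂ h,
    C.br_of_r h₁' h]
  simp [kos, h₁', h₂']

/-- Moves `d` away from the first argument, at the price of an outer `d` and a `d` on the second
argument. When the second argument is exact, the last term disappears. -/
lemma kos_lft_left (W F G : R) : C.kos W (C.lft F) G =
    -C.r (C.lft (C.kos (C.inv W) F G)) - C.kos W (C.inv F) (C.lft G) := by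
  have h := C.lft_br (C.br (C.lft (C.inv W)) F) G
  rw [inv_br, inv_lft, C.inv_inv, br_neg_left, br_neg_left, ← sub_eq_add_neg] at h
  rw [kos, br_lft_lft, br_neg_left, kos, kos, r_lft_r, h]
  simp

variable {C} in
-- Jacobi applied to `{Ψ,{F,G}}`, where `{F,G} = 0` because both functions live on `𝓛`.
lemma kos_symm {p s : Bool} {W F G : R} (hW : C.Homog p W) (hG : C.Homog s G)
    (hFr : C.r F = F) (hGr : C.r G = G) : C.kos W F G = C.kos W G (C.tau s F) := by
  have h := C.jacobi hW.lft F G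
  rw [C.br_of_r hFr hGr, br_zero_right, C.br_skew (hW.lft.br hG)] at h
  rw [kos, eq_neg_of_add_eq_zero_left h.symm, neg_neg, kos]
  cases p <;> cases s <;> simp [C.inv_inv]

lemma pd_one (w : Coord n m k) : C.pd w 1 = 0 := by
  have h := C.pd_mul w 1 1
  simpa using h

/-- `Δ` is quadratic, so its third derivatives vanish. -/
lemma pd_pd_dDelta (u v w : Coord n m k) : C.pd u (C.pd v (C.dDelta w)) = 0 := by
  rcases w with (_ | _ | _ | _) | (_ | _ | _ | _) <;>
    simp [dDelta, C.pd_X, apply_ite (C.pd u), pd_one]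

variable {C} in
lemma NoVel.pd_br {F G : R} (w : Coord n m k) (hw : vel w) (hG : C.NoVel G) :
    C.pd w (C.br F G) = C.br (C.pd w F) G := by
  rw [SuperCalculus.pd_br, hG w hw, br_zero_right, add_zero]

variable {C} in
lemma NoVel.pd_lft {F : R} (hF : C.NoVel F) (w : Coord n m k) (hw : vel w) :
    C.pd w (C.lft F) = C.br (C.dDelta w) F := by
  rw [lft, hF.pd_br w hw, pd_delta]

variable {C} in
-- A velocity derivative turns the lift into `{∂_w Δ,F}`. A second one gives `{∂_v ∂_w Δ,F}`, which
-- is zero since `Δ` is quadratic. So `{∂_w Δ,F}` has no velocities and commutes with `G`.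
lemma NoVel.oddBr {F G : R} (hF : C.NoVel F) (hG : C.NoVel G) : C.NoVel (C.br (C.lft F) G) := by
  intro w hw
  rw [hG.pd_br w hw, hF.pd_lft w hw]
  refine C.br_of_noVel (fun v hv => ?_) hG
  rw [hF.pd_br v hv]
  refine Finset.sum_eq_zero fun u _ => ?_
  cases h : odd u <;> simp [pd_pd_dDelta]
  have := C.inv_pd u (C.pd v (C.dDelta w))
  simp_all [pd_pd_dDelta]

variable {C} in
-- The odd bracket of `W` and `F` is again free of velocities, so it commutes with `G`.
lemma kos_of_noVel {W F G : R} (hW : C.NoVel W) (hF : C.NoVel F) (hG : C.NoVel G) :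
    C.kos W F G = 0 := by
  rw [kos, C.br_of_noVel (hW.oddBr hF) hG, map_zero]

/-- Before restriction, a bracket with an exact first argument is a double odd bracket on `𝓝`. This
is how the invariance of the odd bracket enters. -/
lemma kos_lft_of_fn (W F G : R) :
    C.kos W (C.lft F) G = -C.r (C.br (C.lft (C.br (C.lft (C.inv W)) F)) G) := by
  rw [kos, br_lft_lft, br_neg_left, map_neg]

lemma br_X (v : Coord n m k) (H : R) :
    C.br (C.X v) H = (if odd v then -eps v else eps v) • C.pd (conj v) H := by
  rw [br, Finset.sum_eq_single v]
  · cases h : odd v <;> simp [h, C.inv_X, C.pd_X]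
  · intro w _ hw
    cases h : odd w <;> cases h' : odd v <;> simp [h', C.inv_X, C.pd_X, hw]
  · simp

end SuperCalculus

lemma sum_evenCoord {A : Type*} [AddCommMonoid A] (f : EvenCoord n m k → A) :
    ∑ e, f e = ∑ i, f (.x i) + ∑ a, f (.zStar a) + ∑ a, f (.dz a) + ∑ i, f (.dxStar i) := by
  let E : ((Fin n ⊕ Ghost m k) ⊕ Ghost m k) ⊕ Fin n ≃ EvenCoord n m k :=
    { toFun := fun
        | .inl (.inl (.inl i)) => .x i
        | .inl (.inl (.inr a)) => .zStar a
        | .inl (.inr a) => .dz a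
        | .inr i => .dxStar i
      invFun := fun
        | .x i => .inl (.inl (.inl i))
        | .zStar a => .inl (.inl (.inr a))
        | .dz a => .inl (.inr a)
        | .dxStar i => .inr i
      left_inv := by rintro (((_ | _) | _) | _) <;> rfl
      right_inv := by rintro (_ | _ | _ | _) <;> rfl }
  rw [← Equiv.sum_comp E, Fintype.sum_sum_type, Fintype.sum_sum_type, Fintype.sum_sum_type]
  rfl

lemma sum_oddCoord {A : Type*} [AddCommMonoid A] (f : OddCoord n m k → A) :
    ∑ e, f e = ∑ a, f (.z a) + ∑ i, f (.xStar i) + ∑ i, f (.dx i) + ∑ a, f (.dzStar a) := by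
  let E : ((Ghost m k ⊕ Fin n) ⊕ Fin n) ⊕ Ghost m k ≃ OddCoord n m k :=
    { toFun := fun
        | .inl (.inl (.inl i)) => .z i
        | .inl (.inl (.inr a)) => .xStar a
        | .inl (.inr a) => .dx a
        | .inr i => .dzStar i
      invFun := fun
        | .z i => .inl (.inl (.inl i))
        | .xStar a => .inl (.inl (.inr a))
        | .dx a => .inl (.inr a)
        | .dzStar i => .inr i
      left_inv := by rintro (((_ | _) | _) | _) <;> rfl
      right_inv := by rintro (_ | _ | _ | _) <;> rfl }
  rw [← Equiv.sum_comp E, Fintype.sum_sum_type, Fintype.sum_sum_type, Fintype.sum_sum_type]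
  rfl

namespace SuperCalculus

variable {R : Type*} [Ring R] [Algebra ℝ R] {C : SuperCalculus n m k R}

/-- The bracket of a function on `𝓝` with a function on `𝓜`. -/
lemma oddBr_eq {H F : R} (hH : C.NoVel H) (hF : C.NoVel F) (hFr : C.r F = F) :
    C.br (C.lft H) F =
      -∑ i, C.pd (.inr (.xStar i)) H * C.pd (.inl (.x i)) F +
        ∑ a, C.pd (.inl (.zStar a)) (C.inv H) * C.pd (.inr (.z a)) F := by
  have h1 (i) : C.pd (.inr (.xStar i)) F = 0 := by rw [← hFr]; exact C.pd_r _ _ (by simp [tang])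
  have h2 (i) : C.pd (.inl (.zStar i)) F = 0 := by rw [← hFr]; exact C.pd_r _ _ (by simp [tang])
  have h3 (i) : C.pd (.inl (.dxStar i)) (C.lft H) = -C.pd (.inr (.xStar i)) H := by
    rw [hH.pd_lft _ rfl, dDelta, br_X]; simp [odd, eps, conj]
  have h4 (i) : C.pd (.inr (.dzStar i)) (C.inv (C.lft H)) = -C.pd (.inl (.zStar i)) (C.inv H) := by
    rw [inv_lft, map_neg, hH.inv.pd_lft _ rfl, dDelta, br_neg_left, br_X]; simp [odd, eps, conj]
  rw [br, Fintype.sum_sum_type, sum_evenCoord, sum_oddCoord]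
  simp only [conj, eps, odd, h1, h2, h3, h4, tau_true, tau_false, hF (.inl (.dz _)) rfl,
    hF (.inl (.dxStar _)) rfl, hF (.inr (.dx _)) rfl, hF (.inr (.dzStar _)) rfl]
  simp

end SuperCalculus

/-! ## The Grassmann algebra -/

section Grassmann

variable {M N : Type*} [AddCommGroup M] [Module ℝ M] [AddCommGroup N] [Module ℝ N]

open CliffordAlgebra (involute contractLeft)

lemma involute_map (L : M →ₗ[ℝ] N) (a : ExteriorAlgebra ℝ M) :
    involute (ExteriorAlgebra.map L a) = ExteriorAlgebra.map L (involute a) := by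
  induction a using ExteriorAlgebra.induction with
  | algebraMap r => simp
  | ι x =>
    rw [ExteriorAlgebra.map_apply_ι, CliffordAlgebra.involute_ι, CliffordAlgebra.involute_ι,
      map_neg, ExteriorAlgebra.map_apply_ι]
  | mul a b ha hb => simp only [map_mul, ha, hb]
  | add a b ha hb => simp only [map_add, ha, hb]

lemma contractLeft_mul (d : Module.Dual ℝ M) (a b : ExteriorAlgebra ℝ M) :
    contractLeft d (a * b) = contractLeft d a * b + involute a * contractLeft d b := by
  induction a using CliffordAlgebra.left_induction with
  | algebraMap r => simp [CliffordAlgebra.contractLeft_algebraMap_mul]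
  | add x y hx hy => simp only [add_mul, map_add, hx, hy]; abel
  | ι_mul x v h =>
    rw [mul_assoc, CliffordAlgebra.contractLeft_ι_mul, h, CliffordAlgebra.contractLeft_ι_mul,
      map_mul, CliffordAlgebra.involute_ι]
    simp only [mul_add, sub_mul, smul_mul_assoc, mul_assoc, neg_mul]
    abel

lemma involute_contractLeft (d : Module.Dual ℝ M) (a : ExteriorAlgebra ℝ M) :
    involute (contractLeft d a) = -contractLeft d (involute a) := by
  induction a using CliffordAlgebra.left_induction with
  | algebraMap r => simp
  | add x y hx hy => simp only [map_add, hx, hy]; abel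
  | ι_mul x v h =>
    rw [CliffordAlgebra.contractLeft_ι_mul, map_mul, CliffordAlgebra.involute_ι, neg_mul, map_neg,
      CliffordAlgebra.contractLeft_ι_mul, map_sub, map_mul, CliffordAlgebra.involute_ι, h, map_smul]
    simp

lemma contractLeft_map (d : Module.Dual ℝ N) (L : M →ₗ[ℝ] N) (a : ExteriorAlgebra ℝ M) :
    contractLeft d (ExteriorAlgebra.map L a) =
      ExteriorAlgebra.map L (contractLeft (d ∘ₗ L) a) := by
  induction a using CliffordAlgebra.left_induction with
  | algebraMap r => simp
  | add x y hx hy => simp only [map_add, hx, hy]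
  | ι_mul x v h =>
    have e : ∀ y, ExteriorAlgebra.map L (CliffordAlgebra.ι 0 v * y) =
        CliffordAlgebra.ι 0 (L v) * ExteriorAlgebra.map L y := fun y => by
      rw [map_mul]; exact congrArg (· * _) (ExteriorAlgebra.map_apply_ι L v)
    rw [e, CliffordAlgebra.contractLeft_ι_mul, CliffordAlgebra.contractLeft_ι_mul, map_sub,
      map_smul, e, h]
    rfl

lemma ι_mul_eq (v : M) (b : ExteriorAlgebra ℝ M) :
    ExteriorAlgebra.ι ℝ v * b = involute b * ExteriorAlgebra.ι ℝ v := by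
  induction b using ExteriorAlgebra.induction with
  | algebraMap r => simp [Algebra.commutes]
  | ι x =>
    rw [CliffordAlgebra.involute_ι, neg_mul, eq_neg_iff_add_eq_zero]
    exact ExteriorAlgebra.ι_add_mul_swap v x
  | mul a b ha hb => rw [map_mul, ← mul_assoc, ha, mul_assoc, hb, mul_assoc]
  | add a b ha hb => rw [map_add, mul_add, add_mul, ha, hb]

/-- Supercommutativity for both parities of `a` at once. Being linear in `a`, it can be proved by
induction on products of vectors without splitting `a` into homogeneous parts. -/
lemma two_smul_mul (a b : ExteriorAlgebra ℝ M) :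
    (2 : ℝ) • (a * b) = b * (a + involute a) + involute b * (a - involute a) := by
  induction a using CliffordAlgebra.left_induction with
  | algebraMap r => simp [two_smul, mul_add, Algebra.commutes]
  | add x y hx hy => simp only [add_mul, smul_add, map_add, hx, hy, mul_add, mul_sub]; abel
  | ι_mul x v h =>
    have e1 : b * CliffordAlgebra.ι 0 v = CliffordAlgebra.ι 0 v * involute b := by
      have := ι_mul_eq v (involute b)
      rw [CliffordAlgebra.involute_involute] at this
      exact this.symm
    have e2 : involute b * CliffordAlgebra.ι 0 v = CliffordAlgebra.ι 0 v * b := (ι_mul_eq v b).symm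
    have e3 : b * (CliffordAlgebra.ι 0 v * x + involute (CliffordAlgebra.ι 0 v * x)) =
        CliffordAlgebra.ι 0 v * (involute b * (x - involute x)) := by
      rw [map_mul, CliffordAlgebra.involute_ι, ← mul_assoc, ← e1, neg_mul, ← sub_eq_add_neg,
        ← mul_sub, mul_assoc]
    have e4 : involute b * (CliffordAlgebra.ι 0 v * x - involute (CliffordAlgebra.ι 0 v * x)) =
        CliffordAlgebra.ι 0 v * (b * (x + involute x)) := by
      rw [map_mul, CliffordAlgebra.involute_ι, ← mul_assoc, ← e2, neg_mul, sub_neg_eq_add,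
        ← mul_add, mul_assoc]
    rw [e3, e4, ← mul_add, add_comm, ← h, mul_smul_comm, mul_assoc]

lemma mul_comm_of_involute_eq {a : ExteriorAlgebra ℝ M} (ha : involute a = a)
    (b : ExteriorAlgebra ℝ M) : a * b = b * a := by
  have h := two_smul_mul a b
  rw [ha, sub_self, mul_zero, add_zero, mul_add, ← two_smul ℝ] at h
  exact smul_right_injective _ (two_ne_zero (α := ℝ)) h

lemma mul_comm_of_involute_eq_neg {a : ExteriorAlgebra ℝ M} (ha : involute a = -a)
    (b : ExteriorAlgebra ℝ M) : a * b = involute b * a := by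
  have h := two_smul_mul a b
  rw [ha, add_neg_cancel, mul_zero, zero_add, sub_neg_eq_add, mul_add, ← two_smul ℝ] at h
  exact smul_right_injective _ (two_ne_zero (α := ℝ)) h

end Grassmann

/-- A basis of the Grassmann algebra. -/
def grassmannBasis (n m k : ℕ) :
    Module.Basis (Finset (Fin (Fintype.card (OddCoord n m k)))) ℝ (Grassmann n m k) :=
  ((Pi.basisFun ℝ (OddCoord n m k)).reindex (Fintype.equivFin _)).ExteriorAlgebra

local notation "𝔟" => grassmannBasis n m k

lemma eq_of_functional {a b : Grassmann n m k} (h : ∀ l : Grassmann n m k →ₗ[ℝ] ℝ, l a = l b) :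
    a = b :=
  (𝔟).ext_elem fun i => h ((𝔟).coord i)

lemma functional_eq_sum (l : Grassmann n m k →ₗ[ℝ] ℝ) (a : Grassmann n m k) :
    l a = ∑ i, (𝔟).coord i a * l (𝔟 i) := by
  conv_lhs => rw [← (𝔟).sum_repr a, map_sum]
  simp only [map_smul, smul_eq_mul, Module.Basis.coord_apply]

/-- Reduces product rules in the Grassmann algebra to those for real functions, with no norm on the
algebra. -/
lemma exists_functional_mul_eq_sum (l : Grassmann n m k →ₗ[ℝ] ℝ) :
    ∃ c : _ → _ → ℝ, ∀ a b : Grassmann n m k,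
      l (a * b) = ∑ i, ∑ j, (𝔟).coord i a * (𝔟).coord j b * c i j := by
  refine ⟨fun i j => l (𝔟 i * 𝔟 j), fun a b => ?_⟩
  conv_lhs => rw [← (𝔟).sum_repr a, ← (𝔟).sum_repr b, Finset.sum_mul_sum]
  simp only [map_sum, smul_mul_smul_comm, map_smul, smul_eq_mul, Module.Basis.coord_apply]

/-! ## Differential calculus of superfunctions -/

section Calculus

variable {f g : SFun n m k} {u : EvenCoord n m k → ℝ} {v w : Grassmann n m k}
  {e : EvenCoord n m k} {U : Set (EvenCoord n m k → ℝ)}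

lemma HasEvenDeriv.unique (h : HasEvenDeriv e f u v) (h' : HasEvenDeriv e f u w) : v = w :=
  eq_of_functional fun l => (h l).unique (h' l)

lemma HasEvenDeriv.evenDeriv_eq (h : HasEvenDeriv e f u w) : evenDeriv e f u = w := by
  have h' : ∃ w, HasEvenDeriv e f u w := ⟨w, h⟩
  rw [evenDeriv, dif_pos h']
  exact h'.choose_spec.unique h

lemma HasEvenDeriv.add (hf : HasEvenDeriv e f u v) (hg : HasEvenDeriv e g u w) :
    HasEvenDeriv e (f + g) u (v + w) := fun l => by
  simpa only [Pi.add_apply, map_add] using (hf l).fun_add (hg l)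

/-- `w` is the derivative at `0` of the curve `γ`, tested on linear functionals. -/
def WeakDeriv (γ : ℝ → Grassmann n m k) (w : Grassmann n m k) : Prop :=
  ∀ l : Grassmann n m k →ₗ[ℝ] ℝ, HasDerivAt (fun t => l (γ t)) (l w) 0

lemma WeakDeriv.mul {γ δ : ℝ → Grassmann n m k} (hγ : WeakDeriv γ v) (hδ : WeakDeriv δ w) :
    WeakDeriv (fun t => γ t * δ t) (v * δ 0 + γ 0 * w) := fun l => by
  obtain ⟨c, hc⟩ := exists_functional_mul_eq_sum l
  simp only [map_add, hc]
  rw [← Finset.sum_add_distrib]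
  refine HasDerivAt.fun_sum fun i _ => ?_
  rw [← Finset.sum_add_distrib]
  refine HasDerivAt.fun_sum fun j _ => ?_
  rw [← add_mul]
  simpa using ((hγ ((𝔟).coord i)).mul (hδ ((𝔟).coord j))).mul_const (c i j)

lemma HasEvenDeriv.mul (hf : HasEvenDeriv e f u v) (hg : HasEvenDeriv e g u w) :
    HasEvenDeriv e (f * g) u (v * g u + f u * w) := by
  have h := WeakDeriv.mul (γ := fun t => f (u + t • Pi.single e 1))
    (δ := fun t => g (u + t • Pi.single e 1)) hf hg
  rwa [zero_smul, add_zero] at h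

lemma HasEvenDeriv.linear {T : Grassmann n m k →ₗ[ℝ] Grassmann n m k}
    (hf : HasEvenDeriv e f u w) : HasEvenDeriv e (fun u => T (f u)) u (T w) :=
  fun l => hf (l ∘ₗ T)

lemma SmoothOn.congr (hf : SmoothOn f U) (h : EqOn f g U) : SmoothOn g U :=
  fun l => (hf l).congr fun u hu => by rw [h hu]

lemma SmoothOn.mono {U' : Set (EvenCoord n m k → ℝ)} (hf : SmoothOn f U) (h : U' ⊆ U) :
    SmoothOn f U' := fun l => (hf l).mono h

lemma SmoothOn.add (hf : SmoothOn f U) (hg : SmoothOn g U) : SmoothOn (f + g) U :=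
  fun l => by simpa using (hf l).add (hg l)

lemma SmoothOn.mul (hf : SmoothOn f U) (hg : SmoothOn g U) : SmoothOn (f * g) U := fun l => by
  obtain ⟨c, hc⟩ := exists_functional_mul_eq_sum l
  simp only [Pi.mul_apply, hc]
  exact ContDiffOn.sum fun i _ => ContDiffOn.sum fun j _ =>
    ((hf ((𝔟).coord i)).mul (hg ((𝔟).coord j))).mul contDiffOn_const

lemma SmoothOn.linear (hf : SmoothOn f U) (T : Grassmann n m k →ₗ[ℝ] Grassmann n m k) :
    SmoothOn (fun u => T (f u)) U := fun l => hf (l ∘ₗ T)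

lemma smoothOn_const (a : Grassmann n m k) : SmoothOn (fun _ => a) U := fun _ => contDiffOn_const

lemma smoothOn_evenVar (e : EvenCoord n m k) : SmoothOn (evenVar e) U := fun l => by
  have h : (fun u => l (evenVar e u)) = fun u : EvenCoord n m k → ℝ => u e * l 1 := by
    ext u; simp [evenVar, Algebra.algebraMap_eq_smul_one]
  rw [h]
  exact ((contDiff_apply ℝ ℝ e).mul contDiff_const).contDiffOn

lemma SmoothOn.hasEvenDeriv (hf : SmoothOn f U) (hU : IsOpen U) (hu : u ∈ U)
    (e : EvenCoord n m k) : HasEvenDeriv e f u (evenDeriv e f u) := by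
  -- The derivative is assembled from the derivatives of the components in a basis.
  have h : HasEvenDeriv e f u
      (∑ i, fderiv ℝ (fun u => (𝔟).coord i (f u)) u (Pi.single e 1) • 𝔟 i) := by
    intro l
    simp only [functional_eq_sum l (f _), map_sum, map_smul, smul_eq_mul]
    refine HasDerivAt.fun_sum fun i _ => HasDerivAt.mul_const ?_ _
    have h1 : DifferentiableAt ℝ (fun u => (𝔟).coord i (f u)) u :=
      ((hf ((𝔟).coord i)).contDiffAt (hU.mem_nhds hu)).differentiableAt (by simp)
    exact h1.hasFDerivAt.hasLineDerivAt _
  rwa [h.evenDeriv_eq]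

lemma SmoothOn.functional_evenDeriv (hf : SmoothOn f U) (hU : IsOpen U) (hu : u ∈ U)
    (e : EvenCoord n m k) (l : Grassmann n m k →ₗ[ℝ] ℝ) :
    l (evenDeriv e f u) = fderiv ℝ (fun u => l (f u)) u (Pi.single e 1) :=
  (hf.hasEvenDeriv hU hu e l).unique
    ((((hf l).contDiffAt (hU.mem_nhds hu)).differentiableAt (by simp)).hasFDerivAt.hasLineDerivAt _ :)

lemma SmoothOn.evenDeriv (hf : SmoothOn f U) (hU : IsOpen U) (e : EvenCoord n m k) :
    SmoothOn (evenDeriv e f) U := fun l => by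
  have h : ContDiffOn ℝ ∞ (fun u => fderiv ℝ (fun u => l (f u)) u (Pi.single e 1)) U :=
    ((hf l).fderiv_of_isOpen hU (by simp)).clm_apply contDiffOn_const
  exact h.congr fun u hu => hf.functional_evenDeriv hU hu e l

lemma SmoothOn.evenDeriv_comm (hf : SmoothOn f U) (hU : IsOpen U) (hu : u ∈ U)
    (e e' : EvenCoord n m k) :
    WeakKoszul.evenDeriv e (WeakKoszul.evenDeriv e' f) u =
      WeakKoszul.evenDeriv e' (WeakKoszul.evenDeriv e f) u := by
  refine eq_of_functional fun l => ?_
  have key : ∀ e e' : EvenCoord n m k,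
      l (WeakKoszul.evenDeriv e (WeakKoszul.evenDeriv e' f) u) =
        fderiv ℝ (fderiv ℝ fun u => l (f u)) u (Pi.single e 1) (Pi.single e' 1) := by
    intro e e'
    rw [(hf.evenDeriv hU e').functional_evenDeriv hU hu]
    have h1 : (fun u => l (WeakKoszul.evenDeriv e' f u)) =ᶠ[nhds u]
        fun u => fderiv ℝ (fun u => l (f u)) u (Pi.single e' 1) := by
      filter_upwards [hU.mem_nhds hu] with v hv
      exact hf.functional_evenDeriv hU hv e' l
    have h2 : DifferentiableAt ℝ (fderiv ℝ fun u => l (f u)) u :=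
      (((hf l).fderiv_of_isOpen hU (m := ∞) (by simp)).contDiffAt
        (hU.mem_nhds hu)).differentiableAt (by simp)
    rw [h1.fderiv_eq, fderiv_clm_apply h2 (differentiableAt_const _)]
    simp
  rw [key, key]
  exact (((hf l).contDiffAt (hU.mem_nhds hu)).isSymmSndFDerivAt
    (by simp only [minSmoothness_of_isRCLikeNormedField]; exact WithTop.coe_le_coe.2 le_top)) _ _

/-- On an open set the defining conditions of the two derivatives agree, so the default value `0`
also agrees where no derivative exists. -/
lemma evenDeriv_congr (hU : IsOpen U) (h : EqOn f g U) (e : EvenCoord n m k) :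
    EqOn (evenDeriv e f) (evenDeriv e g) U := by
  intro u hu
  have key : HasEvenDeriv e f u = HasEvenDeriv e g u := by
    ext w
    refine forall_congr' fun l => Filter.EventuallyEq.hasDerivAt_iff ?_
    have hc : Filter.Tendsto (fun t : ℝ => u + t • (Pi.single e 1 : EvenCoord n m k → ℝ)) (nhds 0)
        (nhds u) := by
      have : Continuous (fun t : ℝ => u + t • (Pi.single e 1 : EvenCoord n m k → ℝ)) := by fun_prop
      simpa using this.tendsto 0
    filter_upwards [hc (hU.mem_nhds hu)] with t ht
    rw [h ht]
  by_cases hw : ∃ w, HasEvenDeriv e f u w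
  · obtain ⟨w, hw⟩ := hw
    rw [hw.evenDeriv_eq, HasEvenDeriv.evenDeriv_eq (w := w) (key ▸ hw)]
  · rw [evenDeriv, evenDeriv, dif_neg hw, dif_neg (key ▸ hw)]

lemma hasEvenDeriv_of_const {a : Grassmann n m k}
    (h : ∀ t : ℝ, f (u + t • (Pi.single e 1 : EvenCoord n m k → ℝ)) = a) :
    HasEvenDeriv e f u 0 := fun l => by
  simp only [h, map_zero]
  exact hasDerivAt_const _ _

lemma hasEvenDeriv_evenVar (e e' : EvenCoord n m k) :
    HasEvenDeriv e (evenVar e') u (if e = e' then 1 else 0) := fun l => by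
  have h : ∀ t : ℝ, l (evenVar e' (u + t • (Pi.single e 1 : EvenCoord n m k → ℝ))) =
      u e' * l 1 + t * l (if e = e' then 1 else 0) := by
    intro t
    simp only [evenVar, Algebra.algebraMap_eq_smul_one, map_smul, smul_eq_mul, Pi.add_apply,
      Pi.smul_apply, Pi.single_apply, eq_comm (a := e')]
    split_ifs <;> simp [add_mul]
  simp only [h]
  simpa using ((hasDerivAt_id (0 : ℝ)).mul_const (l (if e = e' then 1 else 0))).const_add (u e' * l 1)

end Calculus

/-! ### Setting coordinates to zero -/

section Mask

variable {pe : EvenCoord n m k → Bool} {po : OddCoord n m k → Bool} {f g : SFun n m k}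
  {u : EvenCoord n m k → ℝ} {e : EvenCoord n m k} {U : Set (EvenCoord n m k → ℝ)}

/-- Setting even coordinates to zero. -/
def maskEven (pe : EvenCoord n m k → Bool) (u : EvenCoord n m k → ℝ) : EvenCoord n m k → ℝ :=
  fun e => if pe e then u e else 0

/-- Setting odd coordinates to zero. -/
def maskOdd (po : OddCoord n m k → Bool) : (OddCoord n m k → ℝ) →ₗ[ℝ] (OddCoord n m k → ℝ) :=
  LinearMap.pi fun o => if po o then LinearMap.proj o else 0

lemma setToZero_apply : setToZero pe po f u = ExteriorAlgebra.map (maskOdd po) (f (maskEven pe u)) :=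
  rfl

lemma maskOdd_apply (v : OddCoord n m k → ℝ) (o : OddCoord n m k) :
    maskOdd po v o = if po o then v o else 0 := by
  simp only [maskOdd, LinearMap.pi_apply]; split_ifs <;> simp

lemma proj_comp_maskOdd (o : OddCoord n m k) :
    (LinearMap.proj o : (OddCoord n m k → ℝ) →ₗ[ℝ] ℝ) ∘ₗ maskOdd po =
      if po o then LinearMap.proj o else 0 := by
  ext v
  simp only [LinearMap.comp_apply, LinearMap.proj_apply, maskOdd_apply]
  split_ifs <;> simp

lemma maskOdd_comp (po' : OddCoord n m k → Bool) :
    maskOdd po ∘ₗ maskOdd po' = maskOdd fun o => po o && po' o := by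
  refine LinearMap.ext fun v => funext fun o => ?_
  simp only [LinearMap.comp_apply, maskOdd_apply]
  cases po o <;> cases po' o <;> rfl

lemma maskEven_maskEven (pe' : EvenCoord n m k → Bool) :
    maskEven pe (maskEven pe' u) = maskEven (fun e => pe e && pe' e) u := by
  ext e; simp only [maskEven]; by_cases h : pe e <;> simp [h]

lemma setToZero_setToZero (pe' : EvenCoord n m k → Bool) (po' : OddCoord n m k → Bool) :
    setToZero pe po (setToZero pe' po' f) =
      setToZero (fun e => pe e && pe' e) (fun o => po o && po' o) f := by
  ext u
  simp only [setToZero_apply]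
  rw [← AlgHom.comp_apply, ExteriorAlgebra.map_comp_map, maskOdd_comp, maskEven_maskEven]
  simp only [Bool.and_comm]

lemma SmoothOn.setToZero (hf : SmoothOn f U) (h : MapsTo (maskEven pe) U U) :
    SmoothOn (setToZero pe po f) U := fun l => by
  have hc : ContDiff ℝ ∞ (maskEven pe : (EvenCoord n m k → ℝ) → _) := by
    refine contDiff_pi.2 fun e => ?_
    simp only [maskEven]
    split_ifs
    · exact contDiff_apply ℝ ℝ e
    · exact contDiff_const
  exact (hf (l ∘ₗ (ExteriorAlgebra.map (maskOdd po)).toLinearMap)).comp hc.contDiffOn h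

lemma maskEven_add_single (h : pe e) (t : ℝ) :
    maskEven pe (u + t • Pi.single e 1) = maskEven pe u + t • Pi.single e 1 := by
  ext e'
  simp only [maskEven, Pi.add_apply, Pi.smul_apply, Pi.single_apply]
  by_cases he : e' = e
  · subst he; simp [h]
  · simp [he]

lemma maskEven_add_single_of_not (h : ¬ pe e) (t : ℝ) :
    maskEven pe (u + t • Pi.single e 1) = maskEven pe u := by
  ext e'
  simp only [maskEven, Pi.add_apply, Pi.smul_apply, Pi.single_apply]
  by_cases he : e' = e
  · subst he; simp [h]
  · simp [he]

lemma SmoothOn.evenDeriv_setToZero (hf : SmoothOn f U) (hU : IsOpen U) (hu : maskEven pe u ∈ U)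
    (h : pe e) : WeakKoszul.evenDeriv e (WeakKoszul.setToZero pe po f) u =
      WeakKoszul.setToZero pe po (WeakKoszul.evenDeriv e f) u := by
  refine HasEvenDeriv.evenDeriv_eq fun l => ?_
  simp only [setToZero_apply, maskEven_add_single h]
  exact hf.hasEvenDeriv hU hu e (l ∘ₗ (ExteriorAlgebra.map (maskOdd po)).toLinearMap)

lemma evenDeriv_setToZero_of_not (h : ¬ pe e) : evenDeriv e (setToZero pe po f) u = 0 :=
  HasEvenDeriv.evenDeriv_eq (hasEvenDeriv_of_const (a := setToZero pe po f u)
    fun t => by simp only [setToZero_apply, maskEven_add_single_of_not h])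

lemma oddDeriv_setToZero (o : OddCoord n m k) (h : po o) :
    oddDeriv o (setToZero pe po f) = setToZero pe po (oddDeriv o f) := by
  ext u
  simp only [oddDeriv, setToZero_apply]
  rw [contractLeft_map, proj_comp_maskOdd, if_pos h]

lemma oddDeriv_setToZero_of_not (o : OddCoord n m k) (h : ¬ po o) :
    oddDeriv o (setToZero pe po f) = 0 := by
  ext u
  simp only [oddDeriv, setToZero_apply]
  rw [contractLeft_map, proj_comp_maskOdd, if_neg h]
  simp

lemma setToZero_parityInv : setToZero pe po (parityInv f) = parityInv (setToZero pe po f) := by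
  ext u; simp only [setToZero_apply, parityInv]; rw [involute_map]

end Mask

/-! ## The superalgebra of smooth superfunctions over an open set -/

open TopologicalSpace (Opens)

/-- The values of the even coordinates with `x` in the given set. -/
def cyl (m k : ℕ) (X : Opens (Fin n → ℝ)) : Set (EvenCoord n m k → ℝ) := {u | xPart u ∈ X}

section Algebra

variable {X : Opens (Fin n → ℝ)} {f g : SFun n m k}

lemma isOpen_cyl : IsOpen (cyl m k X) := by
  have : Continuous (xPart : (EvenCoord n m k → ℝ) → _) := by unfold xPart; fun_prop
  exact X.isOpen.preimage this

lemma mapsTo_maskEven {pe : EvenCoord n m k → Bool} (h : ∀ i, pe (.x i)) :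
    MapsTo (maskEven pe) (cyl m k X) (cyl m k X) := by
  intro u hu
  have : xPart (maskEven pe u) = xPart u := by ext i; simp [xPart, maskEven, h]
  rwa [cyl, mem_ofPred_eq, this]

lemma setToZero_congr {pe : EvenCoord n m k → Bool} {po : OddCoord n m k → Bool}
    (hpe : ∀ i, pe (.x i)) (h : EqOn f g (cyl m k X)) :
    EqOn (setToZero pe po f) (setToZero pe po g) (cyl m k X) := fun u hu => by
  rw [setToZero_apply, setToZero_apply, h (mapsTo_maskEven hpe hu)]

/-- Smooth superfunctions over `X`, defined everywhere. -/
def smoothSFun (m k : ℕ) (X : Opens (Fin n → ℝ)) : Subalgebra ℝ (SFun n m k) where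
  carrier := {f | SmoothOn f (cyl m k X)}
  mul_mem' hf hg := hf.mul hg
  add_mem' hf hg := hf.add hg
  algebraMap_mem' _ := smoothOn_const _

/-- The restriction of superfunctions to the given values of the even coordinates. -/
def restrictCyl (m k : ℕ) (X : Opens (Fin n → ℝ)) :
    SFun n m k →ₐ[ℝ] (cyl m k X → Grassmann n m k) where
  toFun f u := f u
  map_one' := rfl
  map_mul' _ _ := rfl
  map_zero' := rfl
  map_add' _ _ := rfl
  commutes' _ := rfl

/-- The algebra of smooth superfunctions over `X`. -/
def SmoothAlg (m k : ℕ) (X : Opens (Fin n → ℝ)) : Subalgebra ℝ (cyl m k X → Grassmann n m k) :=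
  (smoothSFun m k X).map (restrictCyl m k X)

/-- The superfunction `f` restricts to `a` over `X`. -/
def Rep (f : SFun n m k) (a : SmoothAlg m k X) : Prop := ∀ u : cyl m k X, f u = a.1 u

lemma SmoothOn.exists_rep (hf : SmoothOn f (cyl m k X)) : ∃ a : SmoothAlg m k X, Rep f a :=
  ⟨⟨restrictCyl m k X f, f, hf, rfl⟩, fun _ => rfl⟩

lemma exists_rep (a : SmoothAlg m k X) : ∃ f : SFun n m k, Rep f a := by
  obtain ⟨_, f, -, rfl⟩ := a
  exact ⟨f, fun _ => rfl⟩

namespace Rep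

variable {a b : SmoothAlg m k X}

lemma smoothOn (hf : Rep f a) : SmoothOn f (cyl m k X) := by
  obtain ⟨_, g, hg, rfl⟩ := a
  exact SmoothOn.congr hg fun u hu => (hf ⟨u, hu⟩).symm

/-- The bridge between pointwise identities of superfunctions over `X` and identities in the
algebra. -/
lemma eqOn_iff (hf : Rep f a) (hg : Rep g b) : EqOn f g (cyl m k X) ↔ a = b := by
  constructor
  · intro h
    ext u
    rw [← hf, ← hg, h u.2]
  · rintro rfl u hu
    exact (hf ⟨u, hu⟩).trans (hg ⟨u, hu⟩).symm

lemma congr (hf : Rep f a) (h : EqOn f g (cyl m k X)) : Rep g a :=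
  fun u => (h u.2).symm.trans (hf u)

lemma add (hf : Rep f a) (hg : Rep g b) : Rep (f + g) (a + b) :=
  fun u => congrArg₂ (· + ·) (hf u) (hg u)

lemma sub (hf : Rep f a) (hg : Rep g b) : Rep (f - g) (a - b) :=
  fun u => congrArg₂ (· - ·) (hf u) (hg u)

lemma neg (hf : Rep f a) : Rep (-f) (-a) := fun u => congrArg (- ·) (hf u)

lemma mul (hf : Rep f a) (hg : Rep g b) : Rep (f * g) (a * b) :=
  fun u => congrArg₂ (· * ·) (hf u) (hg u)

lemma smul (c : ℝ) (hf : Rep f a) : Rep (c • f) (c • a) := fun u => congrArg (c • ·) (hf u)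

lemma zero : Rep (0 : SFun n m k) (0 : SmoothAlg m k X) := fun _ => rfl

lemma one : Rep (1 : SFun n m k) (1 : SmoothAlg m k X) := fun _ => rfl

lemma sum {ι : Type*} {s : Finset ι} {f : ι → SFun n m k} {a : ι → SmoothAlg m k X}
    (h : ∀ i, Rep (f i) (a i)) : Rep (∑ i ∈ s, f i) (∑ i ∈ s, a i) := by
  classical
  induction s using Finset.induction_on with
  | empty => simpa using zero
  | insert i s hi ih => simpa [Finset.sum_insert hi] using (h i).add ih

end Rep

/-- The operation on `SmoothAlg m k X` that is induced by a local operation on superfunctions. -/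
def liftOp (T : SFun n m k → SFun n m k)
    (hT : ∀ f, SmoothOn f (cyl m k X) → SmoothOn (T f) (cyl m k X)) (a : SmoothAlg m k X) :
    SmoothAlg m k X :=
  (hT _ (exists_rep a).choose_spec.smoothOn).exists_rep.choose

/-- `liftOp` acts on a chosen representative; locality of `T` makes the choice irrelevant. -/
lemma rep_liftOp {T : SFun n m k → SFun n m k}
    {hT : ∀ f, SmoothOn f (cyl m k X) → SmoothOn (T f) (cyl m k X)}
    (h : ∀ f g, EqOn f g (cyl m k X) → EqOn (T f) (T g) (cyl m k X))
    {a : SmoothAlg m k X} (hf : Rep f a) : Rep (T f) (liftOp T hT a) :=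
  (hT _ (exists_rep a).choose_spec.smoothOn).exists_rep.choose_spec.congr
    (h _ _ (((exists_rep a).choose_spec.eqOn_iff hf).2 rfl))

/-- The partial derivatives of a superfunction. -/
def partialDeriv : Coord n m k → SFun n m k → SFun n m k
  | .inl e => evenDeriv e
  | .inr o => oddDeriv o

lemma SmoothOn.partialDeriv (hf : SmoothOn f (cyl m k X)) (w : Coord n m k) :
    SmoothOn (partialDeriv w f) (cyl m k X) := by
  rcases w with e | o
  · exact hf.evenDeriv isOpen_cyl e
  · exact hf.linear (CliffordAlgebra.contractLeft _)

lemma partialDeriv_congr (w : Coord n m k) (h : EqOn f g (cyl m k X)) :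
    EqOn (partialDeriv w f) (partialDeriv w g) (cyl m k X) := by
  rcases w with e | o
  · exact evenDeriv_congr isOpen_cyl h e
  · intro u hu
    simp only [partialDeriv, oddDeriv]
    rw [h hu]

/-- The coordinates as superfunctions. -/
def coordVar : Coord n m k → SFun n m k
  | .inl e => evenVar e
  | .inr o => oddVar o

lemma smoothOn_coordVar (w : Coord n m k) : SmoothOn (coordVar w) (cyl m k X) := by
  rcases w with e | o
  · exact smoothOn_evenVar e
  · exact smoothOn_const _

lemma restrictL_eq : (restrictL : SFun n m k → SFun n m k) =
    setToZero (fun e => Coord.tang (.inl e)) (fun o => Coord.tang (.inr o)) := by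
  unfold restrictL
  congr 1
  · ext e; cases e <;> rfl
  · ext o; cases o <;> rfl

lemma restrictN_eq : (restrictN : SFun n m k → SFun n m k) =
    setToZero (fun e => !Coord.vel (.inl e)) (fun o => !Coord.vel (.inr o)) := by
  unfold restrictN
  congr 1
  · ext e; cases e <;> rfl
  · ext o; cases o <;> rfl

lemma restrictM_eq : (restrictM : SFun n m k → SFun n m k) =
    setToZero (fun e => Coord.tang (.inl e) && !Coord.vel (.inl e))
      (fun o => Coord.tang (.inr o) && !Coord.vel (.inr o)) := by
  unfold restrictM
  congr 1
  · ext e; cases e <;> rfl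
  · ext o; cases o <;> rfl

lemma restrictL_restrictN (f : SFun n m k) : restrictL (restrictN f) = restrictM f := by
  rw [restrictL_eq, restrictN_eq, restrictM_eq, setToZero_setToZero]

lemma restrictL_restrictM (f : SFun n m k) : restrictL (restrictM f) = restrictM f := by
  rw [restrictL_eq, restrictM_eq, setToZero_setToZero]
  congr 1 <;> ext <;> simp

lemma restrictN_restrictM (f : SFun n m k) : restrictN (restrictM f) = restrictM f := by
  rw [restrictN_eq, restrictM_eq, setToZero_setToZero]
  congr 1
  · ext e; cases Coord.tang (.inl e) <;> cases Coord.vel (.inl e) <;> rfl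
  · ext e; cases Coord.tang (.inr e) <;> cases Coord.vel (.inr e) <;> rfl

lemma SmoothOn.restrictL (hf : SmoothOn f (cyl m k X)) :
    SmoothOn (restrictL f) (cyl m k X) := by
  rw [restrictL_eq]; exact hf.setToZero (mapsTo_maskEven fun _ => rfl)

lemma restrictL_congr (h : EqOn f g (cyl m k X)) :
    EqOn (restrictL f) (restrictL g) (cyl m k X) := by
  rw [restrictL_eq]; exact setToZero_congr (fun _ => rfl) h

lemma SmoothOn.parityInv (hf : SmoothOn f (cyl m k X)) : SmoothOn (parityInv f) (cyl m k X) :=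
  hf.linear CliffordAlgebra.involute.toLinearMap

lemma parityInv_congr (h : EqOn f g (cyl m k X)) :
    EqOn (parityInv f) (parityInv g) (cyl m k X) := fun u hu => by
  simp only [parityInv]; rw [h hu]

variable (X) in
/-- The parity involution. -/
def algInv : SmoothAlg m k X → SmoothAlg m k X := liftOp parityInv fun _ hf => hf.parityInv

lemma Rep.parityInv {a : SmoothAlg m k X} (hf : Rep f a) : Rep (parityInv f) (algInv X a) :=
  rep_liftOp (fun _ _ h => parityInv_congr h) hf

variable (X) in
/-- The partial derivatives. -/
def algPd (w : Coord n m k) : SmoothAlg m k X → SmoothAlg m k X :=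
  liftOp (partialDeriv w) fun _ hf => hf.partialDeriv w

lemma Rep.partialDeriv {a : SmoothAlg m k X} (hf : Rep f a) (w : Coord n m k) :
    Rep (partialDeriv w f) (algPd X w a) :=
  rep_liftOp (fun _ _ h => partialDeriv_congr w h) hf

variable (X) in
/-- The restriction to `𝓛`. -/
def algR : SmoothAlg m k X → SmoothAlg m k X := liftOp restrictL fun _ hf => hf.restrictL

lemma Rep.restrictL {a : SmoothAlg m k X} (hf : Rep f a) : Rep (restrictL f) (algR X a) :=
  rep_liftOp (fun _ _ h => restrictL_congr h) hf

variable (X) in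
/-- The coordinates. -/
def algX (w : Coord n m k) : SmoothAlg m k X := (smoothOn_coordVar w).exists_rep.choose

lemma rep_algX (w : Coord n m k) : Rep (coordVar w) (algX X w) :=
  (smoothOn_coordVar w).exists_rep.choose_spec

lemma parityInv_smul (c : ℝ) (f : SFun n m k) : parityInv (c • f) = c • parityInv f := by
  ext u; simp only [parityInv, Pi.smul_apply, map_smul]

lemma oddDeriv_smul (c : ℝ) (f : SFun n m k) (o : OddCoord n m k) :
    oddDeriv o (c • f) = c • oddDeriv o f := by
  ext u; simp only [oddDeriv, Pi.smul_apply, map_smul]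

lemma restrictL_smul (c : ℝ) (f : SFun n m k) : restrictL (c • f) = c • restrictL f := by
  ext u; simp only [restrictL_eq, setToZero_apply, Pi.smul_apply, map_smul]

lemma partialDeriv_add (w : Coord n m k) (hf : SmoothOn f (cyl m k X))
    (hg : SmoothOn g (cyl m k X)) :
    EqOn (partialDeriv w (f + g)) (partialDeriv w f + partialDeriv w g) (cyl m k X) := by
  intro u hu
  rcases w with e | o
  · exact ((hf.hasEvenDeriv isOpen_cyl hu e).add (hg.hasEvenDeriv isOpen_cyl hu e)).evenDeriv_eq
  · exact map_add _ _ _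

lemma partialDeriv_smul (w : Coord n m k) (c : ℝ) (hf : SmoothOn f (cyl m k X)) :
    EqOn (partialDeriv w (c • f)) (c • partialDeriv w f) (cyl m k X) := by
  intro u hu
  rcases w with e | o
  · exact ((hf.hasEvenDeriv isOpen_cyl hu e).linear (T := LinearMap.lsmul ℝ _ c)).evenDeriv_eq
  · exact congrFun (oddDeriv_smul c f o) u

lemma partialDeriv_mul (w : Coord n m k) (hf : SmoothOn f (cyl m k X))
    (hg : SmoothOn g (cyl m k X)) :
    EqOn (partialDeriv w (f * g)) (partialDeriv w f * g +
      (if Coord.odd w then parityInv f else f) * partialDeriv w g) (cyl m k X) := by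
  intro u hu
  rcases w with e | o
  · exact ((hf.hasEvenDeriv isOpen_cyl hu e).mul (hg.hasEvenDeriv isOpen_cyl hu e)).evenDeriv_eq
  · exact contractLeft_mul _ _ _

lemma parityInv_partialDeriv (w : Coord n m k) (hf : SmoothOn f (cyl m k X)) :
    EqOn (parityInv (partialDeriv w f))
      (if Coord.odd w then -partialDeriv w (parityInv f) else partialDeriv w (parityInv f))
      (cyl m k X) := by
  intro u hu
  rcases w with e | o
  · exact ((hf.hasEvenDeriv isOpen_cyl hu e).linear
      (T := CliffordAlgebra.involute.toLinearMap)).evenDeriv_eq.symm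
  · exact involute_contractLeft _ _

lemma partialDeriv_comm (v w : Coord n m k) (hf : SmoothOn f (cyl m k X)) :
    EqOn (partialDeriv v (partialDeriv w f))
      (if Coord.odd v && Coord.odd w then -partialDeriv w (partialDeriv v f)
        else partialDeriv w (partialDeriv v f)) (cyl m k X) := by
  have key : ∀ (e : EvenCoord n m k) (o : OddCoord n m k), EqOn
      (evenDeriv e (oddDeriv o f)) (oddDeriv o (evenDeriv e f)) (cyl m k X) := fun e o u hu =>
    ((hf.hasEvenDeriv isOpen_cyl hu e).linear (T := CliffordAlgebra.contractLeft _)).evenDeriv_eq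
  rcases v with e | o <;> rcases w with e' | o'
  · exact fun u hu => hf.evenDeriv_comm isOpen_cyl hu e e'
  · exact key e o'
  · exact (key e' o).symm
  · exact fun u hu => CliffordAlgebra.contractLeft_comm _ _ _

lemma partialDeriv_coordVar (v w : Coord n m k) :
    partialDeriv v (coordVar w) = if v = w then 1 else 0 := by
  ext u
  rcases v with e | o <;> rcases w with e' | o'
  · refine (hasEvenDeriv_evenVar e e').evenDeriv_eq.trans ?_
    simp only [Sum.inl.injEq]; split_ifs <;> rfl
  · refine (hasEvenDeriv_of_const fun t => rfl).evenDeriv_eq.trans ?_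
    simp
  · simp [partialDeriv, coordVar, oddDeriv, evenVar]
  · simp only [partialDeriv, coordVar, oddDeriv, oddVar, gen, ExteriorAlgebra.ι]
    rw [CliffordAlgebra.contractLeft_ι]
    simp only [LinearMap.proj_apply, Pi.single_apply, Sum.inr.injEq]
    split_ifs <;> simp

lemma parityInv_coordVar (w : Coord n m k) :
    parityInv (coordVar w) = if Coord.odd w then -coordVar w else coordVar w := by
  ext u
  rcases w with e' | o'
  · simp [parityInv, coordVar, evenVar, Coord.odd]
  · exact CliffordAlgebra.involute_ι _

lemma restrictL_partialDeriv (w : Coord n m k) (hw : Coord.tang w) (hf : SmoothOn f (cyl m k X)) :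
    EqOn (restrictL (partialDeriv w f)) (partialDeriv w (restrictL f)) (cyl m k X) := by
  rw [restrictL_eq]
  intro u hu
  rcases w with e | o
  · exact (hf.evenDeriv_setToZero isOpen_cyl (mapsTo_maskEven (by exact fun _ => rfl) hu) hw).symm
  · exact congrFun (oddDeriv_setToZero o hw).symm u

lemma partialDeriv_restrictL (w : Coord n m k) (hw : ¬ Coord.tang w) :
    partialDeriv w (restrictL f) = 0 := by
  rw [restrictL_eq]
  rcases w with e | o
  · ext u; exact evenDeriv_setToZero_of_not hw
  · exact oddDeriv_setToZero_of_not o hw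

lemma partialDeriv_restrictN (w : Coord n m k) (hw : Coord.vel w) :
    partialDeriv w (restrictN f) = 0 := by
  rw [restrictN_eq]
  rcases w with e | o
  · ext u; exact evenDeriv_setToZero_of_not (by simp [hw])
  · exact oddDeriv_setToZero_of_not o (by simp [hw])

lemma restrictL_coordVar (w : Coord n m k) :
    restrictL (coordVar w) = if Coord.tang w then coordVar w else 0 := by
  ext u
  rw [restrictL_eq]
  rcases w with e | o
  · simp only [setToZero_apply, coordVar, evenVar, AlgHom.commutes, maskEven]
    split_ifs <;> simp [evenVar]
  · simp only [setToZero_apply, coordVar, oddVar, gen, ExteriorAlgebra.map_apply_ι]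
    have : maskOdd (fun o => Coord.tang (.inr o)) (Pi.single o 1) =
        if Coord.tang (.inr o) then (Pi.single o 1 : OddCoord n m k → ℝ) else 0 := by
      ext o'
      rw [maskOdd_apply]
      by_cases h : o' = o
      · subst h; split_ifs <;> simp
      · split_ifs <;> simp [h]
    rw [this]
    split_ifs <;> simp [oddVar, gen]

/-- The four terms for each index `A` are the two conjugate pairs of `A`, each in both orders, with
the signs collected in `eps`. In the terms carrying two involutions for odd `A`, these cancel. -/
lemma bracket_eq (f g : SFun n m k) : bracket f g = ∑ w, Coord.eps w •
    (partialDeriv w (if Coord.odd w then parityInv f else f) *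
      partialDeriv (Coord.conj w) g) := by
  have h : parityInv (parityInv f) = f := funext fun u => CliffordAlgebra.involute_involute _
  conv_rhs => rw [Fintype.sum_sum_type, sum_evenCoord, sum_oddCoord]
  rw [bracket, Fintype.sum_sum_type]
  simp only [sgn, twist, dPhi, dPhiStar, dVel, dVelStar, Coord.eps, Coord.odd, Coord.conj,
    partialDeriv, h, one_smul, neg_smul, if_true, Bool.false_eq_true, if_false,
    Finset.sum_add_distrib, Finset.sum_sub_distrib, Finset.sum_neg_distrib]
  abel

/-! ### The smooth superfunctions as a `SuperCalculus` -/

variable (m k X) in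
/-- The parity involution as a homomorphism of algebras. -/
def invHom : SmoothAlg m k X →ₐ[ℝ] SmoothAlg m k X := AlgHom.ofLinearMap
    { toFun := algInv X
      map_add' := fun a b => by
        obtain ⟨f, hf⟩ := exists_rep a
        obtain ⟨g, hg⟩ := exists_rep b
        exact ((hf.add hg).parityInv.eqOn_iff (hf.parityInv.add hg.parityInv)).1
          fun u _ => map_add _ _ _
      map_smul' := fun c a => by
        obtain ⟨f, hf⟩ := exists_rep a
        exact ((hf.smul c).parityInv.eqOn_iff (hf.parityInv.smul c)).1
          fun u _ => congrFun (parityInv_smul c f) u }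
    ((Rep.one.parityInv.eqOn_iff Rep.one).1 fun u _ => map_one _)
    (fun a b => by
        obtain ⟨f, hf⟩ := exists_rep a
        obtain ⟨g, hg⟩ := exists_rep b
        exact ((hf.mul hg).parityInv.eqOn_iff (hf.parityInv.mul hg.parityInv)).1
          fun u _ => map_mul _ _ _)

variable (m k X) in
/-- The restriction to `𝓛` as a homomorphism of algebras. -/
def resHom : SmoothAlg m k X →ₐ[ℝ] SmoothAlg m k X := AlgHom.ofLinearMap
    { toFun := algR X
      map_add' := fun a b => by
        obtain ⟨f, hf⟩ := exists_rep a
        obtain ⟨g, hg⟩ := exists_rep b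
        exact ((hf.add hg).restrictL.eqOn_iff (hf.restrictL.add hg.restrictL)).1
          fun u _ => map_add _ _ _
      map_smul' := fun c a => by
        obtain ⟨f, hf⟩ := exists_rep a
        exact ((hf.smul c).restrictL.eqOn_iff (hf.restrictL.smul c)).1
          fun u _ => congrFun (restrictL_smul c f) u }
    ((Rep.one.restrictL.eqOn_iff Rep.one).1 fun u _ => map_one _)
    (fun a b => by
        obtain ⟨f, hf⟩ := exists_rep a
        obtain ⟨g, hg⟩ := exists_rep b
        exact ((hf.mul hg).restrictL.eqOn_iff (hf.restrictL.mul hg.restrictL)).1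
          fun u _ => map_mul _ _ _)

variable (m k X) in
/-- The partial derivatives as linear maps. -/
def pdHom (w : Coord n m k) : SmoothAlg m k X →ₗ[ℝ] SmoothAlg m k X where
  toFun := algPd X w
  map_add' := fun a b => by
    obtain ⟨f, hf⟩ := exists_rep a
    obtain ⟨g, hg⟩ := exists_rep b
    exact (((hf.add hg).partialDeriv w).eqOn_iff
      ((hf.partialDeriv w).add (hg.partialDeriv w))).1
      (partialDeriv_add w hf.smoothOn hg.smoothOn)
  map_smul' := fun c a => by
    obtain ⟨f, hf⟩ := exists_rep a
    exact (((hf.smul c).partialDeriv w).eqOn_iff ((hf.partialDeriv w).smul c)).1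
      (partialDeriv_smul w c hf.smoothOn)

namespace Rep

variable {a : SmoothAlg m k X}

lemma inv (hf : Rep f a) : Rep (WeakKoszul.parityInv f) (invHom m k X a) := hf.parityInv

lemma pd (hf : Rep f a) (w : Coord n m k) :
    Rep (WeakKoszul.partialDeriv w f) (pdHom m k X w a) := hf.partialDeriv w

lemma r (hf : Rep f a) : Rep (WeakKoszul.restrictL f) (resHom m k X a) := hf.restrictL

end Rep

lemma invHom_invHom (a : SmoothAlg m k X) : invHom m k X (invHom m k X a) = a := by
  obtain ⟨f, hf⟩ := exists_rep a
  exact (hf.inv.inv.eqOn_iff hf).1 fun u _ => CliffordAlgebra.involute_involute _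

lemma mul_comm_of_invHom_eq (a : SmoothAlg m k X) (ha : invHom m k X a = a)
    (b : SmoothAlg m k X) : a * b = b * a := by
  obtain ⟨f, hf⟩ := exists_rep a
  obtain ⟨g, hg⟩ := exists_rep b
  have h := (hf.inv.eqOn_iff hf).2 ha
  exact ((hf.mul hg).eqOn_iff (hg.mul hf)).1 fun u hu => mul_comm_of_involute_eq (h hu) _

lemma mul_comm_of_invHom_eq_neg (a : SmoothAlg m k X) (ha : invHom m k X a = -a)
    (b : SmoothAlg m k X) : a * b = invHom m k X b * a := by
  obtain ⟨f, hf⟩ := exists_rep a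
  obtain ⟨g, hg⟩ := exists_rep b
  have h := (hf.inv.eqOn_iff hf.neg).2 ha
  exact ((hf.mul hg).eqOn_iff (hg.inv.mul hf)).1
    fun u hu => mul_comm_of_involute_eq_neg (h hu) _

lemma pdHom_mul (w : Coord n m k) (a b : SmoothAlg m k X) :
    pdHom m k X w (a * b) = pdHom m k X w a * b +
      (if Coord.odd w then invHom m k X a else a) * pdHom m k X w b := by
  obtain ⟨f, hf⟩ := exists_rep a
  obtain ⟨g, hg⟩ := exists_rep b
  have h : Rep (if Coord.odd w then parityInv f else f)
      (if Coord.odd w then invHom m k X a else a) := by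
    cases Coord.odd w
    · exact hf
    · exact hf.inv
  exact (((hf.mul hg).pd w).eqOn_iff (((hf.pd w).mul hg).add (h.mul (hg.pd w)))).1
    (partialDeriv_mul w hf.smoothOn hg.smoothOn)

lemma invHom_pdHom (w : Coord n m k) (a : SmoothAlg m k X) :
    invHom m k X (pdHom m k X w a) =
      if Coord.odd w then -pdHom m k X w (invHom m k X a) else pdHom m k X w (invHom m k X a) := by
  obtain ⟨f, hf⟩ := exists_rep a
  refine ((hf.pd w).inv.eqOn_iff ?_).1 (parityInv_partialDeriv w hf.smoothOn)
  cases Coord.odd w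
  · exact hf.inv.pd w
  · exact (hf.inv.pd w).neg

lemma pdHom_comm (v w : Coord n m k) (a : SmoothAlg m k X) :
    pdHom m k X v (pdHom m k X w a) =
      if Coord.odd v && Coord.odd w then -pdHom m k X w (pdHom m k X v a)
        else pdHom m k X w (pdHom m k X v a) := by
  obtain ⟨f, hf⟩ := exists_rep a
  refine (((hf.pd w).pd v).eqOn_iff ?_).1 (partialDeriv_comm v w hf.smoothOn)
  cases Coord.odd v && Coord.odd w
  · exact (hf.pd v).pd w
  · exact ((hf.pd v).pd w).neg

lemma invHom_algX (w : Coord n m k) :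
    invHom m k X (algX X w) = if Coord.odd w then -algX X w else algX X w := by
  refine ((rep_algX w).inv.eqOn_iff ?_).1 fun u _ => by rw [parityInv_coordVar]
  cases Coord.odd w
  · exact rep_algX w
  · exact (rep_algX w).neg

lemma pdHom_algX (v w : Coord n m k) :
    pdHom m k X v (algX X w) = if v = w then 1 else 0 := by
  refine (((rep_algX w).pd v).eqOn_iff ?_).1 fun u _ => by rw [partialDeriv_coordVar]
  split_ifs
  · exact Rep.one
  · exact Rep.zero

lemma resHom_resHom (a : SmoothAlg m k X) : resHom m k X (resHom m k X a) = resHom m k X a := by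
  obtain ⟨f, hf⟩ := exists_rep a
  refine (hf.r.r.eqOn_iff hf.r).1 fun u _ => ?_
  rw [restrictL_eq, setToZero_setToZero]
  simp only [Bool.and_self]

lemma resHom_invHom (a : SmoothAlg m k X) :
    resHom m k X (invHom m k X a) = invHom m k X (resHom m k X a) := by
  obtain ⟨f, hf⟩ := exists_rep a
  refine (hf.inv.r.eqOn_iff hf.r.inv).1 fun u _ => ?_
  rw [restrictL_eq, setToZero_parityInv]

lemma resHom_pdHom (w : Coord n m k) (a : SmoothAlg m k X) (hw : Coord.tang w) :
    resHom m k X (pdHom m k X w a) = pdHom m k X w (resHom m k X a) := by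
  obtain ⟨f, hf⟩ := exists_rep a
  exact ((hf.pd w).r.eqOn_iff (hf.r.pd w)).1 (restrictL_partialDeriv w hw hf.smoothOn)

lemma pdHom_resHom (w : Coord n m k) (a : SmoothAlg m k X) (hw : ¬ Coord.tang w) :
    pdHom m k X w (resHom m k X a) = 0 := by
  obtain ⟨f, hf⟩ := exists_rep a
  exact ((hf.r.pd w).eqOn_iff Rep.zero).1 fun u _ => by rw [partialDeriv_restrictL w hw]

lemma resHom_algX (w : Coord n m k) :
    resHom m k X (algX X w) = if Coord.tang w then algX X w else 0 := by
  refine ((rep_algX w).r.eqOn_iff ?_).1 fun u _ => by rw [restrictL_coordVar]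
  split_ifs
  · exact rep_algX w
  · exact Rep.zero

variable (m k X) in
/-- The calculus of smooth superfunctions over `X`. -/
def smoothCalc : SuperCalculus n m k (SmoothAlg m k X) where
  inv := invHom m k X
  inv_inv := invHom_invHom
  comm_of_even := mul_comm_of_invHom_eq
  comm_of_odd := mul_comm_of_invHom_eq_neg
  pd := pdHom m k X
  pd_mul := pdHom_mul
  inv_pd := invHom_pdHom
  pd_comm := pdHom_comm
  X := algX X
  inv_X := invHom_algX
  pd_X := pdHom_algX
  r := resHom m k X
  r_r := resHom_resHom
  r_inv := resHom_invHom
  r_pd := resHom_pdHom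
  pd_r := pdHom_resHom
  r_X := resHom_algX

namespace Rep

variable {a b c : SmoothAlg m k X} {h : SFun n m k}

lemma coord (w : Coord n m k) : Rep (coordVar w) ((smoothCalc m k X).X w) := rep_algX w

lemma bracket (hf : Rep f a) (hg : Rep g b) :
    Rep (bracket f g) ((smoothCalc m k X).br a b) := by
  rw [bracket_eq]
  refine sum fun w => (mul (pd ?_ w) (hg.pd (Coord.conj w))).smul _
  cases Coord.odd w
  · exact hf
  · exact hf.inv

lemma delta : Rep (Delta n m k) ((smoothCalc m k X).delta) :=
  (sum fun i => (coord (.inr (.dx i))).mul (coord (.inl (.dxStar i)))).sub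
    (sum fun a => (coord (.inl (.dz a))).mul (coord (.inr (.dzStar a))))

lemma lift (hf : Rep f a) : Rep (lift f) ((smoothCalc m k X).lft a) := delta.bracket hf

lemma extDeriv (hf : Rep f a) : Rep (extDeriv f) ((smoothCalc m k X).r ((smoothCalc m k X).lft a)) :=
  (delta.bracket hf).r

lemma oddBracket (hf : Rep f a) (hg : Rep g b) :
    Rep (oddBracket f g) ((smoothCalc m k X).br ((smoothCalc m k X).lft a) b) := hf.lift.bracket hg

lemma koszul (hf : Rep f a) (hg : Rep g b) (hh : Rep h c) :
    Rep (koszul f g h) ((smoothCalc m k X).kos a b c) := ((hf.lift.bracket hg).bracket hh).r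

end Rep

lemma noVel_of_rep {a : SmoothAlg m k X} (hf : Rep f a) (h : EqOn (restrictN f) f (cyl m k X)) :
    (smoothCalc m k X).NoVel a := fun w hw =>
  ((hf.pd w).eqOn_iff Rep.zero).1 ((partialDeriv_congr w h.symm).trans
    fun u _ => by rw [partialDeriv_restrictN w hw])

end Algebra

/-! ## The chain rule for substitutions -/

section Substitution

variable {L : ℝ → (OddCoord n m k → ℝ) →ₗ[ℝ] (OddCoord n m k → ℝ)}
  {L' : OddCoord n m k → (OddCoord n m k → ℝ)}

lemma weakDeriv_ι (hL : ∀ o o', HasDerivAt (fun t => L t (Pi.single o 1) o') (L' o o') 0)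
    (v : OddCoord n m k → ℝ) :
    WeakDeriv (fun t => ExteriorAlgebra.ι ℝ (L t v)) (ExteriorAlgebra.ι ℝ (∑ o, v o • L' o)) := by
  intro l
  obtain ⟨c, h⟩ : ∃ c : OddCoord n m k → ℝ, ∀ w : OddCoord n m k → ℝ,
      l (ExteriorAlgebra.ι ℝ w) = ∑ o', w o' * c o' := by
    refine ⟨fun o' => l (ExteriorAlgebra.ι ℝ (Pi.single o' 1)), fun w => ?_⟩
    conv_lhs => rw [pi_eq_sum_univ' w]
    simp only [map_sum, map_smul, smul_eq_mul]
  have h2 : ∀ t, L t v = ∑ o, v o • L t (Pi.single o 1) := by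
    intro t
    conv_lhs => rw [pi_eq_sum_univ' v]
    simp only [map_sum, map_smul]
  simp only [h, h2, Finset.sum_apply, Pi.smul_apply, smul_eq_mul]
  exact HasDerivAt.fun_sum fun o' _ =>
    (HasDerivAt.fun_sum fun o _ => (hL o o').const_mul (v o)).mul_const _

/-- The odd half of the chain rule: varying the linear substitution acts as the vector field with
coefficients `L'` on the odd coordinates. -/
lemma weakDeriv_map (hL : ∀ o o', HasDerivAt (fun t => L t (Pi.single o 1) o') (L' o o') 0)
    (a : Grassmann n m k) :
    WeakDeriv (fun t => ExteriorAlgebra.map (L t) a)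
      (∑ o, ExteriorAlgebra.ι ℝ (L' o) * ExteriorAlgebra.map (L 0)
        (CliffordAlgebra.contractLeft (LinearMap.proj o) a)) := by
  induction a using CliffordAlgebra.left_induction with
  | algebraMap r => intro l; simpa using hasDerivAt_const (0 : ℝ) (l (algebraMap ℝ _ r))
  | add x y hx hy =>
    intro l
    simpa only [map_add, mul_add, Finset.sum_add_distrib] using (hx l).fun_add (hy l)
  | ι_mul x v h =>
    have e : ∀ t y, ExteriorAlgebra.map (L t) (CliffordAlgebra.ι 0 v * y) =
        ExteriorAlgebra.ι ℝ (L t v) * ExteriorAlgebra.map (L t) y := fun t y => by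
      rw [map_mul]; exact congrArg (· * _) (ExteriorAlgebra.map_apply_ι (L t) v)
    have h' := (weakDeriv_ι hL v).mul h
    simp only [e]
    convert h' using 1
    rw [map_sum, Finset.sum_mul, Finset.mul_sum, ← Finset.sum_add_distrib]
    refine Finset.sum_congr rfl fun o _ => ?_
    -- The sign from exchanging two odd vectors compensates the minus sign in the contraction of a
    -- product.
    have e2 : ExteriorAlgebra.ι ℝ (L' o) * ExteriorAlgebra.ι ℝ (L 0 v) =
        -(ExteriorAlgebra.ι ℝ (L 0 v) * ExteriorAlgebra.ι ℝ (L' o)) :=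
      eq_neg_of_add_eq_zero_left (ExteriorAlgebra.ι_add_mul_swap _ _)
    rw [CliffordAlgebra.contractLeft_ι_mul, map_sub, e, map_smul, map_smul, mul_sub, ← mul_assoc,
      e2, mul_smul_comm, smul_mul_assoc, neg_mul, sub_neg_eq_add, mul_assoc, LinearMap.proj_apply]

/-- Expanding `h` in a fixed basis separates the two dependences: the coefficients vary through `Y`,
the images of the basis vectors through `L`. -/
lemma weakDeriv_subst (hL : ∀ o o', HasDerivAt (fun t => L t (Pi.single o 1) o') (L' o o') 0)
    {Y : ℝ → EvenCoord n m k → ℝ} {Y' : EvenCoord n m k → ℝ}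
    (hY : ∀ e, HasDerivAt (fun t => Y t e) (Y' e) 0) {U : Set (EvenCoord n m k → ℝ)}
    (hU : IsOpen U) (hY0 : Y 0 ∈ U) {h : SFun n m k} (hh : SmoothOn h U) :
    WeakDeriv (fun t => ExteriorAlgebra.map (L t) (h (Y t)))
      (∑ e, Y' e • ExteriorAlgebra.map (L 0) (evenDeriv e h (Y 0)) +
        ∑ o, ExteriorAlgebra.ι ℝ (L' o) * ExteriorAlgebra.map (L 0) (oddDeriv o h (Y 0))) := by
  intro l
  have e1 : ∀ (K : Grassmann n m k →ₗ[ℝ] ℝ) (a : Grassmann n m k),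
      K a = ∑ i, (𝔟).coord i a * K (𝔟 i) := functional_eq_sum
  have e2 : ∀ t, l (ExteriorAlgebra.map (L t) (h (Y t))) =
      ∑ i, (𝔟).coord i (h (Y t)) * l (ExteriorAlgebra.map (L t) (𝔟 i)) :=
    fun t => e1 (l ∘ₗ (ExteriorAlgebra.map (L t)).toLinearMap) _
  have e3 : ∀ i, HasDerivAt (fun t => (𝔟).coord i (h (Y t)))
      (∑ e, Y' e * (𝔟).coord i (evenDeriv e h (Y 0))) 0 := by
    intro i
    have hd : HasFDerivAt (fun u => (𝔟).coord i (h u))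
        (fderiv ℝ (fun u => (𝔟).coord i (h u)) (Y 0)) (Y 0) :=
      (((hh ((𝔟).coord i)).contDiffAt (hU.mem_nhds hY0)).differentiableAt (by simp)).hasFDerivAt
    have hc := hd.comp_hasDerivAt 0 (hasDerivAt_pi.2 hY)
    refine hc.congr_deriv ?_
    conv_lhs => rw [pi_eq_sum_univ' Y']
    simp only [map_sum, map_smul, smul_eq_mul]
    exact Finset.sum_congr rfl fun e _ => by rw [hh.functional_evenDeriv hU hY0]
  simp only [e2]
  refine (HasDerivAt.fun_sum fun i _ => (e3 i).mul (weakDeriv_map hL (𝔟 i) l)).congr_deriv ?_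
  rw [Finset.sum_add_distrib, map_add]
  symm
  congr 1
  · simp only [Finset.sum_mul]
    rw [Finset.sum_comm, map_sum]
    refine Finset.sum_congr rfl fun e _ => ?_
    rw [map_smul, smul_eq_mul]
    have := e1 (l ∘ₗ (ExteriorAlgebra.map (L 0)).toLinearMap) (evenDeriv e h (Y 0))
    simp only [LinearMap.comp_apply, AlgHom.toLinearMap_apply] at this
    rw [this, Finset.mul_sum]
    simp only [mul_assoc]
  · have := e1 (l ∘ₗ ∑ o, LinearMap.mulLeft ℝ (ExteriorAlgebra.ι ℝ (L' o)) ∘ₗ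
      (ExteriorAlgebra.map (L 0)).toLinearMap ∘ₗ
        CliffordAlgebra.contractLeft (LinearMap.proj o)) (h (Y 0))
    simpa only [LinearMap.comp_apply, AlgHom.toLinearMap_apply, LinearMap.sum_apply,
      LinearMap.mulLeft_apply, oddDeriv] using this

end Substitution

/-- The algebra behind the invariance of the odd Poisson bracket. -/
lemma canonical_sum_eq {A : Type*} [Ring A] [Algebra ℝ A] {I G : Type*} [Fintype I] [Fintype G]
    [DecidableEq I] [DecidableEq G] {J K : I → I → ℝ} {T T' : G → G → ℝ} {dS dT : I → G → G → ℝ}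
    {Q Q' α : I → A} {P E β : G → A} (hE : ∀ d i, E d * Q' i = Q i * E d)
    (hJ : ∀ i l, ∑ j, K l j * J j i = if i = l then 1 else 0)
    (hT : ∀ a a', ∑ b, T' a b * T b a' = if a = a' then 1 else 0)
    (hd : ∀ i e a, ∑ j, J j i * dS j e a = -∑ b, ∑ d, dT i d b * T e d * T b a) :
    -∑ j, (∑ i, J j i • Q i) * (∑ l, K l j • α l + ∑ a, (∑ b, dS j b a • E b) * β a) +
      ∑ b, (∑ a, T' a b • P a + ∑ i, (∑ a, dT i a b • ∑ d, T d a • E d) * -Q' i) *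
        (∑ a, T b a • β a) = -∑ i, Q i * α i + ∑ a, P a * β a := by
  -- In the application `J`, `K` are inverse Jacobians and `T`, `T'` inverse transition matrices
  -- with derivatives `dS`, `dT`; `E` are the odd fibre coordinates. The homogeneous terms `h1`,
  -- `h2` contract by invertibility.
  have h1 : ∑ j, (∑ i, J j i • Q i) * (∑ l, K l j • α l) = ∑ i, Q i * α i := by
    have : ∀ j, (∑ i, J j i • Q i) * (∑ l, K l j • α l) =
        ∑ i, ∑ l, (K l j * J j i) • (Q i * α l) := fun j => by
      rw [Finset.sum_mul_sum]
      simp only [smul_mul_smul_comm, mul_comm (J _ _)]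
    simp only [this]
    rw [Finset.sum_comm]
    refine Finset.sum_congr rfl fun i _ => ?_
    rw [Finset.sum_comm]
    simp only [← Finset.sum_smul, hJ]
    simp
  have h2 : ∑ b, (∑ a, T' a b • P a) * (∑ a, T b a • β a) = ∑ a, P a * β a := by
    have : ∀ b, (∑ a, T' a b • P a) * (∑ a, T b a • β a) =
        ∑ a, ∑ a', (T' a b * T b a') • (P a * β a') := fun j => by
      rw [Finset.sum_mul_sum]
      simp only [smul_mul_smul_comm]
    simp only [this]
    rw [Finset.sum_comm]
    refine Finset.sum_congr rfl fun i _ => ?_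
    rw [Finset.sum_comm]
    simp only [← Finset.sum_smul, hT]
    simp
  -- The inhomogeneous terms: `h3` stems from the `x`-dependence of `z'`, `h4` from the
  -- `z*`-dependence of `x*'`. They cancel by `hd`.
  have h3 : ∑ j, (∑ i, J j i • Q i) * (∑ a, (∑ b, dS j b a • E b) * β a) =
      ∑ i, ∑ a, ∑ e, (∑ j, J j i * dS j e a) • (Q i * E e * β a) := by
    have : ∀ j, (∑ i, J j i • Q i) * (∑ a, (∑ b, dS j b a • E b) * β a) =
        ∑ i, ∑ a, ∑ e, (J j i * dS j e a) • (Q i * E e * β a) := fun j => by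
      rw [Finset.sum_mul_sum]
      simp only [Finset.sum_mul, Finset.mul_sum, smul_mul_assoc, mul_smul_comm, smul_smul,
        mul_assoc, mul_comm (dS _ _ _)]
    simp only [this]
    rw [Finset.sum_comm]
    refine Finset.sum_congr rfl fun i _ => ?_
    rw [Finset.sum_comm]
    refine Finset.sum_congr rfl fun a _ => ?_
    rw [Finset.sum_comm]
    simp only [← Finset.sum_smul]
  have h4 : ∑ b, (∑ i, (∑ a, dT i a b • ∑ d, T d a • E d) * -Q' i) * (∑ a, T b a • β a) =
      -∑ i, ∑ a, ∑ e, (∑ b, ∑ d, dT i d b * T e d * T b a) • (Q i * E e * β a) := by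
    have : ∀ b, (∑ i, (∑ a, dT i a b • ∑ d, T d a • E d) * -Q' i) * (∑ a, T b a • β a) =
        -∑ i, ∑ a, ∑ e, (∑ d, dT i d b * T e d * T b a) • (Q i * E e * β a) := fun b => by
      rw [Finset.sum_mul_sum, ← Finset.sum_neg_distrib]
      refine Finset.sum_congr rfl fun i _ => ?_
      rw [← Finset.sum_neg_distrib]
      refine Finset.sum_congr rfl fun a _ => ?_
      have h5 : (∑ a, dT i a b • ∑ d, T d a • E d) * Q' i =
          ∑ e, (∑ d, dT i d b * T e d) • (Q i * E e) := by
        simp only [Finset.smul_sum, Finset.sum_mul, Finset.sum_smul, smul_smul, smul_mul_assoc, hE]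
        rw [Finset.sum_comm]
      rw [mul_neg, neg_mul, h5, Finset.sum_mul]
      simp only [smul_mul_smul_comm, Finset.sum_mul]
    simp only [this]
    rw [Finset.sum_neg_distrib, Finset.sum_comm]
    congr 1
    refine Finset.sum_congr rfl fun i _ => ?_
    rw [Finset.sum_comm]
    refine Finset.sum_congr rfl fun a _ => ?_
    rw [Finset.sum_comm]
    simp only [← Finset.sum_smul]
  simp only [mul_add, add_mul, Finset.sum_add_distrib, h1, h2, h3, h4, hd]
  simp only [neg_smul, Finset.sum_neg_distrib]
  abel

/-! ## Changes of coordinates -/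

section Charts

variable {M : Type*} [TopologicalSpace M] [ChartedSpace (Fin n → ℝ) M]
  {E : M → Type*} [TopologicalSpace (TotalSpace (Fin m → ℝ) E)]
  [∀ p, AddCommGroup (E p)] [∀ p, Module ℝ (E p)] [∀ p, TopologicalSpace (E p)]
  [FiberBundle (Fin m → ℝ) E] [VectorBundle ℝ (Fin m → ℝ) E]
  {F : M → Type*} [TopologicalSpace (TotalSpace (Fin k → ℝ) F)]
  [∀ p, AddCommGroup (F p)] [∀ p, Module ℝ (F p)] [∀ p, TopologicalSpace (F p)]
  [FiberBundle (Fin k → ℝ) F] [VectorBundle ℝ (Fin k → ℝ) F]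

variable (c c' : SuperChart n m k E F)

/-- The coordinates `x` of the points of an open set. -/
def SuperChart.xRegion (D : Opens M) : Opens (Fin n → ℝ) :=
  ⟨c.chart.target ∩ c.chart.symm ⁻¹' D, c.chart.symm.isOpen_inter_preimage D.isOpen⟩

lemma SuperChart.region_eq (D : Opens M) : c.region D = cyl m k (c.xRegion D) := rfl

lemma SuperChart.isOpen_base : IsOpen c.base :=
  c.chart.open_source.inter (c.trivE.open_baseSet.inter c.trivF.open_baseSet)

/-- The linear map of the odd coordinates in a change of coordinates. -/
def transOdd (u : EvenCoord n m k → ℝ) : (OddCoord n m k → ℝ) →ₗ[ℝ] (OddCoord n m k → ℝ) :=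
  Fintype.linearCombination ℝ (transOddGen c c' u)

lemma pullback_apply (f : SFun n m k) (u : EvenCoord n m k → ℝ) :
    pullback c c' f u = ExteriorAlgebra.map (transOdd c c' u) (f (transEven c c' u)) := rfl

lemma transOdd_single (u : EvenCoord n m k → ℝ) (o : OddCoord n m k) :
    transOdd c c' u (Pi.single o 1) = transOddGen c c' u o := by
  simp [transOdd, Fintype.linearCombination_apply_single]

variable {c c'} {D : Opens M} {u : EvenCoord n m k → ℝ}

lemma transEven_mem (hD : (D : Set M) ⊆ c.base ∩ c'.base) (hu : u ∈ c.region D) :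
    transEven c c' u ∈ c'.region D := by
  have h1 : xPart (transEven c c' u) = c'.chart (c.point u) := rfl
  have h2 := (hD hu.2).2.1
  refine ⟨?_, ?_⟩
  · rw [h1]; exact c'.chart.map_source h2
  · rw [SuperChart.point, h1, c'.chart.left_inv h2]; exact hu.2

lemma pullback_congr (hD : (D : Set M) ⊆ c.base ∩ c'.base) {f g : SFun n m k}
    (h : EqOn f g (c'.region D)) : EqOn (pullback c c' f) (pullback c c' g) (c.region D) := by
  intro u hu
  rw [pullback_apply, pullback_apply, h (transEven_mem hD hu)]

variable (c c') in
lemma pullback_parityInv (f : SFun n m k) :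
    pullback c c' (parityInv f) = parityInv (pullback c c' f) := by
  ext u; exact (involute_map _ _).symm

variable (c c') in
lemma pullback_add (f g : SFun n m k) :
    pullback c c' (f + g) = pullback c c' f + pullback c c' g := by
  ext u; exact map_add _ _ _

variable (c c') in
-- Changes of coordinates preserve `𝓜`: both `z*'` and `x*'` are linear in the old momenta,
-- including the inhomogeneous term of `x*'`.
lemma restrictM_pullback (f : SFun n m k) :
    restrictM (pullback c c' f) = pullback c c' (restrictM f) := by
  ext u
  rw [restrictM_eq, setToZero_apply, pullback_apply, pullback_apply, setToZero_apply,
    ← AlgHom.comp_apply, ← AlgHom.comp_apply, ExteriorAlgebra.map_comp_map,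
    ExteriorAlgebra.map_comp_map]
  have hp : c.point (maskEven (fun e => Coord.tang (.inl e) && !Coord.vel (.inl e)) u) =
      c.point u := rfl
  have hL : maskOdd (fun o => Coord.tang (.inr o) && !Coord.vel (.inr o)) ∘ₗ
      transOdd c c' (maskEven (fun e => Coord.tang (.inl e) && !Coord.vel (.inl e)) u) =
      transOdd c c' u ∘ₗ maskOdd fun o => Coord.tang (.inr o) && !Coord.vel (.inr o) := by
    refine LinearMap.pi_ext' fun o => LinearMap.ext_ring ?_
    have hm : ∀ o : OddCoord n m k, maskOdd (fun o => Coord.tang (.inr o) && !Coord.vel (.inr o))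
        (Pi.single o (1 : ℝ)) = if Coord.tang (.inr o) && !Coord.vel (.inr o)
          then Pi.single o 1 else 0 := by
      intro o
      ext o'
      rw [maskOdd_apply]
      by_cases h : o' = o
      · subst h; split_ifs <;> simp
      · split_ifs <;> simp [h]
    simp only [LinearMap.comp_apply, LinearMap.coe_single]
    rw [hm, transOdd_single, apply_ite (transOdd c c' u), transOdd_single, map_zero]
    rcases o with a | i | i | a
    · simp only [transOddGen, hp, map_sum, map_smul, hm]
      simp [Coord.tang, Coord.vel]
    · simp only [transOddGen, hp, map_add, map_sum, map_smul, hm]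
      simp [Coord.tang, Coord.vel, maskEven]
    · simp [transOddGen, Coord.tang, Coord.vel]
    · simp [transOddGen, Coord.tang, Coord.vel]
  have hY : transEven c c' (maskEven (fun e => Coord.tang (.inl e) && !Coord.vel (.inl e)) u) =
      maskEven (fun e => Coord.tang (.inl e) && !Coord.vel (.inl e)) (transEven c c' u) := by
    ext e
    rcases e with i | a | a | i
    · simp only [transEven, hp]; rfl
    all_goals simp [transEven, maskEven, Coord.tang, Coord.vel]
  rw [hL, hY]

section Smooth

variable [IsManifold 𝓘(ℝ, Fin n → ℝ) ∞ M]

variable (c c') in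
lemma contDiffOn_transition : ContDiffOn ℝ ∞ (fun y => c'.chart (c.chart.symm y))
    (c.chart.target ∩ c.chart.symm ⁻¹' c'.chart.source) := by
  have h1 := contMDiffOn_of_mem_maximalAtlas (n := ∞) (I := 𝓘(ℝ, Fin n → ℝ))
    (IsManifold.subset_maximalAtlas c'.chart_mem)
  have h2 := contMDiffOn_symm_of_mem_maximalAtlas (n := ∞) (I := 𝓘(ℝ, Fin n → ℝ))
    (IsManifold.subset_maximalAtlas c.chart_mem)
  rw [← contMDiffOn_iff_contDiffOn]
  exact h1.comp (h2.mono inter_subset_left) fun y hy => hy.2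

variable [ContMDiffVectorBundle ∞ (Fin m → ℝ) E 𝓘(ℝ, Fin n → ℝ)]
  [ContMDiffVectorBundle ∞ (Fin k → ℝ) F 𝓘(ℝ, Fin n → ℝ)]

variable (c) in
lemma contDiffOn_ghostTrans (c₁ c₂ : SuperChart n m k E F) (a b : Ghost m k) :
    ContDiffOn ℝ ∞ (fun y => ghostTrans c₁ c₂ (c.chart.symm y) a b)
      (c.chart.target ∩ c.chart.symm ⁻¹' (c₁.base ∩ c₂.base)) := by
  have h2 := contMDiffOn_symm_of_mem_maximalAtlas (n := ∞) (I := 𝓘(ℝ, Fin n → ℝ))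
    (IsManifold.subset_maximalAtlas c.chart_mem)
  rcases a with a | a <;> rcases b with b | b
  · have h1 := contMDiffOn_coordChangeL (n := ∞) (IB := 𝓘(ℝ, Fin n → ℝ)) c₁.trivE c₂.trivE
    have h3 := contMDiffOn_iff_contDiffOn.1
      (h1.comp (s := c.chart.target ∩ c.chart.symm ⁻¹' (c₁.base ∩ c₂.base))
        (h2.mono inter_subset_left) fun y hy => ⟨hy.2.1.2.1, hy.2.2.2.1⟩)
    exact (contDiffOn_pi.1 (h3.clm_apply contDiffOn_const)) b
  · exact contDiffOn_const
  · exact contDiffOn_const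
  · have h1 := contMDiffOn_coordChangeL (n := ∞) (IB := 𝓘(ℝ, Fin n → ℝ)) c₁.trivF c₂.trivF
    have h3 := contMDiffOn_iff_contDiffOn.1
      (h1.comp (s := c.chart.target ∩ c.chart.symm ⁻¹' (c₁.base ∩ c₂.base))
        (h2.mono inter_subset_left) fun y hy => ⟨hy.2.1.2.2, hy.2.2.2.2⟩)
    exact (contDiffOn_pi.1 (h3.clm_apply contDiffOn_const)) b

end Smooth

lemma ghostTrans_mul {p : M} (hp : p ∈ c.base ∩ c'.base) (a a' : Ghost m k) :
    ∑ b, ghostTrans c' c p a b * ghostTrans c c' p b a' = if a = a' then 1 else 0 := by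
  have key : ∀ {r : ℕ} (T T' : (Fin r → ℝ) →L[ℝ] (Fin r → ℝ)) (h : ∀ v, T (T' v) = v)
      (a a' : Fin r), ∑ b, T' (Pi.single a 1) b * T (Pi.single b 1) a' =
        if a = a' then 1 else 0 := by
    intro r T T' h a a'
    have := congrFun (h (Pi.single a 1)) a'
    rw [pi_eq_sum_univ' (T' (Pi.single a 1))] at this
    simp only [map_sum, map_smul, Finset.sum_apply, Pi.smul_apply, smul_eq_mul] at this
    rw [this, Pi.single_apply]
    simp only [eq_comm]
  rw [Fintype.sum_sum_type]
  have hE : ∀ v, c.trivE.coordChangeL ℝ c'.trivE p (c'.trivE.coordChangeL ℝ c.trivE p v) = v := by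
    intro v
    rw [← Trivialization.symm_coordChangeL c.trivE c'.trivE ⟨hp.2.2.1, hp.1.2.1⟩]
    exact ContinuousLinearEquiv.apply_symm_apply _ v
  have hF : ∀ v, c.trivF.coordChangeL ℝ c'.trivF p (c'.trivF.coordChangeL ℝ c.trivF p v) = v := by
    intro v
    rw [← Trivialization.symm_coordChangeL c.trivF c'.trivF ⟨hp.2.2.2, hp.1.2.2⟩]
    exact ContinuousLinearEquiv.apply_symm_apply _ v
  rcases a with a | a <;> rcases a' with a' | a'
  · simpa [ghostTrans] using key (c.trivE.coordChangeL ℝ c'.trivE p : _ →L[ℝ] _)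
      (c'.trivE.coordChangeL ℝ c.trivE p : _ →L[ℝ] _) hE a a'
  · simp [ghostTrans]
  · simp [ghostTrans]
  · simpa [ghostTrans] using key (c.trivF.coordChangeL ℝ c'.trivF p : _ →L[ℝ] _)
      (c'.trivF.coordChangeL ℝ c.trivF p : _ →L[ℝ] _) hF a a'

end Charts

lemma clm_eq_sum {r : ℕ} {G : Type*} [NormedAddCommGroup G] [NormedSpace ℝ G]
    (A : (Fin r → ℝ) →L[ℝ] G) (v : Fin r → ℝ) : A v = ∑ j, v j • A (Pi.single j 1) := by
  conv_lhs => rw [pi_eq_sum_univ' v]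
  simp only [map_sum, map_smul]

/-! ### Jacobians and derivatives of the transition matrices -/

section Charts

variable {M : Type*} [TopologicalSpace M] [ChartedSpace (Fin n → ℝ) M]
  {E : M → Type*} [TopologicalSpace (TotalSpace (Fin m → ℝ) E)]
  [∀ p, AddCommGroup (E p)] [∀ p, Module ℝ (E p)] [∀ p, TopologicalSpace (E p)]
  [FiberBundle (Fin m → ℝ) E] [VectorBundle ℝ (Fin m → ℝ) E]
  {F : M → Type*} [TopologicalSpace (TotalSpace (Fin k → ℝ) F)]
  [∀ p, AddCommGroup (F p)] [∀ p, Module ℝ (F p)] [∀ p, TopologicalSpace (F p)]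
  [FiberBundle (Fin k → ℝ) F] [VectorBundle ℝ (Fin k → ℝ) F]

/-- The Jacobian `∂xʲ/∂x'ⁱ` at a point. -/
def jac (c c' : SuperChart n m k E F) (p : M) (j i : Fin n) : ℝ :=
  fderiv ℝ (fun y => c.chart (c'.chart.symm y)) (c'.chart p) (Pi.single i 1) j

/-- The derivatives of a transition matrix in the coordinates of `c`. -/
def dTrans (c c₁ c₂ : SuperChart n m k E F) (p : M) (i : Fin n) (a b : Ghost m k) : ℝ :=
  fderiv ℝ (fun y => ghostTrans c₁ c₂ (c.chart.symm y) a b) (c.chart p) (Pi.single i 1)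

variable {c c' c₁ c₂ : SuperChart n m k E F}

lemma eventually_mem_nhds {p : M} (hc : p ∈ c.chart.source) {D : Set M} (hD : IsOpen D)
    (hp : p ∈ D) :
    ∀ᶠ y in nhds (c.chart p), y ∈ c.chart.target ∧ c.chart.symm y ∈ D :=
  (c.chart.symm.isOpen_inter_preimage hD).mem_nhds
    ⟨c.chart.map_source hc, by simpa [c.chart.left_inv hc] using hp⟩

section Smooth

variable [IsManifold 𝓘(ℝ, Fin n → ℝ) ∞ M]

lemma differentiableAt_transition {p : M} (hc : p ∈ c.chart.source) (hc' : p ∈ c'.chart.source) :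
    DifferentiableAt ℝ (fun y => c'.chart (c.chart.symm y)) (c.chart p) :=
  ((contDiffOn_transition c c').contDiffAt
    (eventually_mem_nhds hc c'.chart.open_source hc')).differentiableAt (by simp)

lemma sum_jac_mul_jac {p : M} (hc : p ∈ c.chart.source) (hc' : p ∈ c'.chart.source)
    (i l : Fin n) : ∑ j, jac c' c p l j * jac c c' p j i = if i = l then 1 else 0 := by
  have e : c.chart (c'.chart.symm (c'.chart p)) = c.chart p := by rw [c'.chart.left_inv hc']
  have hf := (differentiableAt_transition hc hc').hasFDerivAt
  have hg := (differentiableAt_transition hc' hc).hasFDerivAt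
  rw [← e] at hf
  have h := (HasFDerivAt.comp (g := fun x => c'.chart (c.chart.symm x))
    (f := fun y => c.chart (c'.chart.symm y)) (c'.chart p) hf hg).congr_of_eventuallyEq
    (f₁ := id) (by
    filter_upwards [eventually_mem_nhds hc' c.chart.open_source hc] with y hy
    simp only [Function.comp_apply, c.chart.left_inv hy.2, c'.chart.right_inv hy.1, id])
  have h2 := congrFun (DFunLike.congr_fun (h.unique (hasFDerivAt_id _)) (Pi.single i 1)) l
  rw [ContinuousLinearMap.comp_apply, clm_eq_sum, e] at h2
  simp only [Finset.sum_apply, Pi.smul_apply, smul_eq_mul, ContinuousLinearMap.id_apply,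
    Pi.single_apply, eq_comm (a := l)] at h2
  rw [← h2]
  exact Finset.sum_congr rfl fun j _ => mul_comm _ _

variable [ContMDiffVectorBundle ∞ (Fin m → ℝ) E 𝓘(ℝ, Fin n → ℝ)]
  [ContMDiffVectorBundle ∞ (Fin k → ℝ) F 𝓘(ℝ, Fin n → ℝ)]

lemma differentiableAt_ghostTrans {p : M} (hc : p ∈ c.chart.source) (hp : p ∈ c₁.base ∩ c₂.base)
    (a b : Ghost m k) :
    DifferentiableAt ℝ (fun y => ghostTrans c₁ c₂ (c.chart.symm y) a b) (c.chart p) :=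
  ((contDiffOn_ghostTrans c c₁ c₂ a b).contDiffAt (eventually_mem_nhds hc
    (c₁.isOpen_base.inter c₂.isOpen_base) hp)).differentiableAt (by simp)

/-- The derivative of an inverse matrix, combined with the chain rule that turns `x`-derivatives
into `x'`-derivatives. -/
lemma sum_jac_mul_dTrans {p : M} (hp : p ∈ c.base ∩ c'.base) (i : Fin n) (e a : Ghost m k) :
    ∑ j, jac c c' p j i * dTrans c c c' p j e a =
      -∑ b, ∑ d, dTrans c' c' c p i d b * ghostTrans c c' p e d * ghostTrans c c' p b a := by
  have hc := hp.1.1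
  have hc' := hp.2.1
  have h1 : ∑ j, jac c c' p j i * dTrans c c c' p j e a = dTrans c' c c' p i e a := by
    have ee : c.chart (c'.chart.symm (c'.chart p)) = c.chart p := by rw [c'.chart.left_inv hc']
    have hf := (differentiableAt_ghostTrans hc hp e a).hasFDerivAt
    have hg := (differentiableAt_transition hc' hc).hasFDerivAt
    rw [← ee] at hf
    have h := (HasFDerivAt.comp (g := fun x => ghostTrans c c' (c.chart.symm x) e a)
      (f := fun y => c.chart (c'.chart.symm y)) (c'.chart p) hf hg).congr_of_eventuallyEq (f₁ := fun y => ghostTrans c c' (c'.chart.symm y) e a) (by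
        filter_upwards [eventually_mem_nhds hc' c.chart.open_source hc] with y hy
        simp only [Function.comp_apply, c.chart.left_inv hy.2])
    rw [dTrans, h.fderiv, ContinuousLinearMap.comp_apply, clm_eq_sum, ee]
    rfl
  -- The product of the two transition matrices is the identity near the point; differentiate it.
  have h2 : ∀ b, ∑ d, (dTrans c' c c' p i e d * ghostTrans c' c p d b +
      ghostTrans c c' p e d * dTrans c' c' c p i d b) = 0 := by
    intro b
    have hd : HasFDerivAt (fun y => ∑ d, ghostTrans c c' (c'.chart.symm y) e d *
        ghostTrans c' c (c'.chart.symm y) d b) _ (c'.chart p) :=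
      HasFDerivAt.fun_sum fun d _ => ((differentiableAt_ghostTrans hc' hp e d).hasFDerivAt.mul
        (differentiableAt_ghostTrans hc' hp.symm d b).hasFDerivAt)
    have hd' := hd.congr_of_eventuallyEq (f₁ := fun _ => if e = b then (1 : ℝ) else 0) (by
        filter_upwards [eventually_mem_nhds hc' (c'.isOpen_base.inter c.isOpen_base) hp.symm]
          with y hy
        exact (ghostTrans_mul hy.2 e b).symm)
    have := DFunLike.congr_fun (hd'.unique (hasFDerivAt_const _ _)) (Pi.single i 1)
    simp only [sum_apply, add_apply, smul_apply, smul_eq_mul, c'.chart.left_inv hc'] at this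
    refine Eq.trans ?_ this
    exact Finset.sum_congr rfl fun d _ => by rw [dTrans, dTrans]; ring
  rw [h1, eq_neg_iff_add_eq_zero]
  -- Multiplying by the transition matrix collapses the first summand to the undecorated derivative.
  have h3 : ∑ b, (∑ d, (dTrans c' c c' p i e d * ghostTrans c' c p d b +
      ghostTrans c c' p e d * dTrans c' c' c p i d b)) * ghostTrans c c' p b a = 0 :=
    Finset.sum_eq_zero fun b _ => by rw [h2, zero_mul]
  rw [← h3]
  simp only [Finset.sum_add_distrib, add_mul]
  congr 1
  · simp only [Finset.sum_mul, mul_assoc]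
    rw [Finset.sum_comm]
    simp only [← Finset.mul_sum, ghostTrans_mul hp]
    simp
  · simp only [Finset.sum_mul]
    exact Finset.sum_congr rfl fun b _ => Finset.sum_congr rfl fun d _ => by ring

end Smooth

/-! ### Derivatives of pullbacks -/

variable {D : Opens M} {u : EvenCoord n m k → ℝ} {f h : SFun n m k}

lemma isOpen_region : IsOpen (c.region (D : Set M)) := by
  rw [c.region_eq]; exact isOpen_cyl

lemma oddDeriv_pullback (o : OddCoord n m k) (h : SFun n m k) (u : EvenCoord n m k → ℝ) :
    oddDeriv o (pullback c c' h) u =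
      ∑ o', transOddGen c c' u o' o • pullback c c' (oddDeriv o' h) u := by
  have e : (LinearMap.proj o : (OddCoord n m k → ℝ) →ₗ[ℝ] ℝ) ∘ₗ transOdd c c' u =
      ∑ o', transOddGen c c' u o' o • (LinearMap.proj o' : (OddCoord n m k → ℝ) →ₗ[ℝ] ℝ) := by
    refine LinearMap.pi_ext' fun o₁ => LinearMap.ext_ring ?_
    simp only [LinearMap.comp_apply, LinearMap.coe_single, transOdd_single, LinearMap.proj_apply,
      LinearMap.sum_apply, LinearMap.smul_apply, smul_eq_mul, Pi.single_apply]
    simp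
  simp only [oddDeriv, pullback_apply]
  rw [contractLeft_map, e, map_sum, LinearMap.sum_apply, map_sum]
  simp only [map_smul, LinearMap.smul_apply]

lemma oddDeriv_xStar_pullback (j : Fin n) (h : SFun n m k) (u : EvenCoord n m k → ℝ) :
    oddDeriv (.xStar j) (pullback c c' h) u =
      ∑ i, jac c c' (c.point u) j i • pullback c c' (oddDeriv (.xStar i) h) u := by
  rw [oddDeriv_pullback, sum_oddCoord]
  simp [transOddGen, jac, Finset.sum_apply, Pi.single_apply]

/-- The hypothesis removes the contribution of `x*'`, whose transformation law also contains `z`. -/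
lemma oddDeriv_z_pullback (b : Ghost m k) (h : SFun n m k) (u : EvenCoord n m k → ℝ)
    (hh : ∀ i, pullback c c' (oddDeriv (.xStar i) h) u = 0) :
    oddDeriv (.z b) (pullback c c' h) u =
      ∑ a, ghostTrans c c' (c.point u) b a • pullback c c' (oddDeriv (.z a) h) u := by
  rw [oddDeriv_pullback, sum_oddCoord]
  simp only [hh]
  simp [transOddGen, Finset.sum_apply, Pi.single_apply, -Fintype.sum_sum_type]

/-- `z*` enters through `z*'` and through the inhomogeneous part of `x*'`. Both are affine along the
line, which gives the two sums. -/
lemma evenDeriv_zStar_pullback (hD : (D : Set M) ⊆ c.base ∩ c'.base) (hu : u ∈ c.region D)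
    (hh : SmoothOn h (c'.region D)) (b : Ghost m k) :
    evenDeriv (.zStar b) (pullback c c' h) u =
      ∑ a, ghostTrans c' c (c.point u) a b • pullback c c' (evenDeriv (.zStar a) h) u +
      ∑ i, (∑ a, dTrans c' c' c (c.point u) i a b • ∑ d, ghostTrans c c' (c.point u) d a •
        gen (.z d)) * pullback c c' (oddDeriv (.xStar i) h) u := by
  have hx : ∀ t : ℝ, c.point (u + t • Pi.single (.zStar b) 1) = c.point u := by
    intro t
    have : xPart (u + t • Pi.single (EvenCoord.zStar b) (1 : ℝ)) = xPart u := by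
      ext i; simp [xPart]
    rw [SuperChart.point, this]; rfl
  let L' : OddCoord n m k → OddCoord n m k → ℝ
    | .xStar i => ∑ a, dTrans c' c' c (c.point u) i a b •
        ∑ d, ghostTrans c c' (c.point u) d a • Pi.single (.z d) 1
    | _ => 0
  let Y' : EvenCoord n m k → ℝ
    | .zStar a => ghostTrans c' c (c.point u) a b
    | _ => 0
  have hL : ∀ (t : ℝ) o, transOdd c c' (u + t • Pi.single (.zStar b) 1) (Pi.single o 1) =
      transOddGen c c' u o + t • L' o := by
    intro t o
    rw [transOdd_single]
    rcases o with a | i | i | a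
    · simp only [transOddGen, hx, L', smul_zero, add_zero]
    · simp only [transOddGen, hx, L']
      rw [add_assoc]
      congr 1
      simp only [Pi.add_apply, Pi.smul_apply, Pi.single_apply, EvenCoord.zStar.injEq, mul_add,
        add_smul, Finset.sum_add_distrib, smul_eq_mul]
      congr 1
      simp [Finset.smul_sum, smul_smul, dTrans, mul_comm t, mul_assoc, -Fintype.sum_sum_type]
    · simp [transOddGen, L']
    · simp [transOddGen, L']
  have hY : ∀ (t : ℝ) e, transEven c c' (u + t • Pi.single (.zStar b) 1) e =
      transEven c c' u e + t * Y' e := by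
    intro t e
    rcases e with i | a | a | i
    · simp only [transEven, hx, Y', mul_zero, add_zero]
    · simp only [transEven, hx, Y', Pi.add_apply, Pi.smul_apply, Pi.single_apply,
        EvenCoord.zStar.injEq, mul_add, Finset.sum_add_distrib, smul_eq_mul]
      simp [mul_comm t, -Fintype.sum_sum_type]
    · simp [transEven, Y']
    · simp [transEven, Y']
  have key := weakDeriv_subst (L := fun t => transOdd c c' (u + t • Pi.single (.zStar b) 1))
    (L' := L') (Y := fun t => transEven c c' (u + t • Pi.single (.zStar b) 1)) (Y' := Y')
    (fun o o' => by
      simp only [hL, Pi.add_apply, Pi.smul_apply, smul_eq_mul]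
      simpa using ((hasDerivAt_id (0 : ℝ)).mul_const (L' o o')).const_add (transOddGen c c' u o o'))
    (fun e => by
      simp only [hY]
      simpa using ((hasDerivAt_id (0 : ℝ)).mul_const (Y' e)).const_add (transEven c c' u e))
    isOpen_region (by simpa using transEven_mem hD hu) hh
  simp only [zero_smul, add_zero, ← pullback_apply] at key
  refine HasEvenDeriv.evenDeriv_eq (w := _) ?_
  convert key using 1
  rw [sum_evenCoord, sum_oddCoord]
  simp only [Y', L', zero_smul, map_zero, zero_mul, Finset.sum_const_zero, add_zero, zero_add,
    map_sum, map_smul]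
  rfl

section Smooth

variable [IsManifold 𝓘(ℝ, Fin n → ℝ) ∞ M]
  [ContMDiffVectorBundle ∞ (Fin m → ℝ) E 𝓘(ℝ, Fin n → ℝ)]
  [ContMDiffVectorBundle ∞ (Fin k → ℝ) F 𝓘(ℝ, Fin n → ℝ)]

/-- Restricting to `𝓜` removes `x*'` and `z*'`, so only the `x`-dependence of `x'` and `z'` is
differentiated and no second derivatives of transition functions occur. -/
lemma evenDeriv_x_pullback_restrictM (hD : (D : Set M) ⊆ c.base ∩ c'.base) (hu : u ∈ c.region D)
    (hf : SmoothOn f (c'.region D)) (j : Fin n) :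
    evenDeriv (.x j) (pullback c c' (restrictM f)) u =
      ∑ i, jac c' c (c.point u) i j • pullback c c' (restrictM (evenDeriv (.x i) f)) u +
      ∑ a, (∑ b, dTrans c c c' (c.point u) j b a • gen (.z b)) *
        pullback c c' (restrictM (oddDeriv (.z a) f)) u := by
  set pe : EvenCoord n m k → Bool := fun e => Coord.tang (.inl e) && !Coord.vel (.inl e) with hpe
  set po : OddCoord n m k → Bool := fun o => Coord.tang (.inr o) && !Coord.vel (.inr o) with hpo
  have hpb : ∀ (g : SFun n m k) v, pullback c c' (restrictM g) v =
      ExteriorAlgebra.map (transOdd c c' v ∘ₗ maskOdd po)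
        (g (maskEven pe (transEven c c' v))) := by
    intro g v
    rw [restrictM_eq, pullback_apply, setToZero_apply, ← AlgHom.comp_apply,
      ExteriorAlgebra.map_comp_map]
  have hcp : c.chart (c.point u) = xPart u := c.chart.right_inv hu.1
  have hp := hD hu.2
  let γ : ℝ → EvenCoord n m k → ℝ := fun t => u + t • Pi.single (.x j) 1
  have hx : ∀ t : ℝ, c.point (γ t) = c.chart.symm (c.chart (c.point u) + t • Pi.single j 1) := by
    intro t
    rw [SuperChart.point, hcp]
    congr 1
    ext i; simp [xPart, γ, Pi.single_apply]
  let L' : OddCoord n m k → OddCoord n m k → ℝ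
    | .z a => ∑ b, dTrans c c c' (c.point u) j b a • Pi.single (.z b) 1
    | _ => 0
  let Y' : EvenCoord n m k → ℝ
    | .x i => jac c' c (c.point u) i j
    | _ => 0
  have hL : ∀ o v, (transOdd c c' v ∘ₗ maskOdd po) (Pi.single o 1) =
      match o with
      | .z a => ∑ b, ghostTrans c c' (c.point v) b a • Pi.single (.z b) 1
      | _ => 0 := by
    intro o v
    have hm : maskOdd po (Pi.single o (1 : ℝ)) = if po o then Pi.single o 1 else 0 := by
      ext o'
      rw [maskOdd_apply]
      by_cases h : o' = o
      · subst h; split_ifs <;> simp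
      · split_ifs <;> simp [h]
    rw [LinearMap.comp_apply, hm, apply_ite (transOdd c c' v), transOdd_single, map_zero]
    rcases o with a | i | i | a <;> simp [transOddGen, hpo, Coord.tang, Coord.vel]
  have key := weakDeriv_subst (L := fun t => transOdd c c' (γ t) ∘ₗ maskOdd po)
    (L' := L') (Y := fun t => maskEven pe (transEven c c' (γ t))) (Y' := Y')
    (fun o o' => by
      simp only [hL]
      rcases o with a | i | i | a
      · simp only [L', hx, Finset.sum_apply, Pi.smul_apply, smul_eq_mul]
        refine HasDerivAt.fun_sum fun b _ => HasDerivAt.mul_const ?_ _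
        exact (differentiableAt_ghostTrans hp.1.1 hp b a).hasFDerivAt.hasLineDerivAt _
      all_goals exact hasDerivAt_const _ _)
    (fun e => by
      rcases e with i | a | a | i
      · simp only [maskEven, hpe, Coord.tang, Coord.vel, Bool.not_false, Bool.and_self, if_true,
          transEven, hx, Y']
        exact hasDerivAt_pi.1
          ((differentiableAt_transition hp.1.1 hp.2.1).hasFDerivAt.hasLineDerivAt
            (Pi.single j 1)) i
      all_goals
        simp only [maskEven, hpe, Coord.tang, Coord.vel, Bool.not_false, Bool.not_true,
          Bool.and_true, Bool.and_false, Bool.false_eq_true, if_false, Y']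
        exact hasDerivAt_const _ _)
    isOpen_region (by
      have := mapsTo_maskEven (pe := pe) (X := c'.xRegion D) (fun _ => rfl) (transEven_mem hD hu)
      change _ ∈ cyl m k (c'.xRegion D)
      simpa [γ] using this) hf
  simp only [γ, zero_smul, add_zero, ← hpb] at key
  refine HasEvenDeriv.evenDeriv_eq (w := _) ?_
  convert key using 1
  rw [sum_evenCoord, sum_oddCoord]
  simp only [Y', L', zero_smul, map_zero, zero_mul, Finset.sum_const_zero, add_zero,
    map_sum, map_smul]
  rfl

end Smooth

end Charts

/-! ## Functions on `𝓝` and on `𝓜` over an open set -/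

section Local

variable {X : Opens (Fin n → ℝ)} {f g H : SFun n m k} {u : EvenCoord n m k → ℝ}

/-- `f` is a smooth function on `𝓝` over `X`. -/
structure IsFnN (X : Opens (Fin n → ℝ)) (f : SFun n m k) : Prop where
  smooth : SmoothOn f (cyl m k X)
  restrict : EqOn (restrictN f) f (cyl m k X)

/-- `f` is a smooth function on `𝓜` over `X`. -/
structure IsFnM (X : Opens (Fin n → ℝ)) (f : SFun n m k) : Prop where
  smooth : SmoothOn f (cyl m k X)
  restrict : EqOn (restrictM f) f (cyl m k X)

lemma restrictN_congr (h : EqOn f g (cyl m k X)) :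
    EqOn (restrictN f) (restrictN g) (cyl m k X) := by
  rw [restrictN_eq]; exact setToZero_congr (fun _ => rfl) h

lemma restrictM_congr (h : EqOn f g (cyl m k X)) :
    EqOn (restrictM f) (restrictM g) (cyl m k X) := by
  rw [restrictM_eq]; exact setToZero_congr (fun _ => rfl) h

lemma restrictM_restrictM (f : SFun n m k) : restrictM (restrictM f) = restrictM f := by
  rw [restrictM_eq, setToZero_setToZero]; simp

lemma IsFnM.isFnN (hf : IsFnM X f) : IsFnN X f :=
  ⟨hf.smooth, (restrictN_congr hf.restrict.symm).trans (by
    rw [restrictN_restrictM]; exact hf.restrict)⟩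

lemma IsFnM.restrictL (hf : IsFnM X f) : EqOn (restrictL f) f (cyl m k X) :=
  (restrictL_congr hf.restrict.symm).trans (by rw [restrictL_restrictM]; exact hf.restrict)

lemma IsFnN.restrictL (hf : IsFnN X f) : EqOn (restrictL f) (restrictM f) (cyl m k X) := by
  rw [← restrictL_restrictN]; exact (restrictL_congr hf.restrict).symm

lemma IsFnN.restrictM (hf : IsFnN X f) : IsFnM X (restrictM f) :=
  ⟨by rw [restrictM_eq]; exact hf.smooth.setToZero (mapsTo_maskEven fun _ => rfl),
    by rw [restrictM_restrictM]; exact eqOn_refl _ _⟩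

lemma IsFnN.parityInv (hf : IsFnN X f) : IsFnN X (parityInv f) :=
  ⟨hf.smooth.parityInv, by
    have := parityInv_congr hf.restrict
    rwa [restrictN_eq, ← setToZero_parityInv, ← restrictN_eq] at this⟩

lemma IsFnM.parityInv (hf : IsFnM X f) : IsFnM X (parityInv f) :=
  ⟨hf.smooth.parityInv, by
    have := parityInv_congr hf.restrict
    rwa [restrictM_eq, ← setToZero_parityInv, ← restrictM_eq] at this⟩

/-- The pointwise form of `oddBr_eq`, suited to the chain rule. -/
lemma oddBracket_apply (hH : IsFnN X H) (hf : IsFnM X f) (hu : u ∈ cyl m k X) :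
    oddBracket H f u = -∑ i, oddDeriv (.xStar i) H u * evenDeriv (.x i) f u +
      ∑ a, evenDeriv (.zStar a) (parityInv H) u * oddDeriv (.z a) f u := by
  obtain ⟨a, ha⟩ := hH.smooth.exists_rep
  obtain ⟨b, hb⟩ := hf.smooth.exists_rep
  have hbr : (smoothCalc m k X).r b = b := (hb.r.eqOn_iff hb).1 hf.restrictL
  have e := (smoothCalc m k X).oddBr_eq (noVel_of_rep ha hH.restrict)
    (noVel_of_rep hb hf.isFnN.restrict) hbr
  have h1 := ha.oddBracket hb
  rw [e] at h1
  have h2 := ((Rep.sum (s := Finset.univ)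
      (f := fun i : Fin n => partialDeriv (.inr (.xStar i)) H * partialDeriv (.inl (.x i)) f)
      fun i => (ha.pd (.inr (.xStar i))).mul (hb.pd (.inl (.x i)))).neg).add
    (Rep.sum (s := Finset.univ) (f := fun i : Ghost m k =>
        partialDeriv (.inl (.zStar i)) (parityInv H) * partialDeriv (.inr (.z i)) f)
      fun i => (ha.inv.pd (.inl (.zStar i))).mul (hb.pd (.inr (.z i))))
  have h3 := (h1.eqOn_iff h2).2 rfl hu
  rw [h3]
  simp only [Pi.add_apply, Pi.neg_apply, Finset.sum_apply, Pi.mul_apply]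
  rfl

lemma restrictN_partialDeriv (w : Coord n m k) (hw : ¬ Coord.vel w) (hf : IsFnN X f)
    (hu : u ∈ cyl m k X) : restrictN (partialDeriv w f) u = partialDeriv w f u := by
  rw [← partialDeriv_congr w hf.restrict hu, restrictN_eq]
  rcases w with e | o
  · exact (hf.smooth.evenDeriv_setToZero isOpen_cyl (mapsTo_maskEven (fun _ => rfl) hu)
      (by simpa using hw)).symm
  · exact (congrFun (oddDeriv_setToZero o (by simpa using hw)) u).symm

/-- Every factor in `oddBracket_apply` is unchanged by setting the velocities to zero. This allows
the odd bracket to be iterated. -/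
lemma IsFnN.oddBracket (hH : IsFnN X H) (hf : IsFnM X f) : IsFnN X (oddBracket H f) := by
  have hs : SmoothOn (WeakKoszul.oddBracket H f) (cyl m k X) := by
    obtain ⟨a, ha⟩ := hH.smooth.exists_rep
    obtain ⟨b, hb⟩ := hf.smooth.exists_rep
    exact (ha.oddBracket hb).smoothOn
  refine ⟨hs, fun u hu => ?_⟩
  have hu' : maskEven (fun e => !Coord.vel (.inl e)) u ∈ cyl m k X :=
    mapsTo_maskEven (fun _ => rfl) hu
  have hp : ∀ (w : Coord n m k) (_ : ¬ Coord.vel w) {g : SFun n m k} (_ : IsFnN X g),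
      ExteriorAlgebra.map (maskOdd fun o => !Coord.vel (.inr o))
        (partialDeriv w g (maskEven (fun e => !Coord.vel (.inl e)) u)) = partialDeriv w g u := by
    intro w hw g hg
    rw [← restrictN_partialDeriv w hw hg hu, restrictN_eq, setToZero_apply]
  rw [restrictN_eq, setToZero_apply, oddBracket_apply hH hf hu', oddBracket_apply hH hf hu]
  simp only [map_add, map_neg, map_sum, map_mul]
  congr 1
  · congr 1
    exact Finset.sum_congr rfl fun i _ => congrArg₂ _ (hp (.inr (.xStar i)) (by simp [Coord.vel]) hH)
      (hp (.inl (.x i)) (by simp [Coord.vel]) hf.isFnN)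
  · exact Finset.sum_congr rfl fun i _ =>
      congrArg₂ _ (hp (.inl (.zStar i)) (by simp [Coord.vel]) hH.parityInv)
        (hp (.inr (.z i)) (by simp [Coord.vel]) hf.isFnN)

end Local

/-! ### Coordinate independence of the odd bracket -/

section Charts

variable {M : Type*} [TopologicalSpace M] [ChartedSpace (Fin n → ℝ) M]
  {E : M → Type*} [TopologicalSpace (TotalSpace (Fin m → ℝ) E)]
  [∀ p, AddCommGroup (E p)] [∀ p, Module ℝ (E p)] [∀ p, TopologicalSpace (E p)]
  [FiberBundle (Fin m → ℝ) E] [VectorBundle ℝ (Fin m → ℝ) E]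
  {F : M → Type*} [TopologicalSpace (TotalSpace (Fin k → ℝ) F)]
  [∀ p, AddCommGroup (F p)] [∀ p, Module ℝ (F p)] [∀ p, TopologicalSpace (F p)]
  [FiberBundle (Fin k → ℝ) F] [VectorBundle ℝ (Fin k → ℝ) F]
  [IsManifold 𝓘(ℝ, Fin n → ℝ) ∞ M]
  [ContMDiffVectorBundle ∞ (Fin m → ℝ) E 𝓘(ℝ, Fin n → ℝ)]
  [ContMDiffVectorBundle ∞ (Fin k → ℝ) F 𝓘(ℝ, Fin n → ℝ)]

variable {c c' : SuperChart n m k E F} {D : Opens M} {u : EvenCoord n m k → ℝ}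
  {f f' H H' : SFun n m k}

/-- The odd Poisson bracket of a function on `𝓝` with a function on `𝓜` does not depend on the
coordinates. -/
theorem oddBracket_eqOn_pullback (hD : (D : Set M) ⊆ c.base ∩ c'.base)
    (hH : IsFnN (c.xRegion D) H) (hH' : IsFnN (c'.xRegion D) H')
    (hf : IsFnM (c.xRegion D) f) (hf' : IsFnM (c'.xRegion D) f')
    (eH : EqOn H (pullback c c' H') (c.region D)) (ef : EqOn f (pullback c c' f') (c.region D)) :
    EqOn (oddBracket H f) (pullback c c' (oddBracket H' f')) (c.region D) := by
  intro u hu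
  have hp := hD hu.2
  have hu' := transEven_mem hD hu
  rw [oddBracket_apply hH hf hu, pullback_apply, oddBracket_apply hH' hf' hu']
  simp only [map_add, map_neg, map_sum, map_mul, ← pullback_apply]
  -- Exhibits `f'` explicitly as a restriction to `𝓜`, the form needed for the `x`-derivative of its
  -- pullback.
  have ef₂ : EqOn f (pullback c c' (restrictM f')) (c.region D) :=
    ef.trans (pullback_congr hD hf'.restrict.symm)
  have ePH : EqOn (parityInv H) (pullback c c' (parityInv H')) (c.region D) := by
    rw [pullback_parityInv]; exact parityInv_congr (X := c.xRegion D) eH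
  have hX : ∀ i, oddDeriv (.xStar i) (restrictM f') = 0 := fun i => by
    rw [restrictM_eq]; exact oddDeriv_setToZero_of_not _ (by simp [Coord.tang])
  have hr : ∀ (w : Coord n m k), Coord.tang w → ¬ Coord.vel w →
      pullback c c' (restrictM (partialDeriv w f')) u = pullback c c' (partialDeriv w f') u := by
    intro w hw hw'
    refine pullback_congr hD (fun v hv => ?_) hu
    rw [← partialDeriv_congr w hf'.restrict hv, restrictM_eq]
    rcases w with e | o
    · exact (hf'.smooth.evenDeriv_setToZero isOpen_cyl (mapsTo_maskEven (fun _ => rfl) hv)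
        (by simp [hw, hw'])).symm
    · exact (congrFun (oddDeriv_setToZero o (by simp [hw, hw'])) v).symm
  have h1 : ∀ j, oddDeriv (.xStar j) H u =
      ∑ i, jac c c' (c.point u) j i • pullback c c' (oddDeriv (.xStar i) H') u := fun j => by
    rw [← oddDeriv_xStar_pullback]
    exact partialDeriv_congr (X := c.xRegion D) (.inr (.xStar j)) eH hu
  have h2 : ∀ j, evenDeriv (.x j) f u =
      ∑ i, jac c' c (c.point u) i j • pullback c c' (evenDeriv (.x i) f') u +
      ∑ a, (∑ b, dTrans c c c' (c.point u) j b a • gen (.z b)) *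
        pullback c c' (oddDeriv (.z a) f') u := fun j => by
    rw [evenDeriv_congr isOpen_region ef₂ _ hu, evenDeriv_x_pullback_restrictM hD hu hf'.smooth]
    congr 1
    · exact Finset.sum_congr rfl fun i _ => by
        rw [show pullback c c' (restrictM (evenDeriv (.x i) f')) u = _ from
          hr (.inl (.x i)) rfl (by simp [Coord.vel])]; rfl
    · exact Finset.sum_congr rfl fun i _ => by
        rw [show pullback c c' (restrictM (oddDeriv (.z i) f')) u = _ from
          hr (.inr (.z i)) rfl (by simp [Coord.vel])]; rfl
  have h3 : ∀ b, oddDeriv (.z b) f u =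
      ∑ a, ghostTrans c c' (c.point u) b a • pullback c c' (oddDeriv (.z a) f') u := fun b => by
    rw [show oddDeriv (.z b) f u = _ from
      partialDeriv_congr (X := c.xRegion D) (.inr (.z b)) ef₂ hu]
    refine (oddDeriv_z_pullback b _ u fun i => by rw [hX]; exact map_zero _).trans ?_
    exact Finset.sum_congr rfl fun i _ => by
      rw [show pullback c c' (oddDeriv (.z i) (restrictM f')) u =
        pullback c c' (oddDeriv (.z i) f') u from pullback_congr hD
          (partialDeriv_congr (X := c'.xRegion D) (.inr (.z i)) hf'.restrict) hu]
  -- The involution anticommutes with an odd derivative, which supplies `-Q'` in `canonical_sum_eq`.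
  have hQ : ∀ i, pullback c c' (oddDeriv (.xStar i) (parityInv H')) u =
      -CliffordAlgebra.involute (pullback c c' (oddDeriv (.xStar i) H') u) := fun i => by
    have : oddDeriv (.xStar i) (parityInv H') = -parityInv (oddDeriv (.xStar i) H') := by
      ext v
      simp only [oddDeriv, parityInv, Pi.neg_apply]
      rw [involute_contractLeft, neg_neg]
    rw [this]
    change ExteriorAlgebra.map _ (-_) = -CliffordAlgebra.involute (ExteriorAlgebra.map _ _)
    rw [map_neg, involute_map]; rfl
  have h4 : ∀ b, evenDeriv (.zStar b) (parityInv H) u =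
      ∑ a, ghostTrans c' c (c.point u) a b •
        pullback c c' (evenDeriv (.zStar a) (parityInv H')) u +
      ∑ i, (∑ a, dTrans c' c' c (c.point u) i a b • ∑ d, ghostTrans c c' (c.point u) d a •
        gen (.z d)) *
          -CliffordAlgebra.involute (pullback c c' (oddDeriv (.xStar i) H') u) := fun b => by
    rw [evenDeriv_congr isOpen_region ePH _ hu,
      evenDeriv_zStar_pullback hD hu hH'.parityInv.smooth]
    simp only [hQ]
  simp only [h1, h2, h3, h4]
  -- The first condition is supercommutation of an odd generator with the involuted factor; the
  -- others are the Jacobian and matrix identities.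
  refine canonical_sum_eq (fun d i => ?_) ?_ ?_ ?_
  · rw [gen]
    erw [ι_mul_eq]
    rw [CliffordAlgebra.involute_involute]
  · exact fun i l => sum_jac_mul_jac hp.1.1 hp.2.1 i l
  · exact fun a a' => ghostTrans_mul hp a a'
  · exact fun i e a => sum_jac_mul_dTrans hp i e a

end Charts

/-! ## Invariance of the weak Koszul bracket -/

namespace SuperCalculus

section

variable {R : Type*} [Ring R] [Algebra ℝ R] (C : SuperCalculus n m k R)

lemma kos_add_left (W F G H : R) : C.kos W (F + G) H = C.kos W F H + C.kos W G H := by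
  simp only [kos, br_add_right, br_add_left, map_add]

lemma kos_add_right (W F G H : R) : C.kos W F (G + H) = C.kos W F G + C.kos W F H := by
  simp only [kos, br_add_right, map_add]

lemma kos_neg_weight (W F G : R) : C.kos (-W) F G = -C.kos W F G := by
  simp only [kos, lft, br_neg_right, br_neg_left, map_neg]

/-- The homogeneous components. -/
def part (p : Bool) (a : R) : R := (2⁻¹ : ℝ) • (a + if p then -C.inv a else C.inv a)

lemma homog_part (p : Bool) (a : R) : C.Homog p (C.part p a) := by
  cases p <;> simp [Homog, part, C.inv_inv, add_comm, ← smul_neg]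

lemma part_add_part (a : R) : C.part false a + C.part true a = a := by
  have : C.part false a + C.part true a = (2⁻¹ : ℝ) • (2 : ℝ) • a := by
    rw [two_smul, part, part, ← smul_add]
    simp only [Bool.false_eq_true, if_true, if_false]
    congr 1
    abel
  rw [this, smul_smul]
  norm_num

end

variable {R R' : Type*} [Ring R] [Algebra ℝ R] [Ring R'] [Algebra ℝ R']
  {C : SuperCalculus n m k R} {C' : SuperCalculus n m k R'}

/-- A correspondence between the functions on `𝓜` in two calculi. -/
structure FnRel (C : SuperCalculus n m k R) (C' : SuperCalculus n m k R')
    (P : R → R' → Prop) : Prop where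
  one : P 1 1
  add : ∀ {a a' b b'}, P a a' → P b b' → P (a + b) (a' + b')
  smul : ∀ (t : ℝ) {a a'}, P a a' → P (t • a) (t • a')
  inv : ∀ {a a'}, P a a' → P (C.inv a) (C'.inv a')
  noVel : ∀ {a a'}, P a a' → C.NoVel a
  noVel' : ∀ {a a'}, P a a' → C'.NoVel a'
  r_eq : ∀ {a a'}, P a a' → C.r a = a
  r_eq' : ∀ {a a'}, P a a' → C'.r a' = a'

/-- The correspondence between differential forms that is generated by a correspondence between
functions. -/
inductive FormRel (C : SuperCalculus n m k R) (C' : SuperCalculus n m k R')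
    (P : R → R' → Prop) : R → R' → Prop
  | fn {a a'} (h : P a a') : FormRel C C' P a a'
  | add {a a' b b'} (ha : FormRel C C' P a a') (hb : FormRel C C' P b b') :
      FormRel C C' P (a + b) (a' + b')
  | mul {a a' b b'} (ha : FormRel C C' P a a') (hb : FormRel C C' P b b') :
      FormRel C C' P (a * b) (a' * b')
  | d {a a'} (ha : FormRel C C' P a a') : FormRel C C' P (C.r (C.lft a)) (C'.r (C'.lft a'))

variable {P : R → R' → Prop} {a b w : R} {a' b' w' : R'} {p s : Bool}

lemma FnRel.part (hP : FnRel C C' P) (h : P a a') (p : Bool) : P (C.part p a) (C'.part p a') := by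
  refine hP.smul _ (hP.add h ?_)
  cases p
  · exact hP.inv h
  · simpa using hP.smul (-1) (hP.inv h)

lemma FnRel.tau (hP : FnRel C C' P) (h : P a a') (p : Bool) : P (C.tau p a) (C'.tau p a') := by
  cases p
  · exact h
  · exact hP.inv h

namespace FormRel

lemma r_eq (hP : FnRel C C' P) (h : FormRel C C' P a a') : C.r a = a ∧ C'.r a' = a' := by
  induction h with
  | fn h => exact ⟨hP.r_eq h, hP.r_eq' h⟩
  | add _ _ h₁ h₂ => simp [h₁, h₂]
  | mul _ _ h₁ h₂ => simp [h₁, h₂]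
  | d => exact ⟨C.r_r _, C'.r_r _⟩

lemma smul (hP : FnRel C C' P) (t : ℝ) (h : FormRel C C' P a a') :
    FormRel C C' P (t • a) (t • a') := by
  simpa using (FormRel.fn (hP.smul t hP.one)).mul h

lemma neg (hP : FnRel C C' P) (h : FormRel C C' P a a') : FormRel C C' P (-a) (-a') := by
  simpa using h.smul hP (-1)

lemma sub (hP : FnRel C C' P) (h : FormRel C C' P a a') (h₂ : FormRel C C' P b b') :
    FormRel C C' P (a - b) (a' - b') := by
  simpa only [sub_eq_add_neg] using h.add (h₂.neg hP)

lemma zero (hP : FnRel C C' P) : FormRel C C' P 0 0 := by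
  simpa using (FormRel.fn hP.one).smul hP 0

lemma inv (hP : FnRel C C' P) (h : FormRel C C' P a a') :
    FormRel C C' P (C.inv a) (C'.inv a') := by
  induction h with
  | fn h => exact .fn (hP.inv h)
  | add _ _ h₁ h₂ => simpa using h₁.add h₂
  | mul _ _ h₁ h₂ => simpa using h₁.mul h₂
  | d _ h => simpa [← r_inv, inv_lft] using h.d.neg hP

lemma tau (hP : FnRel C C' P) (h : FormRel C C' P a a') (p : Bool) :
    FormRel C C' P (C.tau p a) (C'.tau p a') := by
  cases p
  · exact h
  · exact h.inv hP

lemma part (hP : FnRel C C' P) (h : FormRel C C' P a a') (p : Bool) :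
    FormRel C C' P (C.part p a) (C'.part p a') := by
  refine (h.add ?_).smul hP _
  cases p
  · exact h.inv hP
  · exact (h.inv hP).neg hP

lemma lft (hP : FnRel C C' P) (h : FormRel C C' P a a') :
    FormRel C C' P (C.lft a) (C'.lft a') := by
  have := h.d
  rwa [C.r_lft_of_r (h.r_eq hP).1, C'.r_lft_of_r (h.r_eq hP).2] at this

/-- Induction on the form in the first argument. The Leibniz rule treats products, while
`kos_lft_left` treats `d` and forces the companion assumption with `lft b`. -/
lemma kos_of_fn_of_lft (hP : FnRel C C' P) (hw : C.Homog p w) (hw' : C'.Homog p w')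
    (hb : C.Homog s b) (hb' : C'.Homog s b') (hr : C.r b = b) (hr' : C'.r b' = b')
    (h₁ : ∀ {a a'}, P a a' → FormRel C C' P (C.kos w a b) (C'.kos w' a' b'))
    (h₂ : ∀ {a a'}, FormRel C C' P a a' →
      FormRel C C' P (C.kos w a (C.lft b)) (C'.kos w' a' (C'.lft b')))
    (h : FormRel C C' P a a') : FormRel C C' P (C.kos w a b) (C'.kos w' a' b') := by
  induction h with
  | fn h => exact h₁ h
  | add _ _ k₁ k₂ => rw [C.kos_add_left, C'.kos_add_left]; exact k₁.add k₂
  | mul h₁ h₂ k₁ k₂ =>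
    rw [kos_mul hw hb (h₁.r_eq hP).1 (h₂.r_eq hP).1 hr,
      kos_mul hw' hb' (h₁.r_eq hP).2 (h₂.r_eq hP).2 hr']
    exact (k₁.mul (h₂.tau hP _)).add ((h₁.tau hP _).mul k₂)
  | d h k =>
    rw [C.r_lft_of_r (h.r_eq hP).1, C'.r_lft_of_r (h.r_eq hP).2, kos_lft_left, kos_lft_left]
    refine FormRel.sub hP ?_ (h₂ (h.inv hP))
    refine FormRel.neg hP (FormRel.d ?_)
    rw [hw, hw']
    cases p
    · exact k
    · simp only [if_true, kos_neg_weight]; exact k.neg hP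

/-- The weak Koszul bracket respects the correspondence of forms as soon as the double odd bracket
with `w` respects the correspondence of functions. -/
theorem kos (hP : FnRel C C' P) (hw : C.Homog p w) (hw' : C'.Homog p w')
    (hn : C.NoVel w) (hn' : C'.NoVel w')
    (hK : ∀ {a a' b b'}, P a a' → P b b' → P (C.r (C.br (C.lft (C.br (C.lft w) a)) b))
      (C'.r (C'.br (C'.lft (C'.br (C'.lft w') a')) b')))
    (h₁ : FormRel C C' P a a') (h₂ : FormRel C C' P b b') :
    FormRel C C' P (C.kos w a b) (C'.kos w' a' b') := by
  -- This stops the recursion of `kos_of_fn_of_lft` after one step, because `d² = 0`.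
  have zero_of_lft : ∀ {b b' a a'}, FormRel C C' P (C.kos w a (C.lft (C.lft b)))
      (C'.kos w' a' (C'.lft (C'.lft b'))) := by
    intro b b' a a'
    simpa [lft_lft, SuperCalculus.kos] using zero hP
  -- Second argument `db` with `b` a function. For a function in the first argument, symmetry turns
  -- the bracket into `[db,a']` with `a'` the twist of `a`, a double odd bracket covered by `hK`.
  have fn_lft : ∀ {s b b' a a'}, P b b' → C.Homog s b → C'.Homog s b' → FormRel C C' P a a' →
      FormRel C C' P (C.kos w a (C.lft b)) (C'.kos w' a' (C'.lft b')) := by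
    intro s b b' a a' h hb hb' ha
    have hr := ((FormRel.fn h).lft hP).r_eq hP
    refine kos_of_fn_of_lft hP hw hw' hb.lft hb'.lft hr.1 hr.2 (fun {a a'} ha => ?_)
      (fun _ => zero_of_lft) ha
    rw [kos_symm hw hb.lft (hP.r_eq ha) hr.1, kos_symm hw' hb'.lft (hP.r_eq' ha) hr.2,
      kos_lft_of_fn, kos_lft_of_fn, hw, hw']
    have := FormRel.fn (C := C) (C' := C') (hK h (hP.tau ha (!s)))
    cases p
    · exact this.neg hP
    · simpa [SuperCalculus.lft, br_neg_left, br_neg_right] using this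
  -- Second argument a function: two functions have zero bracket, and the companion case is
  -- `fn_lft`.
  have fn_homog : ∀ {s b b' a a'}, P b b' → C.Homog s b → C'.Homog s b' → FormRel C C' P a a' →
      FormRel C C' P (C.kos w a b) (C'.kos w' a' b') := by
    intro s b b' a a' h hb hb' ha
    refine kos_of_fn_of_lft hP hw hw' hb hb' (hP.r_eq h) (hP.r_eq' h) (fun {a a'} ha => ?_)
      (fun ha => fn_lft h hb hb' ha) ha
    rw [C.kos_of_noVel hn (hP.noVel ha) (hP.noVel h),
      C'.kos_of_noVel hn' (hP.noVel' ha) (hP.noVel' h)]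
    exact zero hP
  have fn : ∀ {b b' a a'}, P b b' → FormRel C C' P a a' →
      FormRel C C' P (C.kos w a b) (C'.kos w' a' b') := by
    intro b b' a a' h ha
    rw [← C.part_add_part b, ← C'.part_add_part b', C.kos_add_right, C'.kos_add_right]
    exact (fn_homog (hP.part h _) (C.homog_part _ _) (C'.homog_part _ _) ha).add
      (fn_homog (hP.part h _) (C.homog_part _ _) (C'.homog_part _ _) ha)
  -- Symmetry transfers the case of a function in the second argument to a function in the first.
  have symm : ∀ {s b b' a a'}, FormRel C C' P b b' → C.Homog s b → C'.Homog s b' → P a a' →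
      FormRel C C' P (C.kos w a b) (C'.kos w' a' b') := by
    intro s b b' a a' h hb hb' ha
    rw [kos_symm hw hb (hP.r_eq ha) (h.r_eq hP).1, kos_symm hw' hb' (hP.r_eq' ha) (h.r_eq hP).2]
    exact fn (hP.tau ha _) h
  -- General forms: both the base case for `b` and the one for `lft b` are instances of `symm`.
  have homog : ∀ {s b b' a a'}, FormRel C C' P b b' → C.Homog s b → C'.Homog s b' →
      FormRel C C' P a a' → FormRel C C' P (C.kos w a b) (C'.kos w' a' b') := by
    intro s b b' a a' h hb hb' ha
    have hl := h.lft hP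
    exact kos_of_fn_of_lft hP hw hw' hb hb' (h.r_eq hP).1 (h.r_eq hP).2 (symm h hb hb')
      (kos_of_fn_of_lft hP hw hw' hb.lft hb'.lft (hl.r_eq hP).1 (hl.r_eq hP).2
        (symm hl hb.lft hb'.lft) fun _ => zero_of_lft) ha
  rw [← C.part_add_part b, ← C'.part_add_part b', C.kos_add_right, C'.kos_add_right]
  exact (homog (h₂.part hP _) (C.homog_part _ _) (C'.homog_part _ _) h₁).add
    (homog (h₂.part hP _) (C.homog_part _ _) (C'.homog_part _ _) h₁)

end FormRel

end SuperCalculus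

/-! ## Forms on the supermanifold -/

section Charts

variable {M : Type*} [TopologicalSpace M] [ChartedSpace (Fin n → ℝ) M]
  {E : M → Type*} [TopologicalSpace (TotalSpace (Fin m → ℝ) E)]
  [∀ p, AddCommGroup (E p)] [∀ p, Module ℝ (E p)] [∀ p, TopologicalSpace (E p)]
  [FiberBundle (Fin m → ℝ) E] [VectorBundle ℝ (Fin m → ℝ) E]
  {F : M → Type*} [TopologicalSpace (TotalSpace (Fin k → ℝ) F)]
  [∀ p, AddCommGroup (F p)] [∀ p, Module ℝ (F p)] [∀ p, TopologicalSpace (F p)]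
  [FiberBundle (Fin k → ℝ) F] [VectorBundle ℝ (Fin k → ℝ) F]

variable {c c' : SuperChart n m k E F} {D : Opens M} {θ θ' σ σ' W W' : SFun n m k} {p : Bool}

variable (c c' D) in
/-- The correspondence between functions on `𝓜` over `D` in two coordinate systems. -/
def FnTrans (a : SmoothAlg m k (c.xRegion D)) (a' : SmoothAlg m k (c'.xRegion D)) : Prop :=
  ∃ f f', IsFnM (c.xRegion D) f ∧ IsFnM (c'.xRegion D) f' ∧
    EqOn f (pullback c c' f') (c.region D) ∧ Rep f a ∧ Rep f' a'

variable (c c' D) in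
/-- The correspondence between differential forms on `𝓜` over `D` in two coordinate systems. -/
abbrev FormTransAlg (a : SmoothAlg m k (c.xRegion D)) (a' : SmoothAlg m k (c'.xRegion D)) : Prop :=
  SuperCalculus.FormRel (smoothCalc m k (c.xRegion D)) (smoothCalc m k (c'.xRegion D))
    (FnTrans c c' D) a a'

section

variable {X : Opens (Fin n → ℝ)} {f g : SFun n m k}

lemma IsFnM.add (hf : IsFnM X f) (hg : IsFnM X g) : IsFnM X (f + g) :=
  ⟨hf.smooth.add hg.smooth, fun u hu => by
    have h₁ := hf.restrict hu
    have h₂ := hg.restrict hu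
    rw [restrictM_eq, setToZero_apply] at *
    rw [Pi.add_apply, map_add, h₁, h₂]; rfl⟩

lemma IsFnM.smul (t : ℝ) (hf : IsFnM X f) : IsFnM X (t • f) :=
  ⟨hf.smooth.linear (t • LinearMap.id), fun u hu => by
    have h₁ := hf.restrict hu
    rw [restrictM_eq, setToZero_apply] at *
    rw [Pi.smul_apply, map_smul, h₁]; rfl⟩

lemma isFnM_one : IsFnM X (1 : SFun n m k) :=
  ⟨smoothOn_const 1, fun u _ => by rw [restrictM_eq, setToZero_apply]; exact map_one _⟩

end

lemma fnRel_fnTrans : SuperCalculus.FnRel (smoothCalc m k (c.xRegion D))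
    (smoothCalc m k (c'.xRegion D)) (FnTrans c c' D) where
  one := ⟨1, 1, isFnM_one, isFnM_one, fun u _ => (map_one _).symm, Rep.one, Rep.one⟩
  add := by
    rintro a a' b b' ⟨f, f', hf, hf', e, ha, ha'⟩ ⟨g, g', hg, hg', e₂, hb, hb'⟩
    refine ⟨_, _, hf.add hg, hf'.add hg', fun u hu => ?_, ha.add hb, ha'.add hb'⟩
    rw [pullback_add, Pi.add_apply, Pi.add_apply, e hu, e₂ hu]
  smul := by
    rintro t a a' ⟨f, f', hf, hf', e, ha, ha'⟩
    refine ⟨_, _, hf.smul t, hf'.smul t, fun u hu => ?_, ha.smul t, ha'.smul t⟩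
    rw [pullback_apply, Pi.smul_apply, Pi.smul_apply, map_smul, e hu]; rfl
  inv := by
    rintro a a' ⟨f, f', hf, hf', e, ha, ha'⟩
    refine ⟨_, _, hf.parityInv, hf'.parityInv, ?_, ha.inv, ha'.inv⟩
    rw [pullback_parityInv]; exact parityInv_congr (X := c.xRegion D) e
  noVel := by
    rintro a a' ⟨f, f', hf, hf', e, ha, ha'⟩
    exact noVel_of_rep ha hf.isFnN.restrict
  noVel' := by
    rintro a a' ⟨f, f', hf, hf', e, ha, ha'⟩
    exact noVel_of_rep ha' hf'.isFnN.restrict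
  r_eq := by
    rintro a a' ⟨f, f', hf, hf', e, ha, ha'⟩
    exact (ha.r.eqOn_iff ha).1 hf.restrictL
  r_eq' := by
    rintro a a' ⟨f, f', hf, hf', e, ha, ha'⟩
    exact (ha'.r.eqOn_iff ha').1 hf'.restrictL

lemma FormTrans.exists_rep (h : FormTrans c c' D θ θ') :
    ∃ a a', Rep θ a ∧ Rep θ' a' ∧ FormTransAlg c c' D a a' := by
  induction h with
  | fn f f' hf hf' hM hM' h =>
    obtain ⟨a, ha⟩ := SmoothOn.exists_rep (X := c.xRegion D) hf
    obtain ⟨a', ha'⟩ := SmoothOn.exists_rep (X := c'.xRegion D) hf'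
    exact ⟨a, a', ha, ha', .fn ⟨f, f', ⟨hf, hM⟩, ⟨hf', hM'⟩, h, ha, ha'⟩⟩
  | add _ _ h₁ h₂ =>
    obtain ⟨a, a', ha, ha', h⟩ := h₁
    obtain ⟨b, b', hb, hb', h'⟩ := h₂
    exact ⟨_, _, ha.add hb, ha'.add hb', h.add h'⟩
  | mul _ _ h₁ h₂ =>
    obtain ⟨a, a', ha, ha', h⟩ := h₁
    obtain ⟨b, b', hb, hb', h'⟩ := h₂
    exact ⟨_, _, ha.mul hb, ha'.mul hb', h.mul h'⟩
  | d _ h =>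
    obtain ⟨a, a', ha, ha', h⟩ := h
    exact ⟨_, _, ha.extDeriv, ha'.extDeriv, h.d⟩
  | congr _ e e' h =>
    obtain ⟨a, a', ha, ha', h⟩ := h
    exact ⟨a, a', ha.congr e, ha'.congr e', h⟩

/-- Together with `FormTrans.exists_rep`, this moves the correspondence to the algebras. Arbitrary
representatives are reached through `FormTrans.congr`. -/
lemma FormTrans.of_rep {a : SmoothAlg m k (c.xRegion D)} {a' : SmoothAlg m k (c'.xRegion D)}
    (h : FormTransAlg c c' D a a') (ha : Rep θ a) (ha' : Rep θ' a') :
    FormTrans c c' D θ θ' := by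
  induction h generalizing θ θ' with
  | fn h =>
    obtain ⟨f, f', hf, hf', e, hr, hr'⟩ := h
    exact .congr (.fn f f' hf.smooth hf'.smooth hf.restrict hf'.restrict e)
      ((hr.eqOn_iff ha).2 rfl) ((hr'.eqOn_iff ha').2 rfl)
  | @add a a' b b' _ _ h₁ h₂ =>
    obtain ⟨f, hf⟩ := WeakKoszul.exists_rep a
    obtain ⟨f', hf'⟩ := WeakKoszul.exists_rep a'
    obtain ⟨g, hg⟩ := WeakKoszul.exists_rep b
    obtain ⟨g', hg'⟩ := WeakKoszul.exists_rep b'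
    exact .congr (.add (h₁ hf hf') (h₂ hg hg')) (((hf.add hg).eqOn_iff ha).2 rfl)
      (((hf'.add hg').eqOn_iff ha').2 rfl)
  | @mul a a' b b' _ _ h₁ h₂ =>
    obtain ⟨f, hf⟩ := WeakKoszul.exists_rep a
    obtain ⟨f', hf'⟩ := WeakKoszul.exists_rep a'
    obtain ⟨g, hg⟩ := WeakKoszul.exists_rep b
    obtain ⟨g', hg'⟩ := WeakKoszul.exists_rep b'
    exact .congr (.mul (h₁ hf hf') (h₂ hg hg')) (((hf.mul hg).eqOn_iff ha).2 rfl)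
      (((hf'.mul hg').eqOn_iff ha').2 rfl)
  | @d a a' _ h =>
    obtain ⟨f, hf⟩ := WeakKoszul.exists_rep a
    obtain ⟨f', hf'⟩ := WeakKoszul.exists_rep a'
    exact .congr (.d (h hf hf')) ((hf.extDeriv.eqOn_iff ha).2 rfl)
      ((hf'.extDeriv.eqOn_iff ha').2 rfl)

lemma FormTrans.sub (h₁ : FormTrans c c' D θ θ') (h₂ : FormTrans c c' D σ σ') :
    FormTrans c c' D (θ - σ) (θ' - σ') := by
  obtain ⟨a, a', ha, ha', h⟩ := h₁.exists_rep
  obtain ⟨b, b', hb, hb', h'⟩ := h₂.exists_rep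
  exact .of_rep (h.sub fnRel_fnTrans h') (ha.sub hb) (ha'.sub hb')

lemma FormTrans.neg (h₁ : FormTrans c c' D θ θ') : FormTrans c c' D (-θ) (-θ') := by
  obtain ⟨a, a', ha, ha', h⟩ := h₁.exists_rep
  exact .of_rep (h.neg fnRel_fnTrans) ha.neg ha'.neg

lemma FormTrans.parityInv (h₁ : FormTrans c c' D θ θ') :
    FormTrans c c' D (parityInv θ) (parityInv θ') := by
  obtain ⟨a, a', ha, ha', h⟩ := h₁.exists_rep
  exact .of_rep (h.inv fnRel_fnTrans) ha.inv ha'.inv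

lemma FormTrans.mono {D D' : Set M} (h : FormTrans c c' D θ θ') (hD : D' ⊆ D) :
    FormTrans c c' D' θ θ' := by
  have hr : ∀ c : SuperChart n m k E F, c.region D' ⊆ c.region D := fun c u hu =>
    ⟨hu.1, hD hu.2⟩
  induction h with
  | fn f f' hf hf' hM hM' h =>
    exact .fn f f' (hf.mono (hr c)) (hf'.mono (hr c')) (hM.mono (hr c)) (hM'.mono (hr c'))
      (h.mono (hr c))
  | add _ _ h₁ h₂ => exact h₁.add h₂
  | mul _ _ h₁ h₂ => exact h₁.mul h₂
  | d _ h => exact h.d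
  | congr _ e e' h => exact h.congr (e.mono (hr c)) (e'.mono (hr c'))

lemma homog_of_rep {X : Opens (Fin n → ℝ)} {a : SmoothAlg m k X} (ha : Rep W a)
    (h : EqOn (parityInv W) (if p then -W else W) (cyl m k X)) :
    (smoothCalc m k X).Homog p a := by
  cases p
  · exact (ha.inv.eqOn_iff ha).1 h
  · exact (ha.inv.eqOn_iff ha.neg).1 h

section Invariance

variable [IsManifold 𝓘(ℝ, Fin n → ℝ) ∞ M]
  [ContMDiffVectorBundle ∞ (Fin m → ℝ) E 𝓘(ℝ, Fin n → ℝ)]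
  [ContMDiffVectorBundle ∞ (Fin k → ℝ) F 𝓘(ℝ, Fin n → ℝ)]

lemma FormTrans.koszul (hD : (D : Set M) ⊆ c.base ∩ c'.base)
    (hW : IsFnN (c.xRegion D) W) (hW' : IsFnN (c'.xRegion D) W')
    (e : EqOn W (pullback c c' W') (c.region D))
    (hp : EqOn (WeakKoszul.parityInv W) (if p then -W else W) (c.region D))
    (hp' : EqOn (WeakKoszul.parityInv W') (if p then -W' else W') (c'.region D))
    (h₁ : FormTrans c c' D θ θ') (h₂ : FormTrans c c' D σ σ') :
    FormTrans c c' D (koszul W θ σ) (koszul W' θ' σ') := by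
  obtain ⟨a, a', ha, ha', h⟩ := h₁.exists_rep
  obtain ⟨b, b', hb, hb', h'⟩ := h₂.exists_rep
  obtain ⟨w, hw⟩ := hW.smooth.exists_rep
  obtain ⟨w', hw'⟩ := hW'.smooth.exists_rep
  refine .of_rep (SuperCalculus.FormRel.kos fnRel_fnTrans (homog_of_rep hw hp)
    (homog_of_rep hw' hp') (noVel_of_rep hw hW.restrict) (noVel_of_rep hw' hW'.restrict) ?_ h h')
    (hw.koszul ha hb) (hw'.koszul ha' hb')
  rintro a a' b b' ⟨f, f', hf, hf', ef, ha, ha'⟩ ⟨g, g', hg, hg', eg, hb, hb'⟩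
  -- Invariance is used twice; `IsFnN.oddBracket` makes the inner bracket an admissible first
  -- argument.
  have e₂ := oddBracket_eqOn_pullback hD (hW.oddBracket hf) (hW'.oddBracket hf') hg hg'
    (oddBracket_eqOn_pullback hD hW hW' hf hf' e ef) eg
  have hB := (hW.oddBracket hf).oddBracket hg
  have hB' := (hW'.oddBracket hf').oddBracket hg'
  -- The double odd bracket is a function on `𝓝`, so restricting it to `𝓛` is restricting it to `𝓜`,
  -- which commutes with pullback.
  refine ⟨_, _, hB.restrictM, hB'.restrictM, ?_,
    ((hw.oddBracket ha).oddBracket hb).r.congr hB.restrictL,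
    ((hw'.oddBracket ha').oddBracket hb').r.congr hB'.restrictL⟩
  rw [← restrictM_pullback]
  exact restrictM_congr (X := c.xRegion D) e₂

end Invariance

/-! ### Global forms -/

variable {S V θ τ : SuperChart n m k E F → SFun n m k}

lemma IsForm.sub (hθ : IsForm θ) (hτ : IsForm τ) : IsForm fun c => θ c - τ c := by
  intro c c' x hx
  obtain ⟨D₁, ho₁, hx₁, hD₁, h₁⟩ := hθ c c' x hx
  obtain ⟨D₂, ho₂, hx₂, hD₂, h₂⟩ := hτ c c' x hx
  exact ⟨D₁ ∩ D₂, ho₁.inter ho₂, ⟨hx₁, hx₂⟩, inter_subset_left.trans hD₁,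
    FormTrans.sub (D := ⟨D₁ ∩ D₂, ho₁.inter ho₂⟩) (h₁.mono inter_subset_left)
      (h₂.mono inter_subset_right)⟩

lemma IsForm.neg (hθ : IsForm θ) : IsForm fun c => -θ c := by
  intro c c' x hx
  obtain ⟨D, ho, hx, hD, h⟩ := hθ c c' x hx
  exact ⟨D, ho, hx, hD, FormTrans.neg (D := ⟨D, ho⟩) h⟩

lemma IsForm.parityInv (hθ : IsForm θ) : IsForm fun c => parityInv (θ c) := by
  intro c c' x hx
  obtain ⟨D, ho, hx, hD, h⟩ := hθ c c' x hx
  exact ⟨D, ho, hx, hD, FormTrans.parityInv (D := ⟨D, ho⟩) h⟩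

lemma SuperChart.region_mono (c : SuperChart n m k E F) {D D' : Set M} (h : D ⊆ D') :
    c.region D ⊆ c.region D' := fun _ hu => ⟨hu.1, h hu.2⟩

lemma IsForm.koszul [IsManifold 𝓘(ℝ, Fin n → ℝ) ∞ M]
    [ContMDiffVectorBundle ∞ (Fin m → ℝ) E 𝓘(ℝ, Fin n → ℝ)]
    [ContMDiffVectorBundle ∞ (Fin k → ℝ) F 𝓘(ℝ, Fin n → ℝ)] (hV : IsFunctionN V)
    (hp : ∀ c, EqOn (WeakKoszul.parityInv (V c)) (if p then -V c else V c) c.dom)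
    (hθ : IsForm θ) (hτ : IsForm τ) : IsForm fun c => koszul (V c) (θ c) (τ c) := by
  intro c c' x hx
  obtain ⟨D₁, ho₁, hx₁, hD₁, h₁⟩ := hθ c c' x hx
  obtain ⟨D₂, ho₂, hx₂, hD₂, h₂⟩ := hτ c c' x hx
  have hD : D₁ ∩ D₂ ⊆ c.base ∩ c'.base := inter_subset_left.trans hD₁
  have hr := c.region_mono (hD.trans inter_subset_left)
  have hr' := c'.region_mono (hD.trans inter_subset_right)
  exact ⟨D₁ ∩ D₂, ho₁.inter ho₂, ⟨hx₁, hx₂⟩, hD,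
    FormTrans.koszul (D := ⟨D₁ ∩ D₂, ho₁.inter ho₂⟩) hD
      ⟨(hV.smooth c).mono hr, (hV.noVelocity c).mono hr⟩
      ⟨(hV.smooth c').mono hr', (hV.noVelocity c').mono hr'⟩
      ((hV.glue c c').mono (c.region_mono hD)) ((hp c).mono hr) ((hp c').mono hr')
      (h₁.mono inter_subset_left) (h₂.mono inter_subset_right)⟩

/-- The coordinates `x` in the domain of the coordinate system. -/
abbrev SuperChart.xDom (c : SuperChart n m k E F) : Opens (Fin n → ℝ) :=
  c.xRegion ⟨c.base, c.isOpen_base⟩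

/-- Smoothness is local, so the correspondence of a chart with itself near each point suffices. -/
lemma IsForm.smoothOn (hθ : IsForm θ) (c : SuperChart n m k E F) :
    SmoothOn (θ c) (cyl m k c.xDom) := by
  intro l u hu
  obtain ⟨D, ho, hx, hD, h⟩ := hθ c c (c.point u) ⟨hu.2, hu.2⟩
  obtain ⟨a, a', ha, -⟩ := FormTrans.exists_rep (D := ⟨D, ho⟩) h
  exact ((ha.smoothOn l).contDiffAt
    ((isOpen_region (c := c) (D := ⟨D, ho⟩)).mem_nhds ⟨hu.1, hx⟩)).contDiffWithinAt

/-- Without velocities, vanishing for `φ* = 0` is the same as vanishing on `𝓛`. -/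
lemma IsFunctionN.restrictL_eq (hS : IsFunctionN S)
    (h : ∀ c, EqOn (restrictM (S c)) 0 c.dom) (c : SuperChart n m k E F) :
    EqOn (restrictL (S c)) 0 (cyl m k c.xDom) :=
  (IsFnN.restrictL ⟨hS.smooth c, hS.noVelocity c⟩).trans (h c)

end Charts

end

end WeakKoszul

/-! ### The global statement -/

theorem proposition4 {n m k : ℕ}
    {M : Type*} [TopologicalSpace M] [ChartedSpace (Fin n → ℝ) M]
    [IsManifold 𝓘(ℝ, Fin n → ℝ) ∞ M]
    {E : M → Type*} [TopologicalSpace (TotalSpace (Fin m → ℝ) E)]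
    [∀ p, AddCommGroup (E p)] [∀ p, Module ℝ (E p)] [∀ p, TopologicalSpace (E p)]
    [FiberBundle (Fin m → ℝ) E] [VectorBundle ℝ (Fin m → ℝ) E]
    [ContMDiffVectorBundle ∞ (Fin m → ℝ) E 𝓘(ℝ, Fin n → ℝ)]
    {F : M → Type*} [TopologicalSpace (TotalSpace (Fin k → ℝ) F)]
    [∀ p, AddCommGroup (F p)] [∀ p, Module ℝ (F p)] [∀ p, TopologicalSpace (F p)]
    [FiberBundle (Fin k → ℝ) F] [VectorBundle ℝ (Fin k → ℝ) F]
    [ContMDiffVectorBundle ∞ (Fin k → ℝ) F 𝓘(ℝ, Fin n → ℝ)]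
    (S V θ τ : SuperChart n m k E F → SFun n m k)
    (hS : IsMasterFunction S) (hV : IsWeakPoissonField S V)
    (hθ : IsProjectibleForm S θ) (hτ : IsProjectibleForm S τ)
    (hVθ : ZeroInCohomology S (fun c => lieDer (V c) (θ c)))
    (hVτ : ZeroInCohomology S (fun c => lieDer (V c) (τ c))) :
    IsProjectibleForm S (fun c => koszul (S c) (θ c) (τ c)) ∧
      ZeroInCohomology S (fun c => lieDer (V c) (koszul (S c) (θ c) (τ c))) := by
  obtain ⟨α, hα, eα⟩ := hVθ
  obtain ⟨β, hβ, eβ⟩ := hVτ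
  have kS {θ τ : SuperChart n m k E F → SFun n m k} (h₁ : IsForm θ) (h₂ : IsForm τ) :
      IsForm fun c => koszul (S c) (θ c) (τ c) :=
    IsForm.koszul (p := false) hS.toIsFunctionN hS.even h₁ h₂
  have kV := IsForm.koszul (p := true) hV.toIsFunctionN hV.odd hθ.isForm hτ.isForm
  -- The global primitive is the one of `r_br_field_kos`, taken in every chart; each of its three
  -- terms is a global form by `IsForm.koszul`.
  refine ⟨⟨kS hθ.isForm hτ.isForm, fun c => ?_⟩,
    ⟨fun c => -koszul (V c) (θ c) (τ c) - koszul (S c) (α c) (τ c) -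
      koszul (S c) (parityInv (θ c)) (β c),
      (kV.neg.sub (kS hα hτ.isForm)).sub (kS hθ.isForm.parityInv hβ), fun c => ?_⟩⟩
  -- The remaining equations concern one chart at a time, so they and the hypotheses are transported
  -- to the algebra over its domain.
  all_goals
    obtain ⟨s, hs⟩ := SmoothOn.exists_rep (X := c.xDom) (hS.smooth c)
    obtain ⟨t, ht⟩ := (hθ.isForm.smoothOn c).exists_rep
    obtain ⟨r, hr⟩ := (hτ.isForm.smoothOn c).exists_rep
    have hs₀ : (smoothCalc m k c.xDom).Homog false s := homog_of_rep hs (hS.even c)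
    have hsr := (hs.r.eqOn_iff Rep.zero).1 (hS.restrictL_eq hS.momentum c)
    have hss := ((hs.oddBracket hs).eqOn_iff Rep.zero).1 (hS.master c)
    have hct := ((hs.lift.bracket ht).r.eqOn_iff Rep.zero).1 (hθ.cocycle c)
    have hcr := ((hs.lift.bracket hr).r.eqOn_iff Rep.zero).1 (hτ.cocycle c)
  · exact ((hs.lift.bracket (hs.koszul ht hr)).r.eqOn_iff Rep.zero).2
      ((smoothCalc m k c.xDom).r_br_kos hs₀ hsr hss hct hcr)
  · obtain ⟨v, hv⟩ := SmoothOn.exists_rep (X := c.xDom) (hV.smooth c)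
    obtain ⟨a, ha⟩ := (hα.smoothOn c).exists_rep
    obtain ⟨b, hb⟩ := (hβ.smoothOn c).exists_rep
    have hv₁ : (smoothCalc m k c.xDom).Homog true v := homog_of_rep hv (hV.odd c)
    have hvr := (hv.r.eqOn_iff Rep.zero).1 (hV.restrictL_eq hV.momentum c)
    have hsv := ((hs.oddBracket hv).eqOn_iff Rep.zero).1 (hV.master c)
    have hA := ((hv.lift.bracket ht).r.neg.eqOn_iff (hs.lift.bracket ha).r).1 (eα c)
    have hB := ((hv.lift.bracket hr).r.neg.eqOn_iff (hs.lift.bracket hb).r).1 (eβ c)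
    exact ((hv.lift.bracket (hs.koszul ht hr)).r.neg.eqOn_iff
      (hs.lift.bracket (((hv.koszul ht hr).neg.sub (hs.koszul ha hr)).sub
        (hs.koszul ht.inv hb))).r).2
      ((smoothCalc m k c.xDom).r_br_field_kos hs₀ hsr hss hv₁ hvr hsv hct hcr hA hB)
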